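/- **Notation.** $\mathbb N=\{1,2,\dots\}$, $\|\cdot\|$ and $\langle\cdot,\cdot\rangle$ are the Euclidean norm and inner product, and $W^{k,\infty}(I,\mathbb R^n)$ is the space of functions that are essentially bounded on the interval $I$ together with their weak derivatives up to order $k$ (for $k\ge1$ we always use the continuous representative). **System class.** Let $m,r\in\mathbb N$. A system $(d,f,\mathbf T)\in\mathcal N^{m,r}$ is $$y^{(r)}(t)=f\big(d(t),\mathbf T(y,\dot y,\dots,y^{(r-1)})(t),u(t)\big),\qquad y|_{[-h,0]}=y^0\in C^{r-1}([-h,0],\mathbb R^m),\tag{1}$$ with $h\ge0$ (if $h=0$, the initial datum consists of the values $y(0),\dots,y^{(r-1)}(0)$) and dimensions $p,q$, where: * $d\in L^\infty(\mathbb R_{\ge0},\mathbb R^p)$. * $f\in C(\mathbb R^p\times\mathbb R^q\times\mathbb R^m,\mathbb R^m)$ has the *high-gain property*: there is $v^*\in(0,1)$ such that for all non-empty compact $K_p\subset\mathbb R^p$, $K_q\subset\mathbb R^q$, the function $\chi(s)=\min\{\langle v,f(\delta,z,-sv)\rangle : (\delta,z)\in K_p\times K_q,\ v^*\le\|v\|\le1\}$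 satisfies $\sup_{s\in\mathbb R}\chi(s)=\infty$. If, for some $v^*\in(0,1)$, $\sup_{s>0}\chi(s)=\infty$ for all such $K_p,K_q$ (respectively $\sup_{s<0}\chi(s)=\infty$ for all such $K_p,K_q$), then $f$ has the *negative-definite* (respectively *positive-definite*) high-gain property. * $\mathbf T\colon C([-h,\infty),\mathbb R^{rm})\to L^\infty_{\rm loc}(\mathbb R_{\ge0},\mathbb R^q)$ is (TP1) causal: for all $t\ge0$, $\zeta|_{[-h,t]}=\theta|_{[-h,t]}$ implies $\mathbf T(\zeta)|_{[0,t]}=\mathbf T(\theta)|_{[0,t]}$; (TP2) locally Lipschitz: for all $t\ge0$ and $\xi\in C([-h,t],\mathbb R^{rm})$ there are $c_0,\delta,\tau>0$ such that, for all $\zeta_1,\zeta_2$ with $\zeta_i|_{[-h,t]}=\xi$ and $\|\zeta_i(s)-\xi(t)\|<\delta$ on $[t,t+\tau]$, one has $\operatorname{ess\,sup}_{[t,t+\tau]}\|\mathbf T(\zeta_1)-\mathbf T(\zeta_2)\|\le c_0\sup_{[t,t+\tau]}\|\zeta_1-\zeta_2\|$; (TP3) BIBO: for each $c_1>0$ there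 is $c_2>0$ such that $\sup_{t\ge-h}\|\zeta(t)\|<c_1$ implies $\operatorname{ess\,sup}_{t\ge0}\|\mathbf T(\zeta)(t)\|<c_2$. **Reference and design parameters.** Let $y_{\rm ref}\in W^{r,\infty}(\mathbb R_{\ge0},\mathbb R^m)$, $\hat r\in\{1,\dots,r\}$, $e=y-y_{\rm ref}$ on $\mathbb R_{\ge 0}$ and $$\mathbf e=(e,\dot e,\dots,e^{(\hat r-1)},y^{(\hat r)},\dots,y^{(r-1)}).$$ Choose: * $\varphi\in\Phi$, bounded if $\hat r<r$. Here $\Phi$ is the set of locally absolutely continuous $\varphi\colon\mathbb R_{\ge0}\to\mathbb R_{\ge0}$ with $\varphi(t)>0$ for $t>0$, $\liminf_{t\to\infty}\varphi(t)>0$, and $|\dot\varphi(t)|\le c(1+\varphi(t))$ for a.a. $t\ge0$ and some $c>0$. * a continuous surjection $N\colon\mathbb R_{\ge0}\to\mathbb R$; * a bijection $\alpha\in C^1([0,1),[1,\infty))$. With $\mathcal B=\{w\in\mathbb R^m:\|w\|<1\}$ and $\gamma(w)=\alpha(\|w\|^2)w$ for $w\in\mathcal B$, set $\mathcal D_1=\mathcal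 B$, $\rho_1(\eta_1)=\eta_1$, and for $k\ge2$ let $\mathcal D_k$ be the set of $(\eta_1,\dots,\eta_k)$ with $(\eta_1,\dots,\eta_{k-1})\in\mathcal D_{k-1}$ and $\rho_k(\eta_1,\dots,\eta_k):=\eta_k+\gamma(\rho_{k-1}(\eta_1,\dots,\eta_{k-1}))\in\mathcal B$. The funnel controller is $$u(t)=(N\circ\alpha)(\|w(t)\|^2)\,w(t),\qquad w(t)=\rho_r(\varphi(t)\mathbf e(t)).\tag{2}$$ A *solution* of (1), (2) on $[-h,\omega)$, $\omega\in(0,\infty]$, is a function $y\in C^{r-1}([-h,\omega),\mathbb R^m)$ with $y|_{[-h,0]}=y^0$ such that $y^{(r-1)}|_{[0,\omega)}$ is locally absolutely continuous, $\varphi(t)\mathbf e(t)\in\mathcal D_r$ for all $t\in[0,\omega)$, and (1), (2) hold for a.a. $t\in[0,\omega)$. (By causality, $\mathbf T$ is applied on $[0,\tau]$, $\tau<\omega$, to the extension of $(y,\dots,y^{(r-1)})|_{[-h,\tau]}$ by its constant value at $\tau$.) It is *maximal* if it has no proper right extension that is a solution. **Theorem.** Assume $\varphi(0)\mathbf e(0)\in\mathcal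 D_r$. Then the closed-loop initial-value problem (1), (2) has a solution, every solution can be extended to a maximal one, and every maximal solution $y\colon[-h,\omega)\to\mathbb R^m$ has the following properties. 1. $\omega=\infty$. 2. $u\in L^\infty(\mathbb R_{\ge0},\mathbb R^m)$; $y\in W^{r,\infty}(\mathbb R_{\ge0},\mathbb R^m)$; the derivatives $y,\dots,y^{(r-1)}$ are bounded on $[-h,\infty)$; and if $y^0\in W^{r,\infty}([-h,0],\mathbb R^m)$, then $y\in W^{r,\infty}([-h,\infty),\mathbb R^m)$. 3. There is $\varepsilon\in(0,1)$ with $\varphi(t)\|e(t)\|\le\varepsilon$ for all $t\ge0$. 4. If $\hat r=r$ then, for $k=0,\dots,r-1$, $e^{(k)}(t_n)\to0$ along every sequence $t_n\ge0$ with $\varphi(t_n)\to\infty$; in particular, if $\varphi(t)\to\infty$ as $t\to\infty$, then $e^{(k)}(t)\to0$ as $t\to\infty$. 5. If $f$ has the negative-definite (respectively positive-definite) high-gain property, then all of the above (existence, maximal extension and 1–4) remains true when $N$ is replaced by $s\mapsto s$ (respectively $s\mapsto-s$). -/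

import Mathlib

open Set Filter Topology MeasureTheory

noncomputable section

namespace FunnelControl

/-- `ℝⁿ` with the Euclidean norm and inner product. -/
abbrev E (n : ℕ) := EuclideanSpace ℝ (Fin n)

/-- `ℝ^{rm}`, written as `r` blocks from `ℝᵐ`, with the Euclidean norm. -/
abbrev Blocks (r m : ℕ) := PiLp 2 (fun _ : Fin r => E m)

/-! ### Function spaces -/

/-- `g'` is a weak derivative of `g` on the interval `I`. -/
def IsWeakDeriv {n : ℕ} (I : Set ℝ) (g g' : ℝ → E n) : Prop :=
  ∀ ψ : ℝ → ℝ, ContDiff ℝ ((⊤ : ℕ∞) : WithTop ℕ∞) ψ → HasCompactSupport ψ →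
    tsupport ψ ⊆ interior I →
    ∫ t in I, deriv ψ t • g t = - ∫ t in I, ψ t • g' t

/-- The Sobolev space `W^{k,∞}(I, ℝⁿ)`: the function and its weak derivatives `G 1, …, G k` up to
order `k` are measurable and essentially bounded on `I`. -/
def MemWInf {n : ℕ} (k : ℕ) (I : Set ℝ) (g : ℝ → E n) : Prop :=
  ∃ G : ℕ → ℝ → E n, G 0 = g ∧
    (∀ j ≤ k, MemLp (G j) ⊤ (volume.restrict I)) ∧
    ∀ j < k, IsWeakDeriv I (G j) (G (j + 1))

/-! ### The system class -/

/-- The operator class `𝕋_h^{n,q}`, for an operator `T : C([-h,∞), X) → L^∞_loc(ℝ≥0, ℝ^q)`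
where `X` is `ℝⁿ`. Elements of `C([-h,∞), X)` are represented by functions `ℝ → X` that are
continuous on `[-h,∞)`; by causality the class of `T ζ` in `L^∞_loc(ℝ≥0, ℝ^q)` depends only on
the restriction of `ζ` to `[-h,∞)`. -/
structure IsOperatorClass {X : Type*} [NormedAddCommGroup X] {q : ℕ} (h : ℝ)
    (T : (ℝ → X) → ℝ → E q) : Prop where
  /-- values in `L^∞_loc(ℝ≥0, ℝ^q)` -/
  memLp_loc : ∀ ζ : ℝ → X, ContinuousOn ζ (Ici (-h)) →
    ∀ b : ℝ, 0 ≤ b → MemLp (T ζ) ⊤ (volume.restrict (Icc 0 b))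
  /-- causality -/
  causal : ∀ ζ θ : ℝ → X, ContinuousOn ζ (Ici (-h)) → ContinuousOn θ (Ici (-h)) →
    ∀ t : ℝ, 0 ≤ t → EqOn ζ θ (Icc (-h) t) →
      ∀ᵐ s ∂volume.restrict (Icc 0 t), T ζ s = T θ s
  /-- local Lipschitz property -/
  lipschitz : ∀ t : ℝ, 0 ≤ t → ∀ ξ : ℝ → X, ContinuousOn ξ (Icc (-h) t) →
    ∃ c₀ δ τ : ℝ, 0 < c₀ ∧ 0 < δ ∧ 0 < τ ∧
      ∀ ζ₁ ζ₂ : ℝ → X, ContinuousOn ζ₁ (Ici (-h)) → ContinuousOn ζ₂ (Ici (-h)) →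
        EqOn ζ₁ ξ (Icc (-h) t) → EqOn ζ₂ ξ (Icc (-h) t) →
        (∀ s ∈ Icc t (t + τ), ‖ζ₁ s - ξ t‖ < δ ∧ ‖ζ₂ s - ξ t‖ < δ) →
        ∀ᵐ s ∂volume.restrict (Icc t (t + τ)),
          ‖T ζ₁ s - T ζ₂ s‖ ≤ c₀ * sSup ((fun s' => ‖ζ₁ s' - ζ₂ s'‖) '' Icc t (t + τ))
  /-- bounded-input bounded-output property -/
  bibo : ∀ c₁ : ℝ, 0 < c₁ → ∃ c₂ : ℝ, 0 < c₂ ∧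
    ∀ ζ : ℝ → X, ContinuousOn ζ (Ici (-h)) → (∀ t ∈ Ici (-h), ‖ζ t‖ < c₁) →
      ∀ᵐ t ∂volume.restrict (Ici 0), ‖T ζ t‖ < c₂

/-- `χ(s) = min { ⟨v, f(δ, z, -s v)⟩ : (δ, z) ∈ K_p × K_q, v* ≤ ‖v‖ ≤ 1 }`. -/
def chi {p q m : ℕ} (f : E p → E q → E m → E m) (vs : ℝ) (Kp : Set (E p)) (Kq : Set (E q))
    (s : ℝ) : ℝ :=
  sInf {x : ℝ | ∃ δ ∈ Kp, ∃ z ∈ Kq, ∃ v : E m, vs ≤ ‖v‖ ∧ ‖v‖ ≤ 1 ∧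
    x = inner ℝ v (f δ z ((-s) • v))}

/-- `sup { χ(s) : s ∈ S } = ∞` for every pair of (non-empty) compact sets, with a common `v*`. -/
def HighGainOn {p q m : ℕ} (S : Set ℝ) (f : E p → E q → E m → E m) : Prop :=
  ∃ vs ∈ Ioo (0 : ℝ) 1, ∀ (Kp : Set (E p)) (Kq : Set (E q)),
    IsCompact Kp → Kp.Nonempty → IsCompact Kq → Kq.Nonempty →
      ¬ BddAbove (chi f vs Kp Kq '' S)

/-- The high-gain property. -/
def HighGain {p q m : ℕ} (f : E p → E q → E m → E m) : Prop := HighGainOn univ f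

/-- The negative-definite high-gain property. -/
def NegDefHighGain {p q m : ℕ} (f : E p → E q → E m → E m) : Prop := HighGainOn (Ioi 0) f

/-- The positive-definite high-gain property. -/
def PosDefHighGain {p q m : ℕ} (f : E p → E q → E m → E m) : Prop := HighGainOn (Iio 0) f

/-- `(d, f, T)`, with memory `h`, belongs to the system class `𝒩^{m,r}`. -/
structure IsSystem {m r p q : ℕ} (h : ℝ) (d : ℝ → E p) (f : E p → E q → E m → E m)
    (T : (ℝ → Blocks r m) → ℝ → E q) : Prop where
  memory_nonneg : 0 ≤ h
  disturbance : MemLp d ⊤ (volume.restrict (Ici 0))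
  continuous : Continuous (fun x : E p × E q × E m => f x.1 x.2.1 x.2.2)
  highGain : HighGain f
  operator : IsOperatorClass h T

/-- Initial data `y⁰ ∈ C^{r-1}([-h,0], ℝᵐ)`, given together with its derivatives:
`y0 k` is the `k`-th derivative of `y0 0`, for `k < r`. (If `h = 0`, the interval is a point and
the datum consists of the `r` values at `0`.) -/
def IsInitialData {m : ℕ} (r : ℕ) (h : ℝ) (y0 : ℕ → ℝ → E m) : Prop :=
  (∀ k < r, ContinuousOn (y0 k) (Icc (-h) 0)) ∧
  ∀ k, k + 1 < r → ∀ t ∈ Icc (-h) 0, HasDerivWithinAt (y0 k) (y0 (k + 1) t) (Icc (-h) 0) t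

/-! ### The design parameters and the controller -/

/-- The set `Φ` of funnel functions. -/
structure IsFunnelFunction (φ : ℝ → ℝ) : Prop where
  locally_ac : ∀ b : ℝ, 0 ≤ b → AbsolutelyContinuousOnInterval φ 0 b
  nonneg : ∀ t : ℝ, 0 ≤ t → 0 ≤ φ t
  pos : ∀ t : ℝ, 0 < t → 0 < φ t
  liminf_pos : 0 < liminf (fun t : ℝ => (φ t : EReal)) atTop
  deriv_le : ∃ c : ℝ, 0 < c ∧ ∀ᵐ t ∂volume.restrict (Ici (0 : ℝ)), |deriv φ t| ≤ c * (1 + φ t)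

/-- `γ(w) = α(‖w‖²) w`. -/
def gam {m : ℕ} (α : ℝ → ℝ) (w : E m) : E m := α (‖w‖ ^ 2) • w

/-- `rho α η k = ρ_k(η_1, …, η_k)` for `k ≥ 1`, where the entry `η_{k+1}` is written `η k`.
The dummy value `ρ_0 = 0` gives `ρ_1(η_1) = η_1`, since `γ(0) = 0`. -/
def rho {m : ℕ} (α : ℝ → ℝ) (η : ℕ → E m) : ℕ → E m
  | 0 => 0
  | k + 1 => η k + gam α (rho α η k)

/-- `memD α η k` means `(η_1, …, η_k) ∈ 𝒟_k`, for `k ≥ 1`. -/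
def memD {m : ℕ} (α : ℝ → ℝ) (η : ℕ → E m) : ℕ → Prop
  | 0 => True
  | k + 1 => memD α η k ∧ ‖η k + gam α (rho α η k)‖ < 1

/-- The interval `[-h, ω)`, with `ω ≤ ∞`. -/
def dom (h : ℝ) (ω : EReal) : Set ℝ := {t : ℝ | -h ≤ t ∧ (t : EReal) < ω}

/-- The derivative `y^{(k)}` of a function `y` on `[-h, ω)`. -/
def yDer {m : ℕ} (h : ℝ) (ω : EReal) (y : ℝ → E m) (k : ℕ) (t : ℝ) : E m :=
  iteratedDerivWithin k y (dom h ω) t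

/-- The derivative `y_ref^{(k)}` of the reference signal on `[0,∞)`. -/
def refDer {m : ℕ} (yref : ℝ → E m) (k : ℕ) (t : ℝ) : E m :=
  iteratedDerivWithin k yref (Ici 0) t

/-- `e^{(k)} = y^{(k)} - y_ref^{(k)}`. -/
def eDer {m : ℕ} (h : ℝ) (ω : EReal) (yref y : ℝ → E m) (k : ℕ) (t : ℝ) : E m :=
  yDer h ω y k t - refDer yref k t

/-- The vector `(y, y', …, y^{(r-1)})(t)`. -/
def state {m : ℕ} (r : ℕ) (h : ℝ) (ω : EReal) (y : ℝ → E m) (t : ℝ) : Blocks r m :=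
  WithLp.toLp 2 (fun k : Fin r => yDer h ω y k t)

/-- The entries of `𝐞(t) = (e^{(0)}(t), …, e^{(r̂-1)}(t), y^{(r̂)}(t), …, y^{(r-1)}(t))`; only
those with index `k < r` are used. -/
def info {m : ℕ} (rhat : ℕ) (h : ℝ) (ω : EReal) (yref y : ℝ → E m) (t : ℝ) (k : ℕ) : E m :=
  if k < rhat then eDer h ω yref y k t else yDer h ω y k t

/-- The entries of `𝐞(0)`, in terms of the initial data. -/
def initInfo {m : ℕ} (rhat : ℕ) (yref : ℝ → E m) (y0 : ℕ → ℝ → E m) (k : ℕ) : E m :=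
  if k < rhat then y0 k 0 - refDer yref k 0 else y0 k 0

/-- `w(t) = ρ_r(φ(t) 𝐞(t))`. -/
def wSig {m : ℕ} (r rhat : ℕ) (h : ℝ) (φ α : ℝ → ℝ) (ω : EReal) (yref y : ℝ → E m) (t : ℝ) :
    E m :=
  rho α (fun k => φ t • info rhat h ω yref y t k) r

/-- The funnel controller `u(t) = (N ∘ α)(‖w(t)‖²) w(t)`. -/
def uSig {m : ℕ} (r rhat : ℕ) (h : ℝ) (φ N α : ℝ → ℝ) (ω : EReal) (yref y : ℝ → E m) (t : ℝ) :
    E m :=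
  N (α (‖wSig r rhat h φ α ω yref y t‖ ^ 2)) • wSig r rhat h φ α ω yref y t

/-- `y` is a solution on `[-h, ω)` of the closed-loop initial-value problem. The operator `T` acts
on functions on `[-h, ω)` through its localization: on `[0, τ]`, `τ < ω`, it is applied to the
function that agrees with `(y, …, y^{(r-1)})` on `[-h, τ]` and is constant on `[τ, ∞)`. -/
structure IsSolution {m p q : ℕ} (r rhat : ℕ) (h : ℝ) (d : ℝ → E p) (f : E p → E q → E m → E m)
    (T : (ℝ → Blocks r m) → ℝ → E q) (φ N α : ℝ → ℝ) (yref : ℝ → E m) (y0 : ℕ → ℝ → E m)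
    (ω : EReal) (y : ℝ → E m) : Prop where
  pos : 0 < ω
  contDiffOn : ContDiffOn ℝ ((r - 1 : ℕ) : WithTop ℕ∞) y (dom h ω)
  initial : ∀ k < r, EqOn (yDer h ω y k) (y0 k) (Icc (-h) 0)
  locally_ac : ∀ τ : ℝ, 0 ≤ τ → (τ : EReal) < ω →
    AbsolutelyContinuousOnInterval (yDer h ω y (r - 1)) 0 τ
  /-- the control is defined along `y` -/
  mem_domain : ∀ t : ℝ, 0 ≤ t → (t : EReal) < ω →
    memD α (fun k => φ t • info rhat h ω yref y t k) r
  equation : ∀ τ : ℝ, 0 ≤ τ → (τ : EReal) < ω → ∀ᵐ t ∂volume.restrict (Icc 0 τ),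
    HasDerivAt (yDer h ω y (r - 1))
      (f (d t) (T (fun s => state r h ω y (min s τ)) t) (uSig r rhat h φ N α ω yref y t)) t

/-- `y` is a maximal solution, on `[-h, ω)`: it has no proper right extension that is a
solution. -/
def IsMaximalSolution {m p q : ℕ} (r rhat : ℕ) (h : ℝ) (d : ℝ → E p)
    (f : E p → E q → E m → E m) (T : (ℝ → Blocks r m) → ℝ → E q) (φ N α : ℝ → ℝ)
    (yref : ℝ → E m) (y0 : ℕ → ℝ → E m) (ω : EReal) (y : ℝ → E m) : Prop :=
  IsSolution r rhat h d f T φ N α yref y0 ω y ∧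
  ∀ (ω' : EReal) (z : ℝ → E m), IsSolution r rhat h d f T φ N α yref y0 ω' z →
    ω ≤ ω' → EqOn z y (dom h ω) → ω' = ω

end FunnelControl

end

open FunnelControl

namespace FunnelControl

/-! ### Absolutely continuous and Lipschitz functions of a real variable -/

/-! Write e_0, …, e_{r-1} for the entries of 𝐞, so that ρ_{k+1} = φ e_k + γ(ρ_k) with ρ_0 = 0. If
ρ_k stays away from the unit sphere, then γ(ρ_k) is bounded, hence so is φ e_k. If ρ_k is moreover
Lipschitz, the growth condition on φ shows that ρ_{k+1}' equals φ e_k' up to a bounded term. For k +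
1 < r, e_k' is e_{k+1}, except at the switch from errors to output derivatives: there y_ref^{(r̂)}
appears, which is harmless because φ is bounded in that case. Inserting φ e_{k+1} = ρ_{k+2} -
γ(ρ_{k+1}) gives ρ_{k+1}' = -γ(ρ_{k+1}) + (bounded). Since α blows up at 1, ‖ρ_{k+1}‖² cannot cross
a level close enough to 1. This induction is `ErrorChain.rho_bounded_away`; it bounds all e_k, k <
r.

For ρ_r there is no such damping term; its dissipation must come from f. The state is already
bounded, so the BIBO property confines the operator to a compact set. As χ is continuous and
unbounded on the values of N, there are arbitrarily large gains a with χ(N(a)) as large as desired.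
At the level L with α(L) = a this yields dissipation only in a thin layer above L, because N may
oscillate. A layer suffices: a continuous function cannot leave through a layer in which it is
nonincreasing (`le_of_ae_deriv_nonpos_above`, `exists_dissipative_layer`,
`ErrorChain.rho_last_bounded_away`). The three choices of N differ only in the set S of values that
N attains and on which χ is unbounded.

For existence, α is frozen beyond some c < 1, which makes the vector field continuous everywhere. A
Peano theorem for causal equations (`CausalField.exists_solution`) gives a local solution, and the
freezing is inactive for a short time (`StateSol.exists_extension`). Zorn's lemma gives maximal
solutions. On a bounded interval [-h, b) the estimates above are uniform, so the state is Lipschitz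
on [0, b), extends to b with all ρ_k still inside the ball (`StateSol.exists_closed`), and can be
continued past b. A maximal solution is therefore global, and the remaining claims are read off from
the same estimates.

The estimates start at some a > 0, since φ(0) = 0 is allowed; compactness covers [0, a]. Membership
in W^{r,∞} is exchanged for classical derivatives with Lipschitz last member (`IsSmoothChain`) by
the du Bois-Reymond lemma. -/

theorem ac_of_dist_le {X Y : Type*} [PseudoMetricSpace X] [PseudoMetricSpace Y] {g : ℝ → X}
    {u : ℝ → Y} {a b C : ℝ} (hg : AbsolutelyContinuousOnInterval g a b)
    (h : ∀ s ∈ uIcc a b, ∀ t ∈ uIcc a b, dist (u s) (u t) ≤ C * dist (g s) (g t)) :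
    AbsolutelyContinuousOnInterval u a b := by
  have h0 : Tendsto (fun E : ℕ × (ℕ → ℝ × ℝ) ↦
      C * ∑ i ∈ Finset.range E.1, dist (g (E.2 i).1) (g (E.2 i).2))
      (AbsolutelyContinuousOnInterval.totalLengthFilter ⊓
        𝓟 (AbsolutelyContinuousOnInterval.disjWithin a b)) (𝓝 0) := by
    simpa using Tendsto.const_mul C hg
  refine squeeze_zero' ?_ ?_ h0
  · exact Eventually.of_forall fun E => Finset.sum_nonneg fun i _ => dist_nonneg
  · filter_upwards [mem_inf_of_right (mem_principal_self _)] with E hE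
    rw [Finset.mul_sum]
    exact Finset.sum_le_sum fun i hi => h _ (hE.1 i hi).1 _ (hE.1 i hi).2

/-- Integrating an almost everywhere bound for the derivative of a real function. -/
theorem ac_sub_le_of_ae_deriv_le {u : ℝ → ℝ} {a b K : ℝ} (hab : a ≤ b)
    (hu : AbsolutelyContinuousOnInterval u a b)
    (h : ∀ᵐ t ∂volume.restrict (Icc a b), deriv u t ≤ K) : u b - u a ≤ K * (b - a) := by
  rw [← hu.integral_deriv_eq_sub]
  have h1 := intervalIntegral.integral_mono_ae_restrict hab hu.intervalIntegrable_deriv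
    (intervalIntegrable_const (c := K)) h
  simpa [mul_comm] using h1

/-- Testing against the fixed vector g b - g a reduces the estimate to the scalar one. -/
theorem ac_norm_sub_le_of_ae_deriv_le {F : Type*} [NormedAddCommGroup F] [InnerProductSpace ℝ F]
    {g g' : ℝ → F} {a b K : ℝ} (hab : a ≤ b) (hg : AbsolutelyContinuousOnInterval g a b)
    (h : ∀ᵐ t ∂volume.restrict (Icc a b), HasDerivAt g (g' t) t ∧ ‖g' t‖ ≤ K) :
    ‖g b - g a‖ ≤ K * (b - a) := by
  set v := g b - g a with hv
  have hu : AbsolutelyContinuousOnInterval (fun t => inner ℝ v (g t)) a b := by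
    refine ac_of_dist_le (C := ‖v‖) hg fun s _ t _ => ?_
    rw [Real.dist_eq, dist_eq_norm, ← inner_sub_right]
    exact abs_real_inner_le_norm _ _
  have h1 := ac_sub_le_of_ae_deriv_le (K := ‖v‖ * K) hab hu (by
    filter_upwards [h] with t ht
    have h2 : HasDerivAt (fun t => inner ℝ v (g t)) (inner ℝ v (g' t)) t := by
      simpa using (hasDerivAt_const t v).inner ℝ ht.1
    rw [h2.deriv]
    exact (real_inner_le_norm _ _).trans (mul_le_mul_of_nonneg_left ht.2 (norm_nonneg _)))
  have h3 : ‖v‖ * ‖v‖ ≤ ‖v‖ * (K * (b - a)) := by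
    rw [← inner_sub_right, ← hv, real_inner_self_eq_norm_mul_norm] at h1
    linarith
  -- If v = 0 one cannot divide by ‖v‖; the sign of K is then read off at a single point where the
  -- almost everywhere bound holds.
  rcases (norm_nonneg v).eq_or_lt with h0 | h0
  · rw [← h0]
    rcases hab.eq_or_lt with rfl | hlt
    · simp
    · have hne : (ae (volume.restrict (Icc a b))).NeBot := by
        rw [ae_neBot, Ne, Measure.restrict_eq_zero]; simp [hlt]
      obtain ⟨t, -, ht⟩ := h.exists
      exact mul_nonneg ((norm_nonneg _).trans ht) (by linarith)
  · exact le_of_mul_le_mul_left h3 h0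

/-- `g` is Lipschitz on `s` for some constant. -/
def LipOn {X Y : Type*} [PseudoEMetricSpace X] [PseudoEMetricSpace Y] (g : X → Y) (s : Set X) :
    Prop := ∃ K, LipschitzOnWith K g s

theorem LipOn.of_dist_le {X Y : Type*} [PseudoMetricSpace X] [PseudoMetricSpace Y] {g : X → Y}
    {s : Set X} {C : ℝ} (h : ∀ x ∈ s, ∀ y ∈ s, dist (g x) (g y) ≤ C * dist x y) : LipOn g s := by
  refine ⟨C.toNNReal, LipschitzOnWith.of_dist_le_mul fun x hx y hy => ?_⟩
  exact (h x hx y hy).trans (mul_le_mul_of_nonneg_right (Real.le_coe_toNNReal C) dist_nonneg)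

theorem LipOn.exists_dist_le {X Y : Type*} [PseudoMetricSpace X] [PseudoMetricSpace Y] {g : X → Y}
    {s : Set X} (h : LipOn g s) :
    ∃ C, 0 ≤ C ∧ ∀ x ∈ s, ∀ y ∈ s, dist (g x) (g y) ≤ C * dist x y := by
  obtain ⟨K, hK⟩ := h
  exact ⟨K, K.2, fun x hx y hy => hK.dist_le_mul x hx y hy⟩

theorem LipOn.mono {X Y : Type*} [PseudoEMetricSpace X] [PseudoEMetricSpace Y] {g : X → Y}
    {s t : Set X} (h : LipOn g t) (hst : s ⊆ t) : LipOn g s :=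
  h.imp fun _ hK => hK.mono hst

theorem LipOn.continuousOn {X Y : Type*} [PseudoEMetricSpace X] [PseudoEMetricSpace Y] {g : X → Y}
    {s : Set X} (h : LipOn g s) : ContinuousOn g s :=
  h.choose_spec.continuousOn

theorem LipOn.congr {X Y : Type*} [PseudoEMetricSpace X] [PseudoEMetricSpace Y] {g g' : X → Y}
    {s : Set X} (h : LipOn g s) (hg : EqOn g' g s) : LipOn g' s := by
  obtain ⟨K, hK⟩ := h
  refine ⟨K, fun x hx y hy => ?_⟩
  rw [hg hx, hg hy]
  exact hK hx hy

theorem LipOn.comp {X Y Z : Type*} [PseudoEMetricSpace X] [PseudoEMetricSpace Y]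
    [PseudoEMetricSpace Z] {f : Y → Z} {g : X → Y} {s : Set X} {t : Set Y} (hf : LipOn f t)
    (hg : LipOn g s) (hst : MapsTo g s t) : LipOn (fun x => f (g x)) s := by
  obtain ⟨K, hK⟩ := hf
  obtain ⟨L, hL⟩ := hg
  exact ⟨_, hK.comp hL hst⟩

theorem LipOn.add {X F : Type*} [PseudoMetricSpace X] [SeminormedAddCommGroup F] {f g : X → F}
    {s : Set X} (hf : LipOn f s) (hg : LipOn g s) : LipOn (fun x => f x + g x) s := by
  obtain ⟨C, -, hC⟩ := hf.exists_dist_le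
  obtain ⟨D, -, hD⟩ := hg.exists_dist_le
  refine LipOn.of_dist_le (C := C + D) fun x hx y hy => ?_
  rw [add_mul]
  exact (dist_add_add_le _ _ _ _).trans (add_le_add (hC x hx y hy) (hD x hx y hy))

theorem LipOn.sub {X F : Type*} [PseudoMetricSpace X] [SeminormedAddCommGroup F] {f g : X → F}
    {s : Set X} (hf : LipOn f s) (hg : LipOn g s) : LipOn (fun x => f x - g x) s := by
  obtain ⟨C, -, hC⟩ := hf.exists_dist_le
  obtain ⟨D, -, hD⟩ := hg.exists_dist_le
  refine LipOn.of_dist_le (C := C + D) fun x hx y hy => ?_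
  rw [add_mul]
  exact (dist_sub_sub_le _ _ _ _).trans (add_le_add (hC x hx y hy) (hD x hx y hy))

theorem LipOn.smul {X F : Type*} [PseudoMetricSpace X] [SeminormedAddCommGroup F]
    [NormedSpace ℝ F] {f : X → ℝ} {g : X → F} {s : Set X} {A B : ℝ} (hf : LipOn f s)
    (hg : LipOn g s) (hA : ∀ x ∈ s, ‖f x‖ ≤ A) (hB : ∀ x ∈ s, ‖g x‖ ≤ B) :
    LipOn (fun x => f x • g x) s := by
  obtain ⟨C, hC0, hC⟩ := hf.exists_dist_le
  obtain ⟨D, hD0, hD⟩ := hg.exists_dist_le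
  refine LipOn.of_dist_le (C := A * D + C * B) fun x hx y hy => ?_
  have h1 : f x • g x - f y • g y = f x • (g x - g y) + (f x - f y) • g y := by
    rw [smul_sub, sub_smul]; abel
  rw [dist_eq_norm, h1]
  refine (norm_add_le _ _).trans ?_
  rw [norm_smul, norm_smul, ← dist_eq_norm, ← dist_eq_norm, add_mul]
  refine add_le_add ?_ ?_
  · rw [mul_assoc]
    exact mul_le_mul (hA x hx) (hD x hx y hy) dist_nonneg ((norm_nonneg _).trans (hA x hx))
  · calc dist (f x) (f y) * ‖g y‖ ≤ (C * dist x y) * B :=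
          mul_le_mul (hC x hx y hy) (hB y hy) (norm_nonneg _) (by positivity)
      _ = C * B * dist x y := by ring

theorem LipOn.norm_sq {X F : Type*} [PseudoMetricSpace X] [SeminormedAddCommGroup F] {g : X → F}
    {s : Set X} {B : ℝ} (hg : LipOn g s) (hB : ∀ x ∈ s, ‖g x‖ ≤ B) :
    LipOn (fun x => ‖g x‖ ^ 2) s := by
  have h1 : LipOn (fun x => ‖g x‖) s := by
    obtain ⟨C, -, hC⟩ := hg.exists_dist_le
    refine LipOn.of_dist_le fun x hx y hy => le_trans ?_ (hC x hx y hy)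
    rw [Real.dist_eq, dist_eq_norm]
    exact abs_norm_sub_norm_le _ _
  have h2 := h1.smul h1 (A := B) (B := B) (by simpa using hB) (by simpa using hB)
  refine h2.congr fun x _ => by simp [sq]

theorem LipOn.ac {Y : Type*} [PseudoMetricSpace Y] {g : ℝ → Y} {a b : ℝ} (hab : a ≤ b)
    (h : LipOn g (Icc a b)) : AbsolutelyContinuousOnInterval g a b := by
  obtain ⟨K, hK⟩ := h
  rw [← uIcc_of_le hab] at hK
  exact hK.absolutelyContinuousOnInterval

theorem ae_restrict_Icc_iff_Ioo {a b : ℝ} {P : ℝ → Prop} :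
    (∀ᵐ t ∂volume.restrict (Icc a b), P t) ↔ ∀ᵐ t ∂volume.restrict (Ioo a b), P t := by
  rw [Measure.restrict_congr_set (Ioo_ae_eq_Icc (μ := volume)).symm]

theorem LipOn.ae_differentiableAt {F : Type*} [NormedAddCommGroup F] [NormedSpace ℝ F]
    [FiniteDimensional ℝ F] {g : ℝ → F} {a b : ℝ} (h : LipOn g (Icc a b)) :
    ∀ᵐ t ∂volume.restrict (Icc a b), DifferentiableAt ℝ g t := by
  obtain ⟨K, hK⟩ := h
  rw [ae_restrict_Icc_iff_Ioo]
  have := (hK.mono Ioo_subset_Icc_self).ae_differentiableWithinAt_real measurableSet_Ioo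
  filter_upwards [this, ae_restrict_mem measurableSet_Ioo] with t h1 h2
  exact h1.differentiableAt (isOpen_Ioo.mem_nhds h2)

theorem norm_deriv_le_of_dist_le {F : Type*} [NormedAddCommGroup F] [NormedSpace ℝ F] {g : ℝ → F}
    {s : Set ℝ} {C t : ℝ} (h : ∀ x ∈ s, ∀ y ∈ s, dist (g x) (g y) ≤ C * dist x y) (hC : 0 ≤ C)
    (ht : s ∈ 𝓝 t) : ‖deriv g t‖ ≤ C := by
  refine norm_deriv_le_of_lip' hC ?_
  filter_upwards [ht] with x hx
  have := h x hx t (mem_of_mem_nhds ht)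
  rwa [dist_eq_norm, dist_eq_norm] at this

/-- An almost everywhere bound on the derivative of an absolutely continuous function is a Lipschitz
constant. -/
theorem dist_le_of_ae_deriv_le {F : Type*} [NormedAddCommGroup F] [InnerProductSpace ℝ F]
    {g g' : ℝ → F} {a b K : ℝ} (hab : a ≤ b) (hg : AbsolutelyContinuousOnInterval g a b)
    (h : ∀ᵐ t ∂volume.restrict (Icc a b), HasDerivAt g (g' t) t ∧ ‖g' t‖ ≤ K) :
    ∀ s ∈ Icc a b, ∀ t ∈ Icc a b, dist (g s) (g t) ≤ K * dist s t := by
  have key : ∀ s ∈ Icc a b, ∀ t ∈ Icc a b, s ≤ t → dist (g s) (g t) ≤ K * dist s t := by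
    intro s hs t ht hst
    have hsub : Icc s t ⊆ Icc a b := Icc_subset_Icc hs.1 ht.2
    rw [dist_comm, dist_comm s, dist_eq_norm, Real.dist_eq, abs_of_nonneg (by linarith)]
    refine ac_norm_sub_le_of_ae_deriv_le (g' := g') hst (hg.mono ?_)
      (ae_restrict_of_ae_restrict_of_subset hsub h)
    rwa [uIcc_of_le hst, uIcc_of_le hab]
  intro s hs t ht
  rcases le_total s t with hst | hst
  · exact key s hs t ht hst
  · rw [dist_comm (g s), dist_comm s]
    exact key t ht s hs hst

/-- A level that the derivative forbids to cross upwards is not crossed. -/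
theorem le_of_ae_deriv_nonpos_above {V : ℝ → ℝ} {a b L δ : ℝ} (hab : a ≤ b) (hδ : 0 < δ)
    (hV : AbsolutelyContinuousOnInterval V a b) (h0 : V a ≤ L)
    (h : ∀ᵐ t ∂volume.restrict (Icc a b), L < V t → V t < L + δ → deriv V t ≤ 0) : V b ≤ L := by
  by_contra! hb
  have hc : ContinuousOn V (Icc a b) := by simpa [uIcc_of_le hab] using hV.continuousOn
  set A : Set ℝ := {t ∈ Icc a b | V t ≤ L}
  have hA : IsCompact A := by
    have : IsClosed A := by
      have := hc.preimage_isClosed_of_isClosed isClosed_Icc (isClosed_Iic (a := L))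
      exact this
    exact isCompact_Icc.of_isClosed_subset this fun t ht => ht.1
  -- c is the last time with V ≤ L. Right after c the values lie in the layer (L, L + δ), where V is
  -- nonincreasing, so V stays at or below V c ≤ L: a contradiction.
  obtain ⟨c, ⟨hcI, hcL⟩, hcm⟩ := hA.exists_isGreatest ⟨a, ⟨le_rfl, hab⟩, h0⟩
  have hcb : c < b := hcI.2.lt_of_ne fun e => by subst e; linarith
  have habove : ∀ t ∈ Ioc c b, L < V t := by
    intro t ht
    by_contra! hle
    have := hcm ⟨⟨hcI.1.trans ht.1.le, ht.2⟩, hle⟩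
    exact absurd ht.1 (not_lt.2 this)
  have hnear : ∀ᶠ t in 𝓝[Icc a b] c, V t < L + δ :=
    (hc c hcI).eventually (gt_mem_nhds (by linarith))
  have hnear' : ∀ᶠ t in 𝓝[>] c, V t < L + δ :=
    (nhdsWithin_le_of_mem (by
      filter_upwards [Ioc_mem_nhdsGT hcb] with t ht using ⟨hcI.1.trans ht.1.le, ht.2⟩)) hnear
  obtain ⟨e, he, hsub⟩ := (mem_nhdsGT_iff_exists_Ioo_subset' (u' := b) hcb).1 hnear'
  obtain ⟨e', he1, he2⟩ : ∃ e', c < e' ∧ e' ≤ min e b := ⟨min e b, lt_min he hcb, le_rfl⟩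
  have hIcc : Icc c e' ⊆ Icc a b := Icc_subset_Icc hcI.1 (he2.trans (min_le_right _ _))
  have h1 := ac_sub_le_of_ae_deriv_le (K := 0) he1.le
    (hV.mono (by rwa [uIcc_of_le he1.le, uIcc_of_le hab])) (by
      rw [ae_restrict_Icc_iff_Ioo]
      have h2 := ae_restrict_of_ae_restrict_of_subset (Ioo_subset_Icc_self.trans hIcc) h
      filter_upwards [h2, ae_restrict_mem measurableSet_Ioo] with t h3 h4
      exact h3 (habove t ⟨h4.1, h4.2.le.trans (he2.trans (min_le_right _ _))⟩)
        (hsub ⟨h4.1, h4.2.trans_le (he2.trans (min_le_left _ _))⟩))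
  have h2 := habove e' ⟨he1, he2.trans (min_le_right _ _)⟩
  linarith

/-- The primitive of a bounded function is Lipschitz. -/
theorem dist_primitive_le {F : Type*} [NormedAddCommGroup F] [NormedSpace ℝ F] {g' : ℝ → F}
    {a b c C : ℝ} (hm : AEStronglyMeasurable g' (volume.restrict (Icc a b))) (hc : c ∈ Icc a b)
    (hb : ∀ᵐ t ∂volume.restrict (Icc a b), ‖g' t‖ ≤ C) :
    ∀ s ∈ Icc a b, ∀ t ∈ Icc a b,
      dist (∫ r in c..s, g' r) (∫ r in c..t, g' r) ≤ C * dist s t := by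
  have hint : IntegrableOn g' (Icc a b) := Integrable.of_bound hm C hb
  have hi : ∀ s ∈ Icc a b, ∀ t ∈ Icc a b, IntervalIntegrable g' volume s t := fun s hs t ht =>
    (hint.mono_set (uIcc_subset_Icc hs ht)).intervalIntegrable
  intro s hs t ht
  rw [dist_eq_norm, intervalIntegral.integral_interval_sub_left (hi c hc s hs) (hi c hc t ht),
    Real.dist_eq]
  refine intervalIntegral.norm_integral_le_of_norm_le_const_ae ?_
  rw [ae_restrict_iff' measurableSet_Icc] at hb
  filter_upwards [hb] with r hr hr'
  exact hr (uIcc_subset_Icc ht hs (uIoc_subset_uIcc hr'))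

/-- The fundamental theorem of calculus for Lipschitz functions. -/
theorem LipOn.integral_eq_sub {n : ℕ} {g g' : ℝ → E n} {a b C : ℝ} (hab : a ≤ b)
    (hg : LipOn g (Icc a b)) (hm : AEStronglyMeasurable g' (volume.restrict (Icc a b)))
    (hb : ∀ᵐ t ∂volume.restrict (Icc a b), ‖g' t‖ ≤ C)
    (h : ∀ᵐ t ∂volume.restrict (Icc a b), HasDerivAt g (g' t) t) :
    ∫ t in a..b, g' t = g b - g a := by
  have hii : IntervalIntegrable g' volume a b :=
    (intervalIntegrable_iff_integrableOn_Icc_of_le hab).2 (Integrable.of_bound hm C hb)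
  have hL : LipOn (fun t => ∫ s in a..t, g' s) (Icc a b) :=
    LipOn.of_dist_le (dist_primitive_le hm ⟨le_rfl, hab⟩ hb)
  -- The difference of g and the primitive is absolutely continuous with derivative zero almost
  -- everywhere, hence constant.
  have hac := ((hg.sub hL).ac hab).const_of_ae_hasDerivAt_zero (by
    have h1 := hii.ae_hasDerivAt_integral
    rw [ae_restrict_iff' measurableSet_Icc] at h
    rw [uIcc_of_le hab] at h1 ⊢
    filter_upwards [h, h1] with t h2 h3 ht
    simpa using! (h2 ht).sub (h3 ht a ⟨le_rfl, hab⟩))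
  obtain ⟨c, hc⟩ := hac
  have h1 := hc a left_mem_uIcc
  have h2 := hc b right_mem_uIcc
  simp only [intervalIntegral.integral_same, sub_zero] at h1 h2
  rw [h1, ← h2]
  abel

end FunnelControl

namespace FunnelControl

/-! ### A Peano theorem for causal functional differential equations -/

/-- Continuous functions that agree with `ξ` up to time `t₀` and stay `R`-close to `ξ t₀`
afterwards. -/
structure Continues {X : Type*} [NormedAddCommGroup X] (ξ : ℝ → X) (t₀ R : ℝ) (x : ℝ → X) :
    Prop where
  continuous : Continuous x
  eqOn : EqOn x ξ (Iic t₀)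
  bound : ∀ t, t₀ ≤ t → ‖x t - ξ t₀‖ ≤ R

/-- A causal vector field that is bounded, measurable and continuous along the continuations
of `ξ`. -/
structure CausalField {X : Type*} [NormedAddCommGroup X] (ξ : ℝ → X) (t₀ τ R M : ℝ)
    (H : (ℝ → X) → ℝ → X) : Prop where
  meas : ∀ x, Continues ξ t₀ R x → AEStronglyMeasurable (H x) (volume.restrict (Icc t₀ (t₀ + τ)))
  bound : ∀ x, Continues ξ t₀ R x → ∀ᵐ s ∂volume.restrict (Icc t₀ (t₀ + τ)), ‖H x s‖ ≤ M
  causal : ∀ x x', Continues ξ t₀ R x → Continues ξ t₀ R x' → ∀ t ∈ Icc t₀ (t₀ + τ),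
    EqOn x x' (Iic t) → ∀ᵐ s ∂volume.restrict (Icc t₀ t), H x s = H x' s
  cont : ∀ (xs : ℕ → ℝ → X) (x : ℝ → X), (∀ n, Continues ξ t₀ R (xs n)) → Continues ξ t₀ R x →
    TendstoUniformly xs x atTop → ∀ᵐ s ∂volume.restrict (Icc t₀ (t₀ + τ)),
      Tendsto (fun n => H (xs n) s) atTop (𝓝 (H x s))

/-- The time up to which the delayed approximation integrates. -/
def delayTime (t₀ τ δ t : ℝ) : ℝ := max t₀ (min t (t₀ + τ) - δ)

theorem delayTime_mem {t₀ τ δ t : ℝ} (hτ : 0 ≤ τ) (hδ : 0 ≤ δ) :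
    delayTime t₀ τ δ t ∈ Icc t₀ (t₀ + τ) := by
  unfold delayTime
  exact ⟨le_max_left _ _, max_le (by linarith) (by linarith [min_le_right t (t₀ + τ)])⟩

theorem dist_delayTime_le {t₀ τ δ s t : ℝ} :
    dist (delayTime t₀ τ δ s) (delayTime t₀ τ δ t) ≤ dist s t := by
  unfold delayTime
  simp only [Real.dist_eq]
  refine (abs_max_sub_max_le_max _ _ _ _).trans ?_
  rw [sub_sub_sub_cancel_right, sub_self, abs_zero, max_eq_right (abs_nonneg _)]
  simpa using abs_min_sub_min_le_max s (t₀ + τ) t (t₀ + τ)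

theorem continues_const {X : Type*} [NormedAddCommGroup X] {ξ : ℝ → X} {t₀ R : ℝ} (hξ : Continuous ξ) (hR : 0 ≤ R) :
    Continues ξ t₀ R (fun t => ξ (min t t₀)) where
  continuous := by fun_prop
  eqOn := fun t ht => by simp only [min_eq_left (show t ≤ t₀ from ht)]
  bound := fun t ht => by simpa [min_eq_right ht] using hR

variable {X : Type*} [NormedAddCommGroup X] [NormedSpace ℝ X]

/-- The integral operator with delay `δ`. -/
noncomputable def delayStep (ξ : ℝ → X) (t₀ τ δ : ℝ) (H : (ℝ → X) → ℝ → X) (x : ℝ → X) (t : ℝ) :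
    X :=
  ξ (min t t₀) + ∫ s in t₀..delayTime t₀ τ δ t, H x s

section

variable {ξ : ℝ → X} {t₀ τ R M δ : ℝ} {H : (ℝ → X) → ℝ → X}

theorem CausalField.dist_integral_le (hH : CausalField ξ t₀ τ R M H) (hτ : 0 ≤ τ) {x : ℝ → X}
    (hx : Continues ξ t₀ R x) : ∀ s ∈ Icc t₀ (t₀ + τ), ∀ t ∈ Icc t₀ (t₀ + τ),
      dist (∫ r in t₀..s, H x r) (∫ r in t₀..t, H x r) ≤ M * dist s t :=
  dist_primitive_le (hH.meas x hx) ⟨le_rfl, by linarith⟩ (hH.bound x hx)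

theorem CausalField.dist_delayed_integral_le (hH : CausalField ξ t₀ τ R M H) (hτ : 0 ≤ τ)
    (hδ : 0 ≤ δ) (hM : 0 ≤ M) {x : ℝ → X} (hx : Continues ξ t₀ R x) (s t : ℝ) :
    dist (∫ r in t₀..delayTime t₀ τ δ s, H x r) (∫ r in t₀..delayTime t₀ τ δ t, H x r) ≤
      M * dist s t :=
  (hH.dist_integral_le hτ hx _ (delayTime_mem hτ hδ) _ (delayTime_mem hτ hδ)).trans
    (mul_le_mul_of_nonneg_left dist_delayTime_le hM)

theorem CausalField.continues_delayStep (hH : CausalField ξ t₀ τ R M H) (hξ : Continuous ξ)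
    (hτ : 0 ≤ τ) (hδ : 0 ≤ δ) (hM : 0 ≤ M) (hR : M * τ ≤ R) {x : ℝ → X}
    (hx : Continues ξ t₀ R x) : Continues ξ t₀ R (delayStep ξ t₀ τ δ H x) where
  continuous := by
    refine Continuous.add (by fun_prop) ?_
    refine (LipschitzWith.of_dist_le_mul (K := ⟨M, hM⟩) ?_).continuous
    exact hH.dist_delayed_integral_le hτ hδ hM hx
  eqOn := fun t ht => by
    have h1 : delayTime t₀ τ δ t = t₀ := by
      unfold delayTime
      rw [max_eq_left]
      have : t ≤ t₀ := ht
      linarith [min_le_left t (t₀ + τ)]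
    simp only [delayStep, h1, intervalIntegral.integral_same, add_zero]
    rw [min_eq_left ht]
  bound := fun t ht => by
    have h1 := delayTime_mem (t := t) (t₀ := t₀) hτ hδ
    have h2 := hH.dist_integral_le hτ hx _ h1 t₀ ⟨le_rfl, by linarith⟩
    rw [intervalIntegral.integral_same, dist_zero_right, Real.dist_eq,
      abs_of_nonneg (by linarith [h1.1])] at h2
    simp only [delayStep, min_eq_right ht, add_sub_cancel_left]
    refine h2.trans (le_trans ?_ hR)
    exact mul_le_mul_of_nonneg_left (by linarith [h1.2]) hM

theorem CausalField.delayStep_congr (hH : CausalField ξ t₀ τ R M H)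
    (hτ : 0 ≤ τ) (hδ : 0 ≤ δ) {x x' : ℝ → X} (hx : Continues ξ t₀ R x)
    (hx' : Continues ξ t₀ R x') {t : ℝ} (h : EqOn x x' (Iic (delayTime t₀ τ δ t))) :
    delayStep ξ t₀ τ δ H x t = delayStep ξ t₀ τ δ H x' t := by
  have h1 := delayTime_mem (t := t) (t₀ := t₀) hτ hδ
  have h2 := hH.causal x x' hx hx' _ h1 h
  unfold delayStep
  congr 1
  refine intervalIntegral.integral_congr_ae ?_
  rw [ae_restrict_iff' measurableSet_Icc] at h2
  filter_upwards [h2] with s hs hs'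
  rw [uIoc_of_le h1.1] at hs'
  exact hs (Ioc_subset_Icc_self hs')

/-- Solutions of the integral equation with delay, by the method of steps. -/
theorem CausalField.exists_delayed (hH : CausalField ξ t₀ τ R M H) (hξ : Continuous ξ)
    (hτ : 0 < τ) (hM : 0 ≤ M) (hR : M * τ ≤ R) (n : ℕ) :
    ∃ x, Continues ξ t₀ R x ∧ delayStep ξ t₀ τ (τ / (n + 1)) H x = x := by
  set δ := τ / (n + 1) with hδ_def
  have hδ : 0 ≤ δ := by positivity
  set Φ := delayStep ξ t₀ τ δ H
  set x₀ : ℝ → X := fun t => ξ (min t t₀)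
  have hR0 : 0 ≤ R := (mul_nonneg hM hτ.le).trans hR
  have hc : ∀ k, Continues ξ t₀ R (Φ^[k] x₀) := by
    intro k
    induction k with
    | zero => exact continues_const hξ hR0
    | succ k ih =>
      rw [Function.iterate_succ_apply']
      exact hH.continues_delayStep hξ hτ.le hδ hM hR ih
  -- Because of the delay, each iteration lengthens by δ the interval on which consecutive iterates
  -- agree. After n + 1 steps this reaches t₀ + τ, beyond which nothing is read, so the next iterate
  -- is a fixed point.
  have hstep : ∀ k : ℕ, EqOn (Φ^[k + 1] x₀) (Φ^[k] x₀) (Iic (t₀ + k * δ)) := by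
    intro k
    induction k with
    | zero =>
      intro t ht
      have ht' : t ∈ Iic t₀ := by simpa using ht
      rw [(hc 1).eqOn ht', (hc 0).eqOn ht']
    | succ k ih =>
      intro t ht
      rw [Function.iterate_succ_apply' Φ (k + 1)]
      nth_rw 2 [Function.iterate_succ_apply' Φ k]
      refine hH.delayStep_congr hτ.le hδ (hc _) (hc _) (ih.mono (Iic_subset_Iic.2 ?_))
      have ht' : t ≤ t₀ + (k + 1) * δ := by simpa using ht
      refine max_le ?_ ?_
      · nlinarith [Nat.cast_nonneg (α := ℝ) k]
      · nlinarith [min_le_left t (t₀ + τ)]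
  refine ⟨Φ^[n + 2] x₀, hc _, ?_⟩
  funext t
  conv_rhs => rw [Function.iterate_succ_apply' Φ (n + 1)]
  refine hH.delayStep_congr hτ.le hδ (hc _) (hc _) ((hstep (n + 1)).mono (Iic_subset_Iic.2 ?_))
  have : t₀ + ((n + 1 : ℕ) : ℝ) * δ = t₀ + τ := by
    rw [hδ_def]; push_cast; field_simp
  rw [this]
  exact (delayTime_mem hτ.le hδ).2

/-- Tonelli's scheme: the delayed solutions share the Lipschitz constant M on [t₀, t₀ + τ] and stay
in one ball, so Arzelà–Ascoli gives a uniformly convergent subsequence. Dominated convergence passes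
to the limit in the integral. -/
theorem CausalField.exists_solution [FiniteDimensional ℝ X] (hH : CausalField ξ t₀ τ R M H)
    (hξ : Continuous ξ) (hτ : 0 < τ) (hM : 0 ≤ M) (hR : M * τ ≤ R) :
    ∃ x, Continues ξ t₀ R x ∧ ∀ t ∈ Icc t₀ (t₀ + τ), x t = ξ t₀ + ∫ s in t₀..t, H x s := by
  have hle : t₀ ≤ t₀ + τ := by linarith
  choose xs hxs hfix using hH.exists_delayed hξ hτ hM hR
  have hfix' : ∀ n t, xs n t = ξ (min t t₀) + ∫ s in t₀..delayTime t₀ τ (τ / (n + 1)) t, H (xs n) s :=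
    fun n t => (congrFun (hfix n) t).symm
  let I := Icc t₀ (t₀ + τ)
  let fs : ℕ → BoundedContinuousFunction I X := fun n =>
    BoundedContinuousFunction.mkOfCompact ⟨fun t => xs n t, by
      have := (hxs n).continuous; fun_prop⟩
  let A : Set (BoundedContinuousFunction I X) :=
    {g | ∀ t s, g t ∈ Metric.closedBall (ξ t₀) R ∧ dist (g t) (g s) ≤ M * dist t s}
  have hAc : IsCompact A := by
    refine BoundedContinuousFunction.arzela_ascoli₂ (Metric.closedBall (ξ t₀) R)
      (isCompact_closedBall _ _) A ?_ (fun g t hg => (hg t t).1) ?_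
    · simp only [A, ofPred_forall]
      refine isClosed_iInter fun t => isClosed_iInter fun s => ?_
      have hev : ∀ t : I, Continuous fun g : BoundedContinuousFunction I X => g t := fun t =>
        continuous_eval_const t
      exact (Metric.isClosed_closedBall.preimage (hev t)).inter
        (isClosed_le ((hev t).dist (hev s)) continuous_const)
    · refine (LipschitzWith.uniformEquicontinuous _ ⟨M, hM⟩ fun g => ?_).equicontinuous
      exact LipschitzWith.of_dist_le_mul fun t s => (g.2 t s).2
  have hmem : ∀ n, fs n ∈ A := by
    intro n t s
    refine ⟨?_, ?_⟩
    · rw [mem_closedBall_iff_norm]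
      exact (hxs n).bound t t.2.1
    · change dist (xs n t) (xs n s) ≤ _
      rw [hfix' n t, hfix' n s, min_eq_right t.2.1, min_eq_right s.2.1, dist_add_left]
      exact hH.dist_delayed_integral_le hτ.le (by positivity) hM (hxs n) t s
  obtain ⟨g, hgA, σ, hσ, hlim⟩ := hAc.tendsto_subseq hmem
  -- The correction ξ (min t t₀) - ξ t₀ restores the history left of t₀, where the projected time is
  -- t₀. The same formula represents the approximations, so convergence on the compact interval
  -- becomes uniform on ℝ.
  set x : ℝ → X := fun t => (ξ (min t t₀) - ξ t₀) + g (projIcc t₀ (t₀ + τ) hle t)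
  have hrep : ∀ n t, xs n t = (ξ (min t t₀) - ξ t₀) + fs n (projIcc t₀ (t₀ + τ) hle t) := by
    intro n t
    change _ = _ + xs n (projIcc t₀ (t₀ + τ) hle t : ℝ)
    have h1 : delayTime t₀ τ (τ / (n + 1)) (projIcc t₀ (t₀ + τ) hle t : ℝ) =
        delayTime t₀ τ (τ / (n + 1)) t := by
      have : (0 : ℝ) ≤ τ / (n + 1) := by positivity
      simp only [delayTime, projIcc]
      rcases le_total t t₀ with h | h
      · rw [min_eq_right (h.trans hle), max_eq_left h, min_eq_left hle, min_eq_left (h.trans hle),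
          max_eq_left, max_eq_left] <;> linarith
      · rw [max_eq_right (le_min hle h), min_comm (t₀ + τ) t, min_assoc, min_self]
    rw [hfix' n t, hfix' n (projIcc t₀ (t₀ + τ) hle t), h1,
      min_eq_right (projIcc t₀ (t₀ + τ) hle t).2.1]
    abel
  have hunif : TendstoUniformly (fun n => xs (σ n)) x atTop := by
    rw [Metric.tendstoUniformly_iff]
    intro ε hε
    have h1 := (Metric.tendsto_nhds.1 hlim) ε hε
    filter_upwards [h1] with n hn t
    rw [hrep (σ n) t]
    simp only [x]
    rw [dist_add_left, dist_comm]
    exact (BoundedContinuousFunction.dist_coe_le_dist _).trans_lt hn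
  have hx : Continues ξ t₀ R x := by
    refine ⟨?_, ?_, ?_⟩
    · exact hunif.continuous (Frequently.of_forall fun n => (hxs (σ n)).continuous)
    · intro t ht
      refine tendsto_nhds_unique (hunif.tendsto_at t) ?_
      simp only [(hxs _).eqOn ht]
      exact tendsto_const_nhds
    · intro t ht
      refine le_of_tendsto ((hunif.tendsto_at t).sub_const (ξ t₀)).norm ?_
      exact Eventually.of_forall fun n => (hxs (σ n)).bound t ht
  refine ⟨x, hx, fun t ht => ?_⟩
  have hsub : uIoc t₀ t ⊆ Icc t₀ (t₀ + τ) := by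
    rw [uIoc_of_le ht.1]
    exact Ioc_subset_Icc_self.trans (Icc_subset_Icc le_rfl ht.2)
  have hI : Tendsto (fun n => ∫ s in t₀..t, H (xs (σ n)) s) atTop (𝓝 (∫ s in t₀..t, H x s)) := by
    refine intervalIntegral.tendsto_integral_filter_of_dominated_convergence (fun _ => M) ?_ ?_
      intervalIntegrable_const ?_
    · exact Eventually.of_forall fun n => (hH.meas _ (hxs _)).mono_set hsub
    · refine Eventually.of_forall fun n => ?_
      rw [← ae_restrict_iff' measurableSet_uIoc]
      exact ae_restrict_of_ae_restrict_of_subset hsub (hH.bound _ (hxs _))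
    · rw [← ae_restrict_iff' measurableSet_uIoc]
      exact ae_restrict_of_ae_restrict_of_subset hsub
        (hH.cont _ _ (fun n => hxs (σ n)) hx hunif)
  -- The delayed and the undelayed integral differ by at most M times the delay.
  have hdelay : Tendsto (fun n => xs (σ n) t - (ξ t₀ + ∫ s in t₀..t, H (xs (σ n)) s)) atTop
      (𝓝 0) := by
    have hb : Tendsto (fun n : ℕ => M * (τ / ((σ n : ℝ) + 1))) atTop (𝓝 0) := by
      have h1 : Tendsto (fun n : ℕ => τ / ((n : ℝ) + 1)) atTop (𝓝 0) := by
        have := (tendsto_one_div_add_atTop_nhds_zero_nat (𝕜 := ℝ)).const_mul τ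
        simpa [mul_one_div, div_eq_mul_inv] using this
      simpa using (h1.comp hσ.tendsto_atTop).const_mul M
    refine squeeze_zero_norm (fun n => ?_) hb
    have hδ : (0 : ℝ) ≤ τ / ((σ n : ℝ) + 1) := by positivity
    rw [hfix' (σ n) t, min_eq_right ht.1, add_sub_add_left_eq_sub, ← dist_eq_norm]
    refine (hH.dist_integral_le hτ.le (hxs _) _ (delayTime_mem hτ.le hδ) _ ht).trans
      (mul_le_mul_of_nonneg_left ?_ hM)
    rw [Real.dist_eq, abs_le, delayTime, min_eq_left ht.2]
    refine ⟨?_, ?_⟩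
    · linarith [le_max_right t₀ (t - τ / ((σ n : ℝ) + 1))]
    · rcases max_cases t₀ (t - τ / ((σ n : ℝ) + 1)) with h | h <;> linarith [ht.1]
  have h1 := (hunif.tendsto_at t).sub (hI.const_add (ξ t₀))
  exact sub_eq_zero.1 (tendsto_nhds_unique h1 hdelay)

end

end FunnelControl

namespace FunnelControl

/-! ### Sobolev functions on an interval -/

theorem exists_Icc_of_isCompact_subset {J K : Set ℝ} (hJ : IsOpen J) (hJc : J.OrdConnected)
    (hne : J.Nonempty) (hK : IsCompact K) (hKJ : K ⊆ J) :
    ∃ c d, c < d ∧ Icc c d ⊆ J ∧ K ⊆ Ioo c d := by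
  obtain ⟨x, hx⟩ := hne
  have hK' : IsCompact (insert x K) := hK.insert x
  have hsub : insert x K ⊆ J := insert_subset hx hKJ
  obtain ⟨a, ha, ha'⟩ := hK'.exists_isLeast (insert_nonempty _ _)
  obtain ⟨b, hb, hb'⟩ := hK'.exists_isGreatest (insert_nonempty _ _)
  obtain ⟨c, hc, hcJ⟩ := (mem_nhdsLE_iff_exists_Icc_subset).1
    (mem_nhdsWithin_of_mem_nhds (hJ.mem_nhds (hsub ha)))
  obtain ⟨d, hd, hdJ⟩ := (mem_nhdsGE_iff_exists_Icc_subset).1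
    (mem_nhdsWithin_of_mem_nhds (hJ.mem_nhds (hsub hb)))
  have hc' : c < a := hc
  have hd' : b < d := hd
  have hab : a ≤ b := ha' hb
  refine ⟨c, d, by linarith, hJc.out (hcJ ⟨le_rfl, hc'.le⟩) (hdJ ⟨hd'.le, le_rfl⟩), ?_⟩
  exact fun y hy => ⟨hc'.trans_le (ha' (mem_insert_of_mem _ hy)),
    (hb' (mem_insert_of_mem _ hy)).trans_lt hd'⟩

theorem ae_mem_interior {I : Set ℝ} (hI : Convex ℝ I) :
    ∀ᵐ t ∂volume.restrict I, t ∈ interior I := by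
  have h1 : ∀ᵐ t : ℝ, t ∉ frontier I := by
    rw [ae_iff]; simpa using hI.addHaar_frontier volume
  filter_upwards [ae_restrict_of_ae h1, ae_restrict_mem hI.ordConnected.measurableSet] with t h2 h3
  by_contra h4
  exact h2 ⟨subset_closure h3, h4⟩

theorem exists_ae_bound {F : Type*} [NormedAddCommGroup F] {g : ℝ → F} {μ : Measure ℝ}
    (h : MemLp g ⊤ μ) : ∃ C, 0 ≤ C ∧ ∀ᵐ t ∂μ, ‖g t‖ ≤ C := by
  refine ⟨(eLpNormEssSup g μ).toReal, ENNReal.toReal_nonneg, ?_⟩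
  have h1 : eLpNormEssSup g μ < ⊤ := by simpa using h.2
  filter_upwards [ae_le_eLpNormEssSup (f := g) (μ := μ)] with t ht
  rw [← ENNReal.ofReal_le_ofReal_iff ENNReal.toReal_nonneg, ENNReal.ofReal_toReal h1.ne]
  simpa using ht

/-- A test function that vanishes outside `I` does not see the complement of `I`. -/
theorem setIntegral_smul_eq_of_support {F : Type*} [NormedAddCommGroup F] [NormedSpace ℝ F]
    {I J : Set ℝ} (hI : MeasurableSet I) {ψ : ℝ → ℝ} (hJI : J ⊆ I)
    (hψ : ∀ t ∉ J, ψ t = 0) (g : ℝ → F) : ∫ t in J, ψ t • g t = ∫ t in I, ψ t • g t := by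
  refine (setIntegral_eq_of_subset_of_forall_sdiff_eq_zero hI hJI fun t ht => ?_).symm
  rw [hψ t ht.2, zero_smul]

/-- Integration by parts: the product of g and a test function is Lipschitz on a compact interval
containing the support, and it vanishes at both ends. -/
theorem isWeakDeriv_of_lipOn {n : ℕ} {I : Set ℝ} (hI : Convex ℝ I) {g g' : ℝ → E n}
    (hg : ∀ a b, Icc a b ⊆ I → LipOn g (Icc a b))
    (h : ∀ᵐ t ∂volume.restrict I, HasDerivAt g (g' t) t)
    (hm : AEStronglyMeasurable g' (volume.restrict I)) : IsWeakDeriv I g g' := by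
  intro ψ hψ hψc hψI
  rcases (interior I).eq_empty_or_nonempty with hemp | hne
  · have : ψ = 0 := by
      rw [← tsupport_eq_empty_iff]; exact subset_empty_iff.1 (hemp ▸ hψI)
    simp [this]
  obtain ⟨c, d, hcd, hcdI, hsupp⟩ := exists_Icc_of_isCompact_subset isOpen_interior
    hI.interior.ordConnected hne hψc hψI
  have hcdI' : Icc c d ⊆ I := hcdI.trans interior_subset
  have hIm := hI.ordConnected.measurableSet
  have hz : ∀ t ∉ Icc c d, ψ t = 0 := fun t ht => by
    by_contra h0
    exact ht (Ioo_subset_Icc_self (hsupp (subset_tsupport _ h0)))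
  have hz' : ∀ t ∉ Icc c d, deriv ψ t = 0 := fun t ht => by
    by_contra h0
    exact ht (Ioo_subset_Icc_self (hsupp (support_deriv_subset h0)))
  rw [← setIntegral_smul_eq_of_support hIm hcdI' hz',
    ← setIntegral_smul_eq_of_support hIm hcdI' hz]
  have hψ1 : ContDiff ℝ 1 ψ := hψ.of_le (by exact_mod_cast le_top)
  obtain ⟨C, hC⟩ := hψ1.lipschitzWith_of_hasCompactSupport hψc one_ne_zero
  have hcψ : Continuous ψ := hψ.continuous
  have hcψ' : Continuous (deriv ψ) := hψ1.continuous_deriv_one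
  obtain ⟨A, hA⟩ := isCompact_Icc.exists_bound_of_continuousOn (hcψ.continuousOn (s := Icc c d))
  obtain ⟨A', hA'⟩ := isCompact_Icc.exists_bound_of_continuousOn (hcψ'.continuousOn (s := Icc c d))
  obtain ⟨B, hB⟩ := isCompact_Icc.exists_bound_of_continuousOn (hg c d hcdI').continuousOn
  obtain ⟨D, hD0, hD⟩ := (hg c d hcdI').exists_dist_le
  have hL := (LipOn.smul ⟨C, hC.lipschitzOnWith (s := Icc c d)⟩ (hg c d hcdI') hA hB)
  have hmI : AEStronglyMeasurable g' (volume.restrict (Icc c d)) :=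
    hm.mono_measure (Measure.restrict_mono hcdI' le_rfl)
  have hgm : AEStronglyMeasurable g (volume.restrict (Icc c d)) :=
    (hg c d hcdI').continuousOn.aestronglyMeasurable measurableSet_Icc
  have hder := ae_restrict_of_ae_restrict_of_subset hcdI' h
  have hg'b : ∀ᵐ t ∂volume.restrict (Icc c d), ‖g' t‖ ≤ D := by
    have hder' := hder
    rw [ae_restrict_Icc_iff_Ioo] at hder' ⊢
    filter_upwards [hder', ae_restrict_mem measurableSet_Ioo] with t h1 h2
    rw [← h1.deriv]
    exact norm_deriv_le_of_dist_le hD hD0 (Icc_mem_nhds h2.1 h2.2)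
  have hi1 : IntegrableOn (fun t => deriv ψ t • g t) (Icc c d) :=
    Integrable.of_bound (hcψ'.aestronglyMeasurable.smul hgm) (A' * B) (by
      filter_upwards [ae_restrict_mem measurableSet_Icc] with t ht
      rw [norm_smul]
      exact mul_le_mul (hA' t ht) (hB t ht) (norm_nonneg _) ((norm_nonneg _).trans (hA' t ht)))
  have hi2 : IntegrableOn (fun t => ψ t • g' t) (Icc c d) :=
    Integrable.of_bound (hcψ.aestronglyMeasurable.smul hmI) (A * D) (by
      filter_upwards [ae_restrict_mem measurableSet_Icc, hg'b] with t ht ht'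
      rw [norm_smul]
      exact mul_le_mul (hA t ht) ht' (norm_nonneg _) ((norm_nonneg _).trans (hA t ht)))
  have hfull := hL.integral_eq_sub (g' := fun t => ψ t • g' t + deriv ψ t • g t)
    (C := A * D + A' * B) hcd.le (hi2.add hi1).1 (by
      filter_upwards [ae_restrict_mem measurableSet_Icc, hg'b] with t ht ht'
      refine (norm_add_le _ _).trans ?_
      rw [norm_smul, norm_smul]
      exact add_le_add
        (mul_le_mul (hA t ht) ht' (norm_nonneg _) ((norm_nonneg _).trans (hA t ht)))
        (mul_le_mul (hA' t ht) (hB t ht) (norm_nonneg _) ((norm_nonneg _).trans (hA' t ht))))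
    (by
      filter_upwards [hder] with t ht
      exact (hψ1.differentiable one_ne_zero t).hasDerivAt.smul ht)
  have hc0 : ψ c = 0 := by
    by_contra h0; exact lt_irrefl _ (hsupp (subset_tsupport _ h0)).1
  have hd0 : ψ d = 0 := by
    by_contra h0; exact lt_irrefl _ (hsupp (subset_tsupport _ h0)).2
  rw [intervalIntegral.integral_of_le hcd.le, ← integral_Icc_eq_integral_Ioc, hc0, hd0, zero_smul,
    zero_smul, sub_zero, integral_add hi2 hi1] at hfull
  rw [eq_neg_iff_add_eq_zero, add_comm]
  exact hfull

theorem integrableOn_smul_of_hasCompactSupport {n : ℕ} {I : Set ℝ} (hI : MeasurableSet I)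
    {u : ℝ → E n} (hloc : LocallyIntegrable (I.indicator u)) {ζ : ℝ → ℝ} (hc : Continuous ζ)
    (hs : HasCompactSupport ζ) : IntegrableOn (fun t => ζ t • u t) I := by
  have h3 := hloc.integrable_smul_left_of_hasCompactSupport hc hs
  refine (h3.integrableOn (s := I)).congr_fun (fun t ht => ?_) hI
  simp only [indicator_of_mem ht]

/-- The du Bois-Reymond lemma: a function with weak derivative zero is constant. -/
theorem ae_eq_const_of_isWeakDeriv_zero {n : ℕ} {I : Set ℝ} (hI : Convex ℝ I)
    (hne : (interior I).Nonempty) {u : ℝ → E n} (hloc : LocallyIntegrable (I.indicator u))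
    (h : ∀ ψ : ℝ → ℝ, ContDiff ℝ ((⊤ : ℕ∞) : WithTop ℕ∞) ψ → HasCompactSupport ψ →
      tsupport ψ ⊆ interior I → ∫ t in I, deriv ψ t • u t = 0) :
    ∃ C, ∀ᵐ t ∂volume.restrict I, u t = C := by
  have hIm := hI.ordConnected.measurableSet
  obtain ⟨x, hx⟩ := hne
  obtain ⟨r, hr, hrI⟩ := Metric.isOpen_iff.1 isOpen_interior x hx
  let bump : ContDiffBump x := ⟨r / 4, r / 2, by positivity, by linarith⟩
  set η : ℝ → ℝ := bump.normed volume
  have hη1 : ∫ t, η t = 1 := bump.integral_normed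
  have hηd : ContDiff ℝ ((⊤ : ℕ∞) : WithTop ℕ∞) η := bump.contDiff_normed
  have hηc : HasCompactSupport η := bump.hasCompactSupport_normed
  have hηI : tsupport η ⊆ interior I := by
    rw [bump.tsupport_normed_eq]
    exact (Metric.closedBall_subset_ball (by change r / 2 < r; linarith)).trans hrI
  have hint := fun ζ : ℝ → ℝ => integrableOn_smul_of_hasCompactSupport hIm hloc (ζ := ζ)
  have hint' : ∀ ζ : ℝ → ℝ, ∀ C : E n, Continuous ζ → HasCompactSupport ζ →
      IntegrableOn (fun t => ζ t • C) I := fun ζ C h1 h2 =>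
    ((h1.integrable_of_hasCompactSupport h2).smul_const C).integrableOn
  set C := ∫ t in I, η t • u t with hC
  refine ⟨C, ?_⟩
  have hw : LocallyIntegrableOn (fun t => I.indicator u t - C) (interior I) :=
    (hloc.sub (locallyIntegrable_const C)).locallyIntegrableOn _
  have key := isOpen_interior.ae_eq_zero_of_integral_contDiff_smul_eq_zero (μ := volume) hw
    (fun ζ hζ hζc hζI => ?_)
  · rw [ae_restrict_iff' hIm]
    have h1 := ae_mem_interior hI
    rw [ae_restrict_iff' hIm] at h1
    filter_upwards [key, h1] with t h2 h3 h4
    have h5 := h2 (h3 h4)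
    rw [indicator_of_mem h4] at h5
    exact sub_eq_zero.1 h5
  · set a := ∫ t, ζ t
    have hK : IsCompact (tsupport ζ ∪ tsupport η) := hζc.isCompact.union hηc.isCompact
    obtain ⟨c, d, hcd, hcdI, hsupp⟩ := exists_Icc_of_isCompact_subset isOpen_interior
      hI.interior.ordConnected ⟨x, hx⟩ hK (union_subset hζI hηI)
    -- θ has integral zero, so its primitive is again a test function. Inserting that primitive
    -- turns the hypothesis into ∫ ζ u = (∫ ζ) C, where C = ∫ η u.
    set θ : ℝ → ℝ := fun t => ζ t - a * η t
    have hθd : ContDiff ℝ ((⊤ : ℕ∞) : WithTop ℕ∞) θ := hζ.sub (contDiff_const.mul hηd)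
    have hθ0 : ∀ t ∉ Ioo c d, θ t = 0 := by
      intro t ht
      have h1 : ζ t = 0 := by
        by_contra h0; exact ht (hsupp (Or.inl (subset_tsupport _ h0)))
      have h2 : η t = 0 := by
        by_contra h0; exact ht (hsupp (Or.inr (subset_tsupport _ h0)))
      simp [θ, h1, h2]
    have hζi := hζ.continuous.integrable_of_hasCompactSupport hζc (μ := volume)
    have hηi := hηd.continuous.integrable_of_hasCompactSupport hηc (μ := volume)
    have hθi : ∫ t, θ t = 0 := by
      rw [integral_sub hζi (hηi.const_mul a), integral_const_mul, hη1, mul_one, sub_self]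
    have hprim : ∀ t, HasDerivAt (fun t => ∫ s in c..t, θ s) (θ t) t := fun t =>
      intervalIntegral.integral_hasDerivAt_right (hθd.continuous.intervalIntegrable _ _)
        (hθd.continuous.stronglyMeasurableAtFilter _ _) hθd.continuous.continuousAt
    have hderiv : deriv (fun t => ∫ s in c..t, θ s) = θ := funext fun t => (hprim t).deriv
    have hψ0 : ∀ t ∉ Icc c d, (∫ s in c..t, θ s) = 0 := by
      intro t ht
      rcases lt_or_ge t c with h1 | h1
      · rw [intervalIntegral.integral_symm, intervalIntegral.integral_of_le h1.le,
          setIntegral_eq_zero_of_forall_eq_zero, neg_zero]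
        exact fun s hs => hθ0 s fun h2 => by linarith [h2.1, hs.2]
      · have h2 : d < t := by
          by_contra h3; exact ht ⟨h1, not_lt.1 h3⟩
        rw [intervalIntegral.integral_of_le h1, setIntegral_eq_integral_of_forall_compl_eq_zero,
          hθi]
        exact fun s hs => hθ0 s fun h3 => hs ⟨h3.1, h3.2.le.trans h2.le⟩
    have hts : tsupport (fun t => ∫ s in c..t, θ s) ⊆ Icc c d :=
      closure_minimal (fun t ht => by
        by_contra h0; exact ht (hψ0 t h0)) isClosed_Icc
    have h0 := h (fun t => ∫ s in c..t, θ s)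
      (contDiff_infty_iff_deriv.2 ⟨fun t => (hprim t).differentiableAt, by rw [hderiv]; exact hθd⟩)
      (HasCompactSupport.of_support_subset_isCompact isCompact_Icc
        ((subset_tsupport _).trans hts)) (hts.trans hcdI)
    rw [hderiv] at h0
    have h1 : ∫ t in I, θ t • u t = (∫ t in I, ζ t • u t) - a • C := by
      simp only [θ, sub_smul, mul_smul]
      have h1 : IntegrableOn (fun t => a • η t • u t) I := (hint η hηd.continuous hηc).smul a
      rw [integral_sub (hint ζ hζ.continuous hζc) h1, integral_smul, hC]
    have hζ0 : ∀ t ∉ I, ζ t = 0 := fun t ht => by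
      by_contra h2; exact ht (interior_subset (hζI (subset_tsupport _ h2)))
    have h2 : ∫ t, ζ t • (I.indicator u t - C) = ∫ t in I, ζ t • (I.indicator u t - C) := by
      rw [setIntegral_eq_integral_of_forall_compl_eq_zero]
      intro t ht
      rw [hζ0 t ht, zero_smul]
    have h3 : ∫ t in I, ζ t • (I.indicator u t - C) = ∫ t in I, (ζ t • u t - ζ t • C) := by
      refine setIntegral_congr_fun hIm fun t ht => ?_
      simp only [indicator_of_mem ht, smul_sub]
    have h4 : ∫ t in I, ζ t • C = a • C := by
      rw [integral_smul_const, setIntegral_eq_integral_of_forall_compl_eq_zero hζ0]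
    rw [h2, h3, integral_sub (hint ζ hζ.continuous hζc) (hint' ζ C hζ.continuous hζc), h4, ← h1, h0]

/-- A bounded function with bounded weak derivative `g'` is, up to a null set, a primitive
of `g'`. -/
theorem exists_primitive_of_isWeakDeriv {n : ℕ} {I : Set ℝ} (hI : Convex ℝ I)
    (hne : (interior I).Nonempty) {g g' : ℝ → E n} (hg : MemLp g ⊤ (volume.restrict I))
    (hg' : MemLp g' ⊤ (volume.restrict I)) (h : IsWeakDeriv I g g') (c : ℝ) :
    LipOn (fun t => ∫ s in c..t, I.indicator g' s) univ ∧
    ∃ C, ∀ᵐ t ∂volume.restrict I, g t = C + ∫ s in c..t, I.indicator g' s := by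
  have hIm := hI.ordConnected.measurableSet
  have hmem : MemLp (I.indicator g') ⊤ volume := (memLp_indicator_iff_restrict hIm).2 hg'
  have hloc : LocallyIntegrable (I.indicator g') := hmem.locallyIntegrable (by simp)
  obtain ⟨B, -, hB⟩ := exists_ae_bound hmem
  set P : ℝ → E n := fun t => ∫ s in c..t, I.indicator g' s
  have hP : LipOn P univ := by
    refine LipOn.of_dist_le (C := B) fun s _ t _ => ?_
    refine dist_primitive_le (a := min c (min s t)) (b := max c (max s t)) hmem.1.restrict ?_
      (ae_restrict_of_ae hB) s ?_ t ?_ <;> simp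
  refine ⟨hP, ?_⟩
  have hPd : ∀ᵐ t, HasDerivAt P (I.indicator g' t) t := by
    filter_upwards [LocallyIntegrable.ae_hasDerivAt_integral hloc] with t ht using ht c
  have hPd' : ∀ᵐ t ∂volume.restrict I, HasDerivAt P (g' t) t := by
    filter_upwards [ae_restrict_of_ae hPd, ae_restrict_mem hIm] with t h1 h2
    rwa [indicator_of_mem h2] at h1
  have hPw : IsWeakDeriv I P g' := isWeakDeriv_of_lipOn hI (fun a b _ => hP.mono (subset_univ _))
    hPd' hg'.1
  have hgloc : LocallyIntegrable (I.indicator g) :=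
    ((memLp_indicator_iff_restrict hIm).2 hg).locallyIntegrable (by simp)
  have hPc : Continuous P := continuousOn_univ.1 hP.continuousOn
  have hPloc : LocallyIntegrable (I.indicator P) := hPc.locallyIntegrable.indicator hIm
  -- g and P have the same weak derivative.
  obtain ⟨C, hC⟩ := ae_eq_const_of_isWeakDeriv_zero hI hne (u := fun t => g t - P t) (by
    have := hgloc.sub hPloc
    refine this.congr (Eventually.of_forall fun t => ?_)
    by_cases ht : t ∈ I <;> simp [ht]) (fun ψ h1 h2 h3 => by
    have h4 : Continuous (deriv ψ) :=
      (h1.of_le (by exact_mod_cast le_top) : ContDiff ℝ 1 ψ).continuous_deriv_one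
    simp only [smul_sub]
    rw [integral_sub (integrableOn_smul_of_hasCompactSupport hIm hgloc h4 h2.deriv)
      (integrableOn_smul_of_hasCompactSupport hIm hPloc h4 h2.deriv), h ψ h1 h2 h3, hPw ψ h1 h2 h3,
      sub_self])
  refine ⟨C, ?_⟩
  filter_upwards [hC] with t h1
  rw [← h1]; simp [P]

theorem subset_closure_interior {I : Set ℝ} (hI : Convex ℝ I) (hne : (interior I).Nonempty) :
    I ⊆ closure (interior I) := by
  rw [hI.closure_interior_eq_closure_of_nonempty_interior hne]
  exact subset_closure

/-- The functions min(‖g‖, C) and ‖g‖ are continuous and agree almost everywhere, hence on all of I,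
which lies in the closure of its interior. -/
theorem norm_le_of_ae_norm_le {F : Type*} [NormedAddCommGroup F] {I : Set ℝ} (hI : Convex ℝ I)
    (hne : (interior I).Nonempty) {g : ℝ → F} (hg : ContinuousOn g I) {C : ℝ}
    (h : ∀ᵐ t ∂volume.restrict I, ‖g t‖ ≤ C) : ∀ t ∈ I, ‖g t‖ ≤ C := by
  have h1 : EqOn (fun t => min ‖g t‖ C) (fun t => ‖g t‖) I := by
    refine Measure.eqOn_of_ae_eq (μ := volume) ?_ (ContinuousOn.inf hg.norm continuousOn_const) hg.norm
      (subset_closure_interior hI hne)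
    filter_upwards [h] with t ht using min_eq_left ht
  intro t ht
  exact min_eq_left_iff.1 (h1 ht)

/-- `D 0, …, D (k-1)` are the successive derivatives of `D 0` on `I`, they are bounded, and the last
one is Lipschitz. -/
structure IsSmoothChain {n : ℕ} (k : ℕ) (I : Set ℝ) (D : ℕ → ℝ → E n) : Prop where
  hasDeriv : ∀ j, j + 1 < k → ∀ t ∈ I, HasDerivWithinAt (D j) (D (j + 1) t) I t
  lip : ∀ j < k, LipOn (D j) I
  bdd : ∀ j < k, ∃ C, ∀ t ∈ I, ‖D j t‖ ≤ C

/-- Each weak derivative of order below k is replaced by its primitive representative. The integrand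
of the j-th primitive agrees almost everywhere with the continuous representative of order j + 1, so
the fundamental theorem of calculus makes it a classical derivative. -/
theorem MemWInf.exists_isSmoothChain {n k : ℕ} {I : Set ℝ} (hI : Convex ℝ I)
    (hne : (interior I).Nonempty) {g : ℝ → E n} (hg : MemWInf k I g) (hc : ContinuousOn g I)
    (hk : 1 ≤ k) : ∃ D : ℕ → ℝ → E n, EqOn (D 0) g I ∧ IsSmoothChain k I D := by
  obtain ⟨G, rfl, hG, hw⟩ := hg
  obtain ⟨c, hcI⟩ := hne
  have hIm := hI.ordConnected.measurableSet
  choose! hL C hC using fun j (hj : j < k) => exists_primitive_of_isWeakDeriv hI ⟨c, hcI⟩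
    (hG j hj.le) (hG (j + 1) hj) (hw j hj) c
  set D : ℕ → ℝ → E n := fun j t => C j + ∫ s in c..t, I.indicator (G (j + 1)) s
  have hDL : ∀ j < k, LipOn (D j) univ := fun j hj =>
    LipOn.add (LipOn.of_dist_le (C := 0) (by simp)) (hL j hj)
  have hDc : ∀ j < k, Continuous (D j) := fun j hj => continuousOn_univ.1 (hDL j hj).continuousOn
  refine ⟨D, ?_, ?_, fun j hj => (hDL j hj).mono (subset_univ _), fun j hj => ?_⟩
  · refine (Measure.eqOn_of_ae_eq (μ := volume) ?_ hc (hDc 0 hk).continuousOn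
      (subset_closure_interior hI ⟨c, hcI⟩)).symm
    exact hC 0 hk
  · intro j hj t ht
    have h1 : HasDerivAt (fun t => C j + ∫ s in c..t, D (j + 1) s) (D (j + 1) t) t :=
      (intervalIntegral.integral_hasDerivAt_right ((hDc _ hj).intervalIntegrable _ _)
        ((hDc _ hj).stronglyMeasurableAtFilter _ _) (hDc _ hj).continuousAt).const_add _
    refine h1.hasDerivWithinAt.congr_of_mem (fun s hs => ?_) ht
    simp only [D]
    congr 1
    refine intervalIntegral.integral_congr_ae ?_
    have h2 := hC (j + 1) hj
    rw [ae_restrict_iff' hIm] at h2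
    filter_upwards [h2] with r h3 h4
    have h5 : r ∈ I := hI.ordConnected.uIcc_subset (interior_subset hcI) hs (uIoc_subset_uIcc h4)
    rw [indicator_of_mem h5]
    exact h3 h5
  · obtain ⟨B, -, hB⟩ := exists_ae_bound (hG j hj.le)
    refine ⟨B, norm_le_of_ae_norm_le hI ⟨c, hcI⟩ (hDc j hj).continuousOn ?_⟩
    filter_upwards [hB, hC j hj] with t h1 h2
    rw [h2] at h1
    exact h1

/-- The missing derivative of order k is the almost everywhere derivative of the last, Lipschitz,
member; the Lipschitz constant bounds it. -/
theorem IsSmoothChain.memWInf {n k : ℕ} {I : Set ℝ} (hI : Convex ℝ I) {D : ℕ → ℝ → E n}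
    (hD : IsSmoothChain k I D) (hk : 1 ≤ k) : MemWInf k I (D 0) := by
  have hIm := hI.ordConnected.measurableSet
  obtain ⟨l, rfl⟩ : ∃ l, k = l + 1 := ⟨k - 1, by omega⟩
  obtain ⟨C, hC0, hC⟩ := (hD.lip l (by omega)).exists_dist_le
  refine ⟨fun j => if j < l + 1 then D j else deriv (D l), by simp, fun j hj => ?_, fun j hj => ?_⟩
  · rcases hj.lt_or_eq with h | rfl
    · simp only [h, if_true]
      obtain ⟨B, hB⟩ := hD.bdd j h
      refine memLp_top_of_bound ((hD.lip j h).continuousOn.aestronglyMeasurable hIm) B ?_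
      filter_upwards [ae_restrict_mem hIm] with t ht using hB t ht
    · simp only [lt_irrefl, if_false]
      refine memLp_top_of_bound (stronglyMeasurable_deriv _).aestronglyMeasurable C ?_
      filter_upwards [ae_mem_interior hI] with t ht
      exact norm_deriv_le_of_dist_le hC hC0 (mem_interior_iff_mem_nhds.1 ht)
  · simp only [hj, if_true]
    rcases (Nat.lt_succ_iff.1 hj).lt_or_eq with h | rfl
    · simp only [Nat.add_lt_add_right h 1, if_true]
      refine isWeakDeriv_of_lipOn hI (fun a b hab => (hD.lip j hj).mono hab) ?_
        ((hD.lip (j + 1) (by omega)).continuousOn.aestronglyMeasurable hIm)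
      filter_upwards [ae_mem_interior hI] with t ht
      exact (hD.hasDeriv j (by omega) t (interior_subset ht)).hasDerivAt
        (mem_interior_iff_mem_nhds.1 ht)
    · simp only [lt_irrefl, if_false]
      refine isWeakDeriv_of_lipOn hI (fun a b hab => (hD.lip j hj).mono hab) ?_
        (stronglyMeasurable_deriv _).aestronglyMeasurable
      obtain ⟨K, hK⟩ := hD.lip j hj
      filter_upwards [hK.ae_differentiableWithinAt_real hIm, ae_mem_interior hI] with t h1 h2
      exact (h1.differentiableAt (mem_interior_iff_mem_nhds.1 h2)).hasDerivAt

/-- The iterated derivatives are determined by a chain of derivatives. -/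
theorem iteratedDerivWithin_eq_of_hasDerivWithinAt {n k : ℕ} {I : Set ℝ} (hI : UniqueDiffOn ℝ I)
    {D : ℕ → ℝ → E n} (h : ∀ j, j + 1 < k → ∀ t ∈ I, HasDerivWithinAt (D j) (D (j + 1) t) I t)
    {y : ℝ → E n} (hy : EqOn y (D 0) I) : ∀ j < k, EqOn (iteratedDerivWithin j y I) (D j) I := by
  intro j
  induction j with
  | zero => intro _ t ht; rw [iteratedDerivWithin_zero]; exact hy ht
  | succ j ih =>
    intro hj t ht
    rw [iteratedDerivWithin_succ]
    have h1 := (h j hj t ht).congr_of_mem (ih (by omega)) ht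
    exact h1.derivWithin (hI t ht)

theorem hasDerivWithinAt_chain_unique {n k : ℕ} {I : Set ℝ} (hI : UniqueDiffOn ℝ I)
    {D D' : ℕ → ℝ → E n}
    (h : ∀ j, j + 1 < k → ∀ t ∈ I, HasDerivWithinAt (D j) (D (j + 1) t) I t)
    (h' : ∀ j, j + 1 < k → ∀ t ∈ I, HasDerivWithinAt (D' j) (D' (j + 1) t) I t)
    (h0 : EqOn (D 0) (D' 0) I) : ∀ j < k, EqOn (D j) (D' j) I := fun j hj t ht => by
  rw [← iteratedDerivWithin_eq_of_hasDerivWithinAt hI h (fun _ _ => rfl) j hj ht,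
    ← iteratedDerivWithin_eq_of_hasDerivWithinAt hI h' h0 j hj ht]

theorem contDiffOn_of_hasDerivWithinAt {n k : ℕ} {I : Set ℝ} (hI : UniqueDiffOn ℝ I)
    {D : ℕ → ℝ → E n} (h : ∀ j, j + 1 < k → ∀ t ∈ I, HasDerivWithinAt (D j) (D (j + 1) t) I t)
    (hc : ∀ j < k, ContinuousOn (D j) I) (hk : 1 ≤ k) {y : ℝ → E n} (hy : EqOn y (D 0) I) :
    ContDiffOn ℝ ((k - 1 : ℕ) : WithTop ℕ∞) y I := by
  have h1 := iteratedDerivWithin_eq_of_hasDerivWithinAt hI h hy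
  rw [contDiffOn_nat_iff_continuousOn_differentiableOn_deriv hI]
  refine ⟨fun j hj => (hc j (by omega)).congr (h1 j (by omega)), fun j hj => ?_⟩
  exact DifferentiableOn.congr (fun t ht => (h j (by omega) t ht).differentiableWithinAt)
    (h1 j (by omega))

end FunnelControl

namespace FunnelControl

/-! ### Gain functions -/

section gain

variable {α : ℝ → ℝ}

/-- A continuous injection of an interval is strictly monotone; decrease is impossible because α is
unbounded while bounded on each compact part of [0, 1). The point z supplies a value exceeding all
those on [0, y]. -/
theorem gain_strictMonoOn (hα : ContDiffOn ℝ 1 α (Ico 0 1)) (hb : BijOn α (Ico 0 1) (Ici 1)) :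
    StrictMonoOn α (Ico 0 1) := by
  intro x hx y hy hxy
  by_contra! hle
  obtain ⟨B, hB⟩ := isCompact_Icc.exists_bound_of_continuousOn
    (hα.continuousOn.mono (Icc_subset_Ico_right hy.2))
  obtain ⟨z, hz, hzB⟩ := hb.surjOn (show max B 1 + 1 ∈ Ici (1 : ℝ) by
    simp only [mem_Ici]; linarith [le_max_right B 1])
  have hyz : y < z := by
    by_contra! hzy
    have := (le_abs_self _).trans (hB z ⟨hz.1, hzy⟩)
    linarith [le_max_left B 1]
  have hyB := (le_abs_self _).trans (hB y ⟨hy.1, le_rfl⟩)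
  have hsub : Icc x z ⊆ Ico 0 1 := (Icc_subset_Icc_left hx.1).trans (Icc_subset_Ico_right hz.2)
  rcases ContinuousOn.strictMonoOn_of_injOn_Icc' (hxy.trans hyz).le (hα.continuousOn.mono hsub)
    (hb.injOn.mono hsub) with h | h
  · exact absurd (h ⟨le_rfl, (hxy.trans hyz).le⟩ ⟨hxy.le, hyz.le⟩ hxy) (not_lt.2 hle)
  · have := h ⟨hxy.le, hyz.le⟩ ⟨(hxy.trans hyz).le, le_rfl⟩ hyz
    linarith [le_max_left B 1]

theorem one_le_gain (hb : BijOn α (Ico 0 1) (Ici 1)) {s : ℝ} (hs : s ∈ Ico (0 : ℝ) 1) :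
    1 ≤ α s := hb.mapsTo hs

theorem exists_gain_eq (hα : ContDiffOn ℝ 1 α (Ico 0 1)) (hb : BijOn α (Ico 0 1) (Ici 1))
    {s₀ a : ℝ} (h0 : s₀ ∈ Ico (0 : ℝ) 1) (ha : α s₀ < a) : ∃ L ∈ Ioo s₀ 1, α L = a := by
  obtain ⟨L, hL, rfl⟩ := hb.surjOn (show a ∈ Ici (1 : ℝ) from (one_le_gain hb h0).trans ha.le)
  exact ⟨L, ⟨((gain_strictMonoOn hα hb).lt_iff_lt h0 hL).1 ha, hL.2⟩, rfl⟩

theorem gam_lipOn {m : ℕ} (hα : ContDiffOn ℝ 1 α (Ico 0 1)) {ε : ℝ} (h1 : ε < 1) :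
    LipOn (gam α : E m → E m) (Metric.closedBall 0 ε) ∧
      ∃ B, ∀ w ∈ Metric.closedBall (0 : E m) ε, ‖gam α w‖ ≤ B := by
  have hn : ∀ w ∈ Metric.closedBall (0 : E m) ε, ‖w‖ ≤ ε := fun w hw => by simpa using hw
  have hid : LipOn (fun w : E m => w) (Metric.closedBall 0 ε) :=
    LipOn.of_dist_le (C := 1) fun x _ y _ => by simp
  have hsq : MapsTo (fun w : E m => ‖w‖ ^ 2) (Metric.closedBall 0 ε) (Icc 0 (ε ^ 2)) :=
    fun w hw => ⟨by positivity, pow_le_pow_left₀ (norm_nonneg _) (hn w hw) 2⟩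
  -- For negative ε the ball is empty; this spares callers a sign condition on ε.
  rcases lt_or_ge ε 0 with h0 | h0
  · rw [Metric.closedBall_eq_empty.2 h0]
    exact ⟨⟨0, by simp⟩, 0, by simp⟩
  have hsub : Icc 0 (ε ^ 2) ⊆ Ico (0 : ℝ) 1 := Icc_subset_Ico_right (by nlinarith)
  have hαL : LipOn α (Icc 0 (ε ^ 2)) :=
    (hα.mono hsub).exists_lipschitzOnWith one_ne_zero (convex_Icc _ _) isCompact_Icc
  obtain ⟨A, hA⟩ := isCompact_Icc.exists_bound_of_continuousOn hαL.continuousOn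
  have hL : LipOn (gam α : E m → E m) (Metric.closedBall 0 ε) :=
    (hαL.comp (hid.norm_sq hn) hsq).smul hid (fun w hw => hA _ (hsq hw)) hn
  exact ⟨hL, (isCompact_closedBall _ _).exists_bound_of_continuousOn hL.continuousOn⟩

end gain

/-! ### The function χ and dissipative layers -/

section chi

variable {p q m : ℕ} {f : E p → E q → E m → E m} {vs : ℝ} {Kp : Set (E p)} {Kq : Set (E q)}

theorem isCompact_chi_index (hKp : IsCompact Kp) (hKq : IsCompact Kq) :
    IsCompact {x : E p × E q × E m | x.1 ∈ Kp ∧ x.2.1 ∈ Kq ∧ vs ≤ ‖x.2.2‖ ∧ ‖x.2.2‖ ≤ 1} := by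
  have hn : Continuous fun x : E p × E q × E m => ‖x.2.2‖ := by fun_prop
  refine (hKp.prod (hKq.prod (isCompact_closedBall (0 : E m) 1))).of_isClosed_subset ?_ ?_
  · refine (hKp.isClosed.preimage continuous_fst).inter
      ((hKq.isClosed.preimage (by fun_prop)).inter
        ((isClosed_le continuous_const hn).inter
          (isClosed_le hn continuous_const)))
  · rintro ⟨a, b, c⟩ ⟨h1, h2, -, h3⟩
    exact ⟨h1, h2, by simpa using h3⟩

theorem chi_eq_sInf_image (s : ℝ) : chi f vs Kp Kq s =
    sInf ((fun x : E p × E q × E m => inner ℝ x.2.2 (f x.1 x.2.1 ((-s) • x.2.2))) ''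
      {x | x.1 ∈ Kp ∧ x.2.1 ∈ Kq ∧ vs ≤ ‖x.2.2‖ ∧ ‖x.2.2‖ ≤ 1}) := by
  unfold chi
  congr 1
  ext x
  constructor
  · rintro ⟨δ, hδ, z, hz, v, h1, h2, rfl⟩
    exact ⟨(δ, z, v), ⟨hδ, hz, h1, h2⟩, rfl⟩
  · rintro ⟨⟨δ, z, v⟩, ⟨hδ, hz, h1, h2⟩, rfl⟩
    exact ⟨δ, hδ, z, hz, v, h1, h2, rfl⟩

/-- The infimum runs over a compact index set that does not depend on s. Continuity is what forces
large values of χ ∘ N to occur at large gains, and to persist in a layer. -/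
theorem continuous_chi
    (hf : Continuous (fun x : E p × E q × E m => f x.1 x.2.1 x.2.2))
    (hKp : IsCompact Kp) (hKq : IsCompact Kq) :
    Continuous (chi f vs Kp Kq) := by
  have h1 : Continuous fun y : ℝ × (E p × E q × E m) =>
      (inner ℝ y.2.2.2 (f y.2.1 y.2.2.1 ((-y.1) • y.2.2.2)) : ℝ) := by
    have : Continuous fun y : ℝ × (E p × E q × E m) => f y.2.1 y.2.2.1 ((-y.1) • y.2.2.2) :=
      hf.comp (f := fun y : ℝ × (E p × E q × E m) => (y.2.1, y.2.2.1, (-y.1) • y.2.2.2))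
        (by fun_prop)
    fun_prop
  have h2 := (isCompact_chi_index (vs := vs) (m := m) hKp hKq).continuous_sInf
    (f := fun (s : ℝ) (x : E p × E q × E m) =>
      (inner ℝ x.2.2 (f x.1 x.2.1 ((-s) • x.2.2)) : ℝ)) h1
  exact h2.congr fun s => (chi_eq_sInf_image s).symm

theorem chi_le
    (hf : Continuous (fun x : E p × E q × E m => f x.1 x.2.1 x.2.2))
    (hKp : IsCompact Kp) (hKq : IsCompact Kq) (s : ℝ) {δ : E p} (hδ : δ ∈ Kp) {z : E q}
    (hz : z ∈ Kq) {v : E m} (h1 : vs ≤ ‖v‖) (h2 : ‖v‖ ≤ 1) :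
    chi f vs Kp Kq s ≤ inner ℝ v (f δ z ((-s) • v)) := by
  rw [chi_eq_sInf_image]
  have hc : Continuous fun x : E p × E q × E m =>
      (inner ℝ x.2.2 (f x.1 x.2.1 ((-s) • x.2.2)) : ℝ) := by
    have : Continuous fun x : E p × E q × E m => f x.1 x.2.1 ((-s) • x.2.2) :=
      hf.comp (f := fun x : E p × E q × E m => (x.1, x.2.1, (-s) • x.2.2)) (by fun_prop)
    fun_prop
  exact csInf_le ((isCompact_chi_index hKp hKq).image hc).bddBelow
    ⟨(δ, z, v), ⟨hδ, hz, h1, h2⟩, rfl⟩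

/-- There are arbitrarily large gains at which the feedback is strongly dissipative. -/
theorem exists_gain_lt_chi
    (hf : Continuous (fun x : E p × E q × E m => f x.1 x.2.1 x.2.2))
    {N : ℝ → ℝ} (hN : ContinuousOn N (Ici 0)) {S : Set ℝ}
    (hS : SurjOn N (Ici 0) S) (hKp : IsCompact Kp) (hKq : IsCompact Kq)
    (hb : ¬ BddAbove (chi f vs Kp Kq '' S)) (A C : ℝ) :
    ∃ a, A < a ∧ C < chi f vs Kp Kq (N a) := by
  have hc : ContinuousOn (fun a => chi f vs Kp Kq (N a)) (Icc 0 A) :=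
    (continuous_chi hf hKp hKq).comp_continuousOn (hN.mono fun x hx => hx.1)
  obtain ⟨B, hB⟩ := isCompact_Icc.exists_bound_of_continuousOn hc
  -- A value of χ above its bound B on the gains in [0, A] can only be attained at a gain beyond A.
  obtain ⟨_, ⟨s, hs, rfl⟩, hlt⟩ := not_bddAbove_iff.1 hb (max B C)
  obtain ⟨a, ha, rfl⟩ := hS hs
  refine ⟨a, ?_, (le_max_right _ _).trans_lt hlt⟩
  by_contra! hle
  have := (le_abs_self _).trans (hB a ⟨ha, hle⟩)
  linarith [le_max_left B C]

/-- Above every level there is a layer on which the closed loop is dissipative. -/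
theorem exists_dissipative_layer
    (hf : Continuous (fun x : E p × E q × E m => f x.1 x.2.1 x.2.2))
    {α N : ℝ → ℝ} (hα : ContDiffOn ℝ 1 α (Ico 0 1))
    (hb : BijOn α (Ico 0 1) (Ici 1)) (hN : ContinuousOn N (Ici 0)) {S : Set ℝ}
    (hS : SurjOn N (Ici 0) S) (hgain : HighGainOn S f) (hKp : IsCompact Kp) (hKq : IsCompact Kq)
    (hKp' : Kp.Nonempty) (hKq' : Kq.Nonempty) {s₀ : ℝ} (h0 : s₀ ∈ Ico (0 : ℝ) 1) (C : ℝ) :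
    ∃ L ∈ Ioo s₀ 1, ∃ δ > 0, ∀ w : E m, L < ‖w‖ ^ 2 → ‖w‖ ^ 2 < L + δ → ‖w‖ < 1 →
      ∀ d ∈ Kp, ∀ z ∈ Kq, inner ℝ w (f d z (N (α (‖w‖ ^ 2)) • w)) ≤ -C := by
  obtain ⟨vs, hvs, hgain⟩ := hgain
  have hvs2 : vs ^ 2 ∈ Ico (0 : ℝ) 1 := ⟨by positivity, by nlinarith [hvs.1, hvs.2]⟩
  -- Lying above v*² as well ensures that vectors in the layer are admissible in the minimum
  -- defining χ.
  have hmax : max s₀ (vs ^ 2) ∈ Ico (0 : ℝ) 1 := ⟨h0.1.trans (le_max_left _ _), max_lt h0.2 hvs2.2⟩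
  obtain ⟨a, ha, hC⟩ := exists_gain_lt_chi hf hN hS hKp hKq (hgain Kp Kq hKp hKp' hKq hKq')
    (α (max s₀ (vs ^ 2))) C
  obtain ⟨L, hL, rfl⟩ := exists_gain_eq hα hb hmax ha
  have hLI : L ∈ Ico (0 : ℝ) 1 := ⟨hmax.1.trans hL.1.le, hL.2⟩
  have hc : ContinuousOn (fun s => chi f vs Kp Kq (N (α s))) (Ico 0 1) :=
    (continuous_chi hf hKp hKq).comp_continuousOn
      (hN.comp hα.continuousOn fun s hs => zero_le_one.trans (one_le_gain hb hs))
  have hev : ∀ᶠ s in 𝓝[Ico 0 1] L, C < chi f vs Kp Kq (N (α s)) :=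
    (hc L hLI).eventually (lt_mem_nhds hC)
  obtain ⟨δ, hδ, hball⟩ := Metric.mem_nhdsWithin_iff.1 hev
  refine ⟨L, ⟨(le_max_left _ _).trans_lt hL.1, hL.2⟩, δ, hδ, fun w h1 h2 h3 d hd z hz => ?_⟩
  have h4 : C < chi f vs Kp Kq (N (α (‖w‖ ^ 2))) := by
    refine hball ⟨?_, by positivity, by nlinarith [norm_nonneg w]⟩
    rw [Metric.mem_ball, Real.dist_eq, abs_of_pos (by linarith)]
    linarith
  -- χ is applied to v = -w: then -s v = N w for s = N(α(‖w‖²)), and the lower bound for ⟨-w, f⟩ is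
  -- the wanted upper bound for ⟨w, f⟩.
  have h5 : vs ≤ ‖-w‖ := by
    rw [norm_neg]
    have := (le_max_right s₀ (vs ^ 2)).trans hL.1.le
    exact le_of_sq_le_sq (this.trans h1.le) (norm_nonneg _)
  have h6 := chi_le hf hKp hKq (N (α (‖w‖ ^ 2))) hd hz h5 (by rw [norm_neg]; exact h3.le)
  rw [smul_neg, neg_smul, neg_neg, inner_neg_left] at h6
  linarith

end chi

end FunnelControl

namespace FunnelControl

/-! ### A priori estimates for the error signals -/

theorem memD_of_le {m : ℕ} {α : ℝ → ℝ} {η : ℕ → E m} {k l : ℕ} (h : memD α η l) (hkl : k ≤ l) :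
    memD α η k := by
  induction l with
  | zero => obtain rfl : k = 0 := by omega
            trivial
  | succ l ih =>
    rcases hkl.lt_or_eq with h1 | rfl
    · exact ih h.1 (by omega)
    · exact h

theorem memD.norm_rho_lt {m : ℕ} {α : ℝ → ℝ} {η : ℕ → E m} {k l : ℕ} (h : memD α η l)
    (hkl : k ≤ l) : ‖rho α η k‖ < 1 := by
  cases k with
  | zero => simp [rho]
  | succ k => exact (memD_of_le h hkl).2

theorem memD_of_norm_rho_lt {m : ℕ} {α : ℝ → ℝ} {η : ℕ → E m} {l : ℕ}
    (h : ∀ k ≤ l, ‖rho α η k‖ < 1) : memD α η l := by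
  induction l with
  | zero => trivial
  | succ l ih => exact ⟨ih fun k hk => h k (by omega), h (l + 1) le_rfl⟩

/-- The barrier argument for V = ‖ρ‖², whose derivative is 2⟨ρ, ρ'⟩. -/
theorem norm_sq_le_of_inner_deriv_nonpos {m : ℕ} {ρ : ℝ → E m} {S : Set ℝ} {a : ℝ}
    (hmin : ∀ t ∈ S, a ≤ t)
    (hρ : ∀ b ∈ S, LipOn ρ (Icc a b)) {L δ : ℝ} (hδ : 0 < δ) (h0 : ‖ρ a‖ ^ 2 ≤ L)
    (h : ∀ b ∈ S, ∀ᵐ t ∂volume.restrict (Icc a b), ∀ ρ', HasDerivAt ρ ρ' t →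
      L < ‖ρ t‖ ^ 2 → ‖ρ t‖ ^ 2 < L + δ → inner ℝ (ρ t) ρ' ≤ 0) : ∀ t ∈ S, ‖ρ t‖ ^ 2 ≤ L := by
  intro b hb
  obtain ⟨B, hB⟩ := isCompact_Icc.exists_bound_of_continuousOn (hρ b hb).continuousOn
  refine le_of_ae_deriv_nonpos_above (V := fun t => ‖ρ t‖ ^ 2) (hmin b hb) hδ
    (((hρ b hb).norm_sq hB).ac (hmin b hb)) h0 ?_
  filter_upwards [h b hb, (hρ b hb).ae_differentiableAt] with t h1 h2 h3 h4
  rw [h2.hasDerivAt.norm_sq.deriv]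
  have := h1 _ h2.hasDerivAt h3 h4
  linarith

/-- Error signals `e 0, …, e (r-1)` on an interval `S` with least element `a`, each of which is up
to a controlled perturbation the derivative of its predecessor, and which evolve in the funnel. -/
structure ErrorChain {m : ℕ} (α φ : ℝ → ℝ) (r : ℕ) (S : Set ℝ) (a : ℝ) (e : ℕ → ℝ → E m) :
    Prop where
  ord : S.OrdConnected
  mem : a ∈ S
  least : ∀ t ∈ S, a ≤ t
  funnel_lip : ∀ b ∈ S, LipOn φ (Icc a b)
  funnel_pos : ∃ c > 0, ∀ t ∈ S, c ≤ φ t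
  funnel_deriv : ∃ c, 0 ≤ c ∧ ∀ᵐ t ∂volume.restrict S, |deriv φ t| ≤ c * (1 + φ t)
  lip : ∀ k < r, ∀ b ∈ S, LipOn (e k) (Icc a b)
  deriv : ∀ k, k + 1 < r → ∃ B, ∀ b ∈ S, ∀ᵐ t ∂volume.restrict (Icc a b), ∀ e',
    HasDerivAt (e k) e' t → ‖φ t • (e' - e (k + 1) t)‖ ≤ B
  dom : ∀ t ∈ S, memD α (fun k => φ t • e k t) r

namespace ErrorChain

variable {m : ℕ} {α φ : ℝ → ℝ} {r : ℕ} {S : Set ℝ} {a : ℝ} {e : ℕ → ℝ → E m}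

theorem Icc_subset (h : ErrorChain α φ r S a e) {b : ℝ} (hb : b ∈ S) : Icc a b ⊆ S :=
  h.ord.out h.mem hb

theorem norm_rho_lt (h : ErrorChain α φ r S a e) {k : ℕ} (hk : k ≤ r) {t : ℝ} (ht : t ∈ S) :
    ‖rho α (fun j => φ t • e j t) k‖ < 1 := (h.dom t ht).norm_rho_lt hk

/-- If `ρ_k` is uniformly bounded away from the funnel boundary and Lipschitz, then the next error
signal is bounded and the derivative of `ρ_{k+1}` is, up to a bounded term, `φ e_k'`. -/
theorem bounds_of_rho (h : ErrorChain α φ r S a e) (hα : ContDiffOn ℝ 1 α (Ico 0 1)) {k : ℕ}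
    (hk : k < r) {ε : ℝ} (hε : ε < 1) (hρε : ∀ t ∈ S, ‖rho α (fun j => φ t • e j t) k‖ ≤ ε)
    (hρ : LipOn (fun t => rho α (fun j => φ t • e j t) k) S) :
    (∃ B, ∀ t ∈ S, ‖e k t‖ ≤ B) ∧
    (∀ b ∈ S, LipOn (fun t => rho α (fun j => φ t • e j t) (k + 1)) (Icc a b)) ∧
    ∃ C, ∀ b ∈ S, ∀ᵐ t ∂volume.restrict (Icc a b), ∀ ρ',
      HasDerivAt (fun t => rho α (fun j => φ t • e j t) (k + 1)) ρ' t →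
      ∃ e', HasDerivAt (e k) e' t ∧ ‖ρ' - φ t • e'‖ ≤ C := by
  obtain ⟨hgL, G, hG⟩ := gam_lipOn (m := m) hα hε
  set g : ℝ → E m := fun t => gam α (rho α (fun j => φ t • e j t) k) with hg_def
  have hmaps : MapsTo (fun t => rho α (fun j => φ t • e j t) k) S (Metric.closedBall 0 ε) :=
    fun t ht => by simpa using hρε t ht
  have hg : LipOn g S := hgL.comp hρ hmaps
  have hgG : ∀ t ∈ S, ‖g t‖ ≤ G := fun t ht => hG _ (hmaps ht)
  obtain ⟨φ₀, hφ₀, hφ⟩ := h.funnel_pos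
  obtain ⟨c, hc0, hc⟩ := h.funnel_deriv
  -- φ e_k = ρ_{k+1} - γ(ρ_k), where the first term has norm below 1 and the second at most G.
  have hφe : ∀ t ∈ S, φ t * ‖e k t‖ ≤ 1 + G := by
    intro t ht
    have h1 : φ t • e k t = rho α (fun j => φ t • e j t) (k + 1) - g t := by
      simp only [rho, hg_def, add_sub_cancel_right]
    have h2 := norm_sub_le (rho α (fun j => φ t • e j t) (k + 1)) (g t)
    rw [← h1, norm_smul, Real.norm_of_nonneg (hφ₀.le.trans (hφ t ht))] at h2
    linarith [(h.norm_rho_lt (k := k + 1) hk ht), hgG t ht]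
  have hG0 : 0 ≤ 1 + G := by
    have := hφe a h.mem
    exact (mul_nonneg (hφ₀.le.trans (hφ a h.mem)) (norm_nonneg _)).trans this
  have heB : ∀ t ∈ S, ‖e k t‖ ≤ (1 + G) / φ₀ := by
    intro t ht
    rw [le_div_iff₀ hφ₀, mul_comm]
    exact (mul_le_mul_of_nonneg_right (hφ t ht) (norm_nonneg _)).trans (hφe t ht)
  refine ⟨⟨_, heB⟩, ?_, ?_⟩
  · intro b hb
    obtain ⟨A, hA⟩ := isCompact_Icc.exists_bound_of_continuousOn (h.funnel_lip b hb).continuousOn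
    exact ((h.funnel_lip b hb).smul (h.lip k hk b hb) hA
      fun t ht => heB t (h.Icc_subset hb ht)).add (hg.mono (h.Icc_subset hb))
  · obtain ⟨K, hK0, hK⟩ := hg.exists_dist_le
    -- Besides φ e_k', the derivative of ρ_{k+1} contains φ' e_k and (γ(ρ_k))'. The first is at most
    -- c (‖e_k‖ + φ ‖e_k‖), and both summands are bounded even if φ is not; K bounds the second.
    refine ⟨c * ((1 + G) / φ₀ + (1 + G)) + K, fun b hb => ?_⟩
    have hsub := h.Icc_subset hb
    have hgd := (hg.mono hsub).ae_differentiableAt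
    have hmem : ∀ᵐ t ∂volume.restrict (Icc a b), t ∈ Ioo a b := by
      rw [ae_restrict_Icc_iff_Ioo]; exact ae_restrict_mem measurableSet_Ioo
    filter_upwards [hgd, (h.lip k hk b hb).ae_differentiableAt,
      (h.funnel_lip b hb).ae_differentiableAt, hmem,
      ae_restrict_of_ae_restrict_of_subset hsub hc] with t h1 h2 h3 h4 h5 ρ' hρ'
    refine ⟨_, h2.hasDerivAt, ?_⟩
    have h6 := (h3.hasDerivAt.smul h2.hasDerivAt).add h1.hasDerivAt
    have h7 := hρ'.unique h6
    have htS : t ∈ S := hsub (Ioo_subset_Icc_self h4)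
    have h8 : ρ' - φ t • _root_.deriv (e k) t =
        _root_.deriv φ t • e k t + _root_.deriv g t := by
      rw [h7]; abel
    rw [h8]
    refine (norm_add_le _ _).trans (add_le_add ?_ ?_)
    · rw [norm_smul, Real.norm_eq_abs]
      calc |_root_.deriv φ t| * ‖e k t‖ ≤ c * (1 + φ t) * ‖e k t‖ :=
            mul_le_mul_of_nonneg_right h5 (norm_nonneg _)
        _ = c * (‖e k t‖ + φ t * ‖e k t‖) := by ring
        _ ≤ _ := mul_le_mul_of_nonneg_left (add_le_add (heB t htS) (hφe t htS)) hc0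
    · exact norm_deriv_le_of_dist_le hK hK0 (mem_of_superset (Icc_mem_nhds h4.1 h4.2) hsub)

/-- The signals `ρ_k`, `k < r`, are uniformly bounded away from the funnel boundary. -/
theorem rho_bounded_away (h : ErrorChain α φ r S a e) (hα : ContDiffOn ℝ 1 α (Ico 0 1))
    (hb : BijOn α (Ico 0 1) (Ici 1)) : ∀ k < r,
    (∃ ε < 1, ∀ t ∈ S, ‖rho α (fun j => φ t • e j t) k‖ ≤ ε) ∧
    LipOn (fun t => rho α (fun j => φ t • e j t) k) S := by
  intro k
  induction k with
  | zero =>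
    intro _
    exact ⟨⟨0, one_pos, fun t _ => by simp [rho]⟩, LipOn.of_dist_le (C := 0) (by simp [rho])⟩
  | succ k ih =>
    intro hk
    obtain ⟨⟨ε, hε, hρε⟩, hρL⟩ := ih (by omega)
    obtain ⟨-, hLip, C, hC⟩ := h.bounds_of_rho hα (by omega) hε hρε hρL
    obtain ⟨B, hB⟩ := h.deriv k hk
    set ρ : ℝ → E m := fun t => rho α (fun j => φ t • e j t) (k + 1) with hρ_def
    -- C bounds ρ' - φ e_k', B bounds the deviation of φ e_k' from φ e_{k+1}, and 1 bounds ρ_{k+2},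
    -- which equals φ e_{k+1} + γ(ρ).
    set C' := C + B + 1 with hC'
    have hder : ∀ b ∈ S, ∀ᵐ t ∂volume.restrict (Icc a b), ∀ ρ', HasDerivAt ρ ρ' t →
        ‖ρ' + gam α (ρ t)‖ ≤ C' := by
      intro b hb'
      filter_upwards [hC b hb', hB b hb', ae_restrict_mem measurableSet_Icc] with t h1 h2 h3 ρ' hρ'
      obtain ⟨e', he', h4⟩ := h1 ρ' hρ'
      have h5 := h2 e' he'
      have h6 := h.norm_rho_lt (k := k + 2) hk (h.Icc_subset hb' h3)
      have h7 : ρ' + gam α (ρ t) = (ρ' - φ t • e') + φ t • (e' - e (k + 1) t) +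
          rho α (fun j => φ t • e j t) (k + 2) := by
        simp only [hρ_def, rho, smul_sub]; abel
      rw [h7]
      exact (norm_add₃_le).trans (by linarith)
    have hρa : ‖ρ a‖ < 1 := h.norm_rho_lt (by omega) h.mem
    -- Above the level L one has ‖ρ‖ ≥ 1/2 and α(‖ρ‖²) > 2 C', so the damping α ‖ρ‖² outweighs the
    -- perturbation C' ‖ρ‖.
    set s₀ : ℝ := max (‖ρ a‖ ^ 2) (1 / 4) with hs₀
    have hs₀I : s₀ ∈ Ico (0 : ℝ) 1 :=
      ⟨(sq_nonneg _).trans (le_max_left _ _),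
        max_lt (by nlinarith [norm_nonneg (ρ a)]) (by norm_num)⟩
    obtain ⟨L, hL, hLα⟩ := exists_gain_eq hα hb hs₀I
      (a := max (α s₀) (2 * C') + 1) (by linarith [le_max_left (α s₀) (2 * C')])
    have hLI : L ∈ Ico (0 : ℝ) 1 := ⟨hs₀I.1.trans hL.1.le, hL.2⟩
    have hbound : ∀ t ∈ S, ‖ρ t‖ ^ 2 ≤ L := by
      refine norm_sq_le_of_inner_deriv_nonpos h.least hLip one_pos
        ((le_max_left _ _).trans hL.1.le) fun b hb' => ?_
      filter_upwards [hder b hb', ae_restrict_mem measurableSet_Icc] with t h1 h2 ρ' hρ' h3 _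
      have h4 := h1 ρ' hρ'
      have h5 : ‖ρ t‖ < 1 := h.norm_rho_lt (k := k + 1) (by omega) (h.Icc_subset hb' h2)
      have h6 : 2 * C' < α (‖ρ t‖ ^ 2) := by
        have := gain_strictMonoOn hα hb hLI ⟨sq_nonneg _, by nlinarith [norm_nonneg (ρ t)]⟩ h3
        linarith [le_max_right (α s₀) (2 * C')]
      have h7 : 1 / 2 ≤ ‖ρ t‖ := by
        have : (1 / 4 : ℝ) ≤ s₀ := le_max_right _ _
        nlinarith [norm_nonneg (ρ t), hL.1]
      have h8 : inner ℝ (ρ t) ρ' = inner ℝ (ρ t) (ρ' + gam α (ρ t)) -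
          α (‖ρ t‖ ^ 2) * ‖ρ t‖ ^ 2 := by
        rw [inner_add_right, gam, inner_smul_right, real_inner_self_eq_norm_sq]; ring
      have h9 : inner ℝ (ρ t) (ρ' + gam α (ρ t)) ≤ ‖ρ t‖ * C' :=
        (real_inner_le_norm _ _).trans (mul_le_mul_of_nonneg_left h4 (norm_nonneg _))
      have h10 : 0 ≤ C' := (norm_nonneg _).trans h4
      rw [h8]
      have h11 : C' ≤ α (‖ρ t‖ ^ 2) * ‖ρ t‖ := by nlinarith
      nlinarith [norm_nonneg (ρ t)]
    have hε' : √L < 1 := by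
      rw [Real.sqrt_lt' one_pos]; simpa using hL.2
    have hbound' : ∀ t ∈ S, ‖ρ t‖ ≤ √L := fun t ht => Real.le_sqrt_of_sq_le (hbound t ht)
    refine ⟨⟨√L, hε', hbound'⟩, ?_⟩
    obtain ⟨-, G, hG⟩ := gam_lipOn (m := m) hα hε'
    -- The constant does not depend on b, so the Lipschitz property holds on all of S, as the next
    -- induction step requires.
    have hLS : ∀ b ∈ S, ∀ s ∈ Icc a b, ∀ t ∈ Icc a b, dist (ρ s) (ρ t) ≤ (C' + G) * dist s t := by
      intro b hb'
      refine dist_le_of_ae_deriv_le (g' := _root_.deriv ρ) (h.least b hb')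
        ((hLip b hb').ac (h.least b hb')) ?_
      filter_upwards [hder b hb', (hLip b hb').ae_differentiableAt,
        ae_restrict_mem measurableSet_Icc] with t h1 h2 h3
      refine ⟨h2.hasDerivAt, ?_⟩
      have h4 := h1 _ h2.hasDerivAt
      have h5 := hG (ρ t) (by simpa using hbound' t (h.Icc_subset hb' h3))
      calc ‖_root_.deriv ρ t‖ = ‖(_root_.deriv ρ t + gam α (ρ t)) - gam α (ρ t)‖ := by
            rw [add_sub_cancel_right]
        _ ≤ _ := (norm_sub_le _ _).trans (add_le_add h4 h5)
    refine LipOn.of_dist_le (C := C' + G) fun s hs t ht => ?_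
    have hmax : max s t ∈ S := by rcases max_choice s t with h' | h' <;> rw [h'] <;> assumption
    exact hLS _ hmax s ⟨h.least s hs, le_max_left _ _⟩ t ⟨h.least t ht, le_max_right _ _⟩

theorem bounded (h : ErrorChain α φ r S a e) (hα : ContDiffOn ℝ 1 α (Ico 0 1))
    (hb : BijOn α (Ico 0 1) (Ici 1)) {k : ℕ} (hk : k < r) : ∃ B, ∀ t ∈ S, ‖e k t‖ ≤ B := by
  obtain ⟨⟨ε, hε, hρε⟩, hρL⟩ := h.rho_bounded_away hα hb k hk
  exact (h.bounds_of_rho hα hk hε hρε hρL).1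

/-- The last signal `ρ_r` is bounded away from the funnel boundary, if the derivative of the last
error signal is given by a system with the high-gain property. -/
theorem rho_last_bounded_away {p q : ℕ} {f : E p → E q → E m → E m} {N : ℝ → ℝ}
    (h : ErrorChain α φ r S a e) (hr : 1 ≤ r) (hα : ContDiffOn ℝ 1 α (Ico 0 1))
    (hb : BijOn α (Ico 0 1) (Ici 1))
    (hf : Continuous (fun x : E p × E q × E m => f x.1 x.2.1 x.2.2))
    (hN : ContinuousOn N (Ici 0)) {S' : Set ℝ} (hS' : SurjOn N (Ici 0) S')
    (hgain : HighGainOn S' f) {D Z R : ℝ} (hD : 0 ≤ D) (hZ : 0 ≤ Z)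
    (heq : ∀ b ∈ S, ∀ᵐ t ∂volume.restrict (Icc a b), ∀ e', HasDerivAt (e (r - 1)) e' t →
      ∃ d z, ‖d‖ ≤ D ∧ ‖z‖ ≤ Z ∧
        ‖e' - f d z (N (α (‖rho α (fun j => φ t • e j t) r‖ ^ 2)) •
          rho α (fun j => φ t • e j t) r)‖ ≤ R) :
    ∃ ε < 1, ∀ t ∈ S, ‖rho α (fun j => φ t • e j t) r‖ ≤ ε := by
  obtain ⟨k, rfl⟩ : ∃ k, r = k + 1 := ⟨r - 1, by omega⟩
  obtain ⟨⟨ε, hε, hρε⟩, hρL⟩ := h.rho_bounded_away hα hb k (by omega)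
  obtain ⟨-, hLip, C, hC⟩ := h.bounds_of_rho hα (by omega) hε hρε hρL
  set ρ : ℝ → E m := fun t => rho α (fun j => φ t • e j t) (k + 1) with hρ_def
  obtain ⟨φ₀, hφ₀, hφ⟩ := h.funnel_pos
  have hρa : ‖ρ a‖ < 1 := h.norm_rho_lt le_rfl h.mem
  -- In ρ' the vector field carries the factor φ ≥ φ₀, so dissipation of strength |C| / φ₀ absorbs
  -- the term bounded by C. The part |R| absorbs the deviation of e_{r-1}' from the field.
  obtain ⟨L, hL, δ, hδ, hlayer⟩ := exists_dissipative_layer hf hα hb hN hS' hgain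
    (isCompact_closedBall 0 D) (isCompact_closedBall 0 Z) ⟨0, by simpa using hD⟩
    ⟨0, by simpa using hZ⟩ (s₀ := ‖ρ a‖ ^ 2) ⟨sq_nonneg _, by nlinarith [norm_nonneg (ρ a)]⟩
    (|C| / φ₀ + |R|)
  have hbound : ∀ t ∈ S, ‖ρ t‖ ^ 2 ≤ L := by
    refine norm_sq_le_of_inner_deriv_nonpos h.least hLip hδ hL.1.le fun b hb' => ?_
    filter_upwards [heq b hb', hC b hb', ae_restrict_mem measurableSet_Icc]
      with t h1 h2 h3 ρ' hρ' h4 h5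
    have htS := h.Icc_subset hb' h3
    obtain ⟨e', he', h6⟩ := h2 ρ' hρ'
    obtain ⟨d, z, hd, hz, h7⟩ := h1 e' he'
    have h8 : ‖ρ t‖ < 1 := h.norm_rho_lt le_rfl htS
    have h9 := hlayer (ρ t) h4 h5 h8 d (by simpa using hd) z (by simpa using hz)
    set u := f d z (N (α (‖ρ t‖ ^ 2)) • ρ t)
    have hφt : φ₀ ≤ φ t := hφ t htS
    have h10 : inner ℝ (ρ t) ρ' = inner ℝ (ρ t) (ρ' - φ t • e') + φ t * inner ℝ (ρ t) (e' - u) +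
        φ t * inner ℝ (ρ t) u := by
      simp only [inner_sub_right, inner_smul_right]; ring
    have h11 : inner ℝ (ρ t) (ρ' - φ t • e') ≤ |C| :=
      (real_inner_le_norm _ _).trans <|
        (mul_le_mul h8.le (h6.trans (le_abs_self _)) (norm_nonneg _) zero_le_one).trans
          (one_mul _).le
    have h12 : inner ℝ (ρ t) (e' - u) ≤ |R| :=
      (real_inner_le_norm _ _).trans <|
        (mul_le_mul h8.le (h7.trans (le_abs_self _)) (norm_nonneg _) zero_le_one).trans
          (one_mul _).le
    have h13 : |C| ≤ φ t * (|C| / φ₀) := by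
      rw [mul_div_assoc', le_div_iff₀ hφ₀, mul_comm]
      exact mul_le_mul_of_nonneg_right hφt (abs_nonneg _)
    rw [h10]
    have h14 : φ t * (inner ℝ (ρ t) (e' - u) + inner ℝ (ρ t) u) ≤ φ t * -(|C| / φ₀) :=
      mul_le_mul_of_nonneg_left (by linarith) (hφ₀.le.trans hφt)
    nlinarith
  refine ⟨√L, ?_, fun t ht => Real.le_sqrt_of_sq_le (hbound t ht)⟩
  rw [Real.sqrt_lt' one_pos]; simpa using hL.2

end ErrorChain

end FunnelControl

namespace FunnelControl

/-! ### The closed loop on the level of the state -/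

/-- The data of the closed loop. -/
structure ClosedLoop (m r p q : ℕ) where
  rhat : ℕ
  h : ℝ
  d : ℝ → E p
  f : E p → E q → E m → E m
  T : (ℝ → Blocks r m) → ℝ → E q
  φ : ℝ → ℝ
  N : ℝ → ℝ
  α : ℝ → ℝ
  yref : ℝ → E m
  y0 : ℕ → ℝ → E m

/-- The state with components `x 0, …, x (r-1)`. -/
def blocks {m : ℕ} (r : ℕ) (x : ℕ → ℝ → E m) (t : ℝ) : Blocks r m :=
  WithLp.toLp 2 (fun k : Fin r => x k t)

namespace ClosedLoop

variable {m r p q : ℕ}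

/-- The entries of `𝐞(t)`, in terms of the state. -/
noncomputable def signal (L : ClosedLoop m r p q) (x : ℕ → ℝ → E m) (k : ℕ) (t : ℝ) : E m :=
  if k < L.rhat then x k t - refDer L.yref k t else x k t

/-- `ρ_k(φ(t) 𝐞(t))`, in terms of the state. -/
noncomputable def rhoSig (L : ClosedLoop m r p q) (x : ℕ → ℝ → E m) (k : ℕ) (t : ℝ) : E m :=
  rho L.α (fun j => L.φ t • L.signal x j t) k

/-- The input, in terms of the state. -/
noncomputable def control (L : ClosedLoop m r p q) (x : ℕ → ℝ → E m) (t : ℝ) : E m :=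
  L.N (L.α (‖L.rhoSig x r t‖ ^ 2)) • L.rhoSig x r t

/-- The differential equation on `[0, τ]`, with the operator applied to `ζ`. -/
def StateEq (L : ClosedLoop m r p q) (ζ : ℝ → Blocks r m) (x : ℕ → ℝ → E m) (τ : ℝ) : Prop :=
  ∀ᵐ t ∂volume.restrict (Icc 0 τ),
    HasDerivAt (x (r - 1)) (L.f (L.d t) (L.T ζ t) (L.control x t)) t

/-- The assumptions on the data of the closed loop. -/
structure Admissible (L : ClosedLoop m r p q) : Prop where
  order_pos : 1 ≤ r
  memory : 0 ≤ L.h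
  disturbance : MemLp L.d ⊤ (volume.restrict (Ici 0))
  field : Continuous (fun x : E p × E q × E m => L.f x.1 x.2.1 x.2.2)
  operator : IsOperatorClass L.h L.T
  gain : ContinuousOn L.N (Ici 0) ∧ ∃ S, SurjOn L.N (Ici 0) S ∧ HighGainOn S L.f
  initialData : IsInitialData r L.h L.y0
  ref : IsSmoothChain r (Ici 0) (refDer L.yref)
  rhat_pos : 1 ≤ L.rhat
  rhat_le : L.rhat ≤ r
  funnel : IsFunnelFunction L.φ
  funnel_bdd : L.rhat < r → BddAbove (L.φ '' Ici 0)
  bij : BijOn L.α (Ico 0 1) (Ici 1)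
  smooth : ContDiffOn ℝ 1 L.α (Ico 0 1)
  init : memD L.α (fun k => L.φ 0 • initInfo L.rhat L.yref L.y0 k) r

/-- `x 0, …, x (r-1)` are the derivatives of a solution on the interval `J`. -/
structure StateSol (L : ClosedLoop m r p q) (J : Set ℝ) (x : ℕ → ℝ → E m) : Prop where
  cont : ∀ k < r, ContinuousOn (x k) J
  hasDeriv : ∀ k, k + 1 < r → ∀ t ∈ J, HasDerivWithinAt (x k) (x (k + 1) t) J t
  initial : ∀ k < r, EqOn (x k) (L.y0 k) (Icc (-L.h) 0)
  lip : ∀ τ ∈ J, 0 ≤ τ → LipOn (x (r - 1)) (Icc 0 τ)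
  mem_domain : ∀ t ∈ J, 0 ≤ t → memD L.α (fun k => L.φ t • L.signal x k t) r
  equation : ∀ τ ∈ J, 0 ≤ τ → ∀ ζ : ℝ → Blocks r m, ContinuousOn ζ (Ici (-L.h)) →
    EqOn ζ (blocks r x) (Icc (-L.h) τ) → L.StateEq ζ x τ

/-- `y` is a solution of the closed loop on `[-h, ω)`. -/
abbrev IsSol (L : ClosedLoop m r p q) (ω : EReal) (y : ℝ → E m) : Prop :=
  IsSolution r L.rhat L.h L.d L.f L.T L.φ L.N L.α L.yref L.y0 ω y

end ClosedLoop

/-! ### Domains, and the passage between solutions and state trajectories -/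

theorem mem_dom {h : ℝ} {ω : EReal} {t : ℝ} : t ∈ dom h ω ↔ -h ≤ t ∧ (t : EReal) < ω := Iff.rfl

theorem convex_dom (h : ℝ) (ω : EReal) : Convex ℝ (dom h ω) := by
  rw [convex_iff_ordConnected]
  refine ⟨fun s hs t ht u hu => ⟨hs.1.trans hu.1, lt_of_le_of_lt ?_ ht.2⟩⟩
  exact_mod_cast hu.2

theorem dom_mem_nhds {h : ℝ} {ω : EReal} {t : ℝ} (h1 : -h < t) (h2 : (t : EReal) < ω) :
    dom h ω ∈ 𝓝 t := by
  have : IsOpen {s : ℝ | (s : EReal) < ω} :=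
    isOpen_lt continuous_coe_real_ereal continuous_const
  filter_upwards [Ioi_mem_nhds h1, this.mem_nhds h2] with s h3 h4
  exact ⟨h3.le, h4⟩

theorem Icc_subset_dom {h τ : ℝ} {ω : EReal} (hτ : (τ : EReal) < ω) : Icc (-h) τ ⊆ dom h ω :=
  fun _ ht => ⟨ht.1, lt_of_le_of_lt (by exact_mod_cast ht.2) hτ⟩

theorem Icc_zero_subset_dom {h τ : ℝ} {ω : EReal} (hh : 0 ≤ h) (hτ : (τ : EReal) < ω) :
    Icc 0 τ ⊆ dom h ω :=
  (Icc_subset_Icc_left (by linarith)).trans (Icc_subset_dom hτ)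

theorem exists_pos_coe_lt {ω : EReal} (hω : 0 < ω) : ∃ t : ℝ, 0 < t ∧ (t : EReal) < ω := by
  obtain ⟨t, h1, h2⟩ := EReal.lt_iff_exists_real_btwn.1 hω
  exact ⟨t, by exact_mod_cast h1, h2⟩

theorem uniqueDiffOn_dom {h : ℝ} {ω : EReal} (hh : 0 ≤ h) (hω : 0 < ω) :
    UniqueDiffOn ℝ (dom h ω) := by
  obtain ⟨t, h1, h2⟩ := exists_pos_coe_lt hω
  refine uniqueDiffOn_convex (convex_dom h ω) ⟨t, ?_⟩
  rw [mem_interior_iff_mem_nhds]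
  exact dom_mem_nhds (by linarith) h2

theorem blocks_continuousOn {m r : ℕ} {x : ℕ → ℝ → E m} {J : Set ℝ}
    (hx : ∀ k < r, ContinuousOn (x k) J) : ContinuousOn (blocks r x) J := by
  refine (PiLp.continuous_toLp 2 _).comp_continuousOn ?_
  exact continuousOn_pi.2 fun k => hx k k.2

theorem blocks_min_continuousOn {m r : ℕ} {x : ℕ → ℝ → E m} {h τ : ℝ} (hτ : -h ≤ τ)
    (hx : ∀ k < r, ContinuousOn (x k) (Icc (-h) τ)) :
    ContinuousOn (fun s => blocks r x (min s τ)) (Ici (-h)) := by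
  refine (blocks_continuousOn hx).comp (by fun_prop) fun s hs => ?_
  exact ⟨le_min hs hτ, min_le_right _ _⟩

theorem blocks_min_eqOn {m r : ℕ} {x : ℕ → ℝ → E m} {h τ : ℝ} :
    EqOn (fun s => blocks r x (min s τ)) (blocks r x) (Icc (-h) τ) := fun s hs => by
  simp only [min_eq_left hs.2]

theorem blocks_eq {m r : ℕ} {x x' : ℕ → ℝ → E m} {t : ℝ} (h : ∀ k < r, x k t = x' k t) :
    blocks r x t = blocks r x' t := by
  simp only [blocks]
  congr 1
  funext k
  exact h k k.2

theorem rho_congr {m : ℕ} {α : ℝ → ℝ} {η η' : ℕ → E m} {k : ℕ} (h : ∀ j < k, η j = η' j) :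
    rho α η k = rho α η' k := by
  induction k with
  | zero => rfl
  | succ k ih => simp only [rho]; rw [h k (by omega), ih fun j hj => h j (by omega)]

theorem memD_congr {m : ℕ} {α : ℝ → ℝ} {η η' : ℕ → E m} {k : ℕ} (h : ∀ j < k, η j = η' j)
    (hm : memD α η k) : memD α η' k :=
  memD_of_norm_rho_lt fun l hl => by
    rw [← rho_congr fun j hj => h j (by omega)]
    exact hm.norm_rho_lt hl

namespace ClosedLoop

variable {m r p q : ℕ} {L : ClosedLoop m r p q}

theorem signal_congr {x x' : ℕ → ℝ → E m} {k : ℕ} {t : ℝ} (h : x k t = x' k t) :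
    L.signal x k t = L.signal x' k t := by
  simp only [signal, h]

theorem rhoSig_congr {x x' : ℕ → ℝ → E m} {k : ℕ} {t : ℝ} (h : ∀ j < k, x j t = x' j t) :
    L.rhoSig x k t = L.rhoSig x' k t :=
  rho_congr fun j hj => by rw [signal_congr (h j hj)]

theorem control_congr {x x' : ℕ → ℝ → E m} {t : ℝ} (h : ∀ k < r, x k t = x' k t) :
    L.control x t = L.control x' t := by
  simp only [control, rhoSig_congr h]

/-- Causality permits changing the operator's argument after τ'. The derivative depends only on
values near t, so interior points suffice. -/
theorem StateEq.congr (hT : IsOperatorClass L.h L.T) (hr : 1 ≤ r) {ζ ζ' : ℝ → Blocks r m}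
    {x x' : ℕ → ℝ → E m} {τ τ' : ℝ} (h : L.StateEq ζ x τ) (hτ0 : 0 ≤ τ') (hτ : τ' ≤ τ)
    (hx : ∀ k < r, EqOn (x k) (x' k) (Icc 0 τ')) (hζ : EqOn ζ ζ' (Icc (-L.h) τ'))
    (hc : ContinuousOn ζ (Ici (-L.h))) (hc' : ContinuousOn ζ' (Ici (-L.h))) :
    L.StateEq ζ' x' τ' := by
  have h1 := ae_restrict_of_ae_restrict_of_subset (Icc_subset_Icc_right hτ) h
  have h2 := hT.causal ζ ζ' hc hc' τ' hτ0 hζ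
  unfold StateEq
  rw [ae_restrict_Icc_iff_Ioo] at h1 h2 ⊢
  filter_upwards [h1, h2, ae_restrict_mem measurableSet_Ioo] with t h3 h4 h5
  rw [h4, control_congr fun k hk => hx k hk (Ioo_subset_Icc_self h5)] at h3
  refine h3.congr_of_eventuallyEq ?_
  filter_upwards [Icc_mem_nhds h5.1 h5.2] with s hs
  exact (hx (r - 1) (by omega) hs).symm

theorem Admissible.funnel_continuousOn (hL : L.Admissible) : ContinuousOn L.φ (Ici 0) := by
  intro t ht
  have h0 : (0 : ℝ) ≤ t := ht
  have h1 := (hL.funnel.locally_ac (t + 1) (by linarith)).continuousOn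
  rw [uIcc_of_le (by linarith)] at h1
  refine (h1 t ⟨h0, by linarith⟩).mono_of_mem_nhdsWithin ?_
  filter_upwards [self_mem_nhdsWithin, mem_nhdsWithin_of_mem_nhds (Iio_mem_nhds (lt_add_one t))]
    with s h2 h3 using ⟨h2, h3.le⟩

theorem Admissible.signal_continuousOn (hL : L.Admissible) {x : ℕ → ℝ → E m} {J : Set ℝ} {k : ℕ}
    (hk : k < r) (hx : ContinuousOn (x k) J) (hJ : J ⊆ Ici 0) :
    ContinuousOn (L.signal x k) J := by
  unfold signal
  by_cases h : k < L.rhat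
  · simp only [h, if_true]
    exact hx.sub ((hL.ref.lip k hk).continuousOn.mono hJ)
  · simpa only [h, if_false] using hx

/-- The bound on ρ_k may use the continuity of ρ_k already obtained. This matters at the right end
of a closed interval, where membership in the ball is itself deduced by continuity. -/
theorem Admissible.rhoSig_continuousOn_of_norm_lt (hL : L.Admissible) {x : ℕ → ℝ → E m}
    {J : Set ℝ} (hx : ∀ k < r, ContinuousOn (x k) J) (hJ : J ⊆ Ici 0)
    (hd : ∀ k < r, ContinuousOn (L.rhoSig x k) J → ∀ t ∈ J, ‖L.rhoSig x k t‖ < 1) :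
    ∀ k ≤ r, ContinuousOn (L.rhoSig x k) J := by
  intro k
  induction k with
  | zero => intro _; exact continuousOn_const
  | succ k ih =>
    intro hk
    have h1 := ih (by omega)
    have h2 : ContinuousOn (fun t => L.α (‖L.rhoSig x k t‖ ^ 2)) J :=
      hL.smooth.continuousOn.comp (h1.norm.pow 2) fun t ht =>
        ⟨sq_nonneg _, by
          have := hd k hk h1 t ht
          have := norm_nonneg (L.rhoSig x k t)
          nlinarith⟩
    exact ((hL.funnel_continuousOn.mono hJ).smul (hL.signal_continuousOn hk (hx k hk) hJ)).add
      (h2.smul h1)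

theorem Admissible.rhoSig_continuousOn (hL : L.Admissible) {x : ℕ → ℝ → E m} {J : Set ℝ}
    (hx : ∀ k < r, ContinuousOn (x k) J) (hJ : J ⊆ Ici 0)
    (hd : ∀ t ∈ J, memD L.α (fun k => L.φ t • L.signal x k t) r) :
    ∀ k ≤ r, ContinuousOn (L.rhoSig x k) J :=
  hL.rhoSig_continuousOn_of_norm_lt hx hJ fun _ hk _ t ht => (hd t ht).norm_rho_lt hk.le

theorem Admissible.control_continuousOn (hL : L.Admissible) {x : ℕ → ℝ → E m} {J : Set ℝ}
    (hx : ∀ k < r, ContinuousOn (x k) J) (hJ : J ⊆ Ici 0)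
    (hd : ∀ t ∈ J, memD L.α (fun k => L.φ t • L.signal x k t) r) :
    ContinuousOn (L.control x) J := by
  have h1 := hL.rhoSig_continuousOn hx hJ hd r le_rfl
  have hmaps : MapsTo (fun t => ‖L.rhoSig x r t‖ ^ 2) J (Ico 0 1) := fun t ht =>
    ⟨sq_nonneg _, by
      have : ‖L.rhoSig x r t‖ < 1 := (hd t ht).norm_rho_lt le_rfl
      have := norm_nonneg (L.rhoSig x r t)
      nlinarith⟩
  have h2 : ContinuousOn (fun t => L.α (‖L.rhoSig x r t‖ ^ 2)) J :=
    hL.smooth.continuousOn.comp (h1.norm.pow 2) hmaps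
  exact (hL.gain.1.comp h2 fun t ht => zero_le_one.trans (one_le_gain hL.bij (hmaps ht))).smul h1

theorem Admissible.exists_disturbance_bound (hL : L.Admissible) :
    ∃ D, 0 ≤ D ∧ ∀ᵐ t ∂volume.restrict (Ici 0), ‖L.d t‖ ≤ D :=
  exists_ae_bound hL.disturbance

/-- The right-hand side of the differential equation is bounded if the operator and the input
are. -/
theorem Admissible.exists_field_bound (hL : L.Admissible) (Z U : ℝ) :
    ∃ C, 0 ≤ C ∧ ∀ᵐ t ∂volume.restrict (Ici 0), ∀ z u, ‖z‖ ≤ Z → ‖u‖ ≤ U →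
      ‖L.f (L.d t) z u‖ ≤ C := by
  obtain ⟨D, -, hD⟩ := hL.exists_disturbance_bound
  obtain ⟨C, hC⟩ := ((isCompact_closedBall (0 : E p) D).prod
    ((isCompact_closedBall (0 : E q) Z).prod
      (isCompact_closedBall (0 : E m) U))).exists_bound_of_continuousOn hL.field.continuousOn
  refine ⟨max C 0, le_max_right _ _, ?_⟩
  filter_upwards [hD] with t ht z u hz hu
  exact (hC (L.d t, z, u) ⟨by simpa using ht, by simpa using hz, by simpa using hu⟩).trans
    (le_max_left _ _)

/-- The right-hand side is essentially bounded on a compact interval, so the absolute continuity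
required of a solution improves to a Lipschitz property. -/
theorem StateEq.lipOn (hL : L.Admissible) {ζ : ℝ → Blocks r m} {x : ℕ → ℝ → E m} {τ : ℝ}
    (hτ : 0 ≤ τ) (h : L.StateEq ζ x τ) (hζ : ContinuousOn ζ (Ici (-L.h)))
    (hu : ContinuousOn (L.control x) (Icc 0 τ))
    (hac : AbsolutelyContinuousOnInterval (x (r - 1)) 0 τ) : LipOn (x (r - 1)) (Icc 0 τ) := by
  obtain ⟨U, hU⟩ := isCompact_Icc.exists_bound_of_continuousOn hu
  obtain ⟨Z, -, hZ⟩ := exists_ae_bound (hL.operator.memLp_loc ζ hζ τ hτ)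
  obtain ⟨C, -, hC⟩ := hL.exists_field_bound Z U
  refine LipOn.of_dist_le (C := C)
    (dist_le_of_ae_deriv_le (g' := fun t => L.f (L.d t) (L.T ζ t) (L.control x t)) hτ hac ?_)
  filter_upwards [h, hZ, ae_restrict_of_ae_restrict_of_subset Icc_subset_Ici_self hC,
    ae_restrict_mem measurableSet_Icc] with t h1 h2 h3 h4
  exact ⟨h1, h3 _ _ h2 (hU t h4)⟩

theorem IsSol.stateSol (hL : L.Admissible) {ω : EReal} {y : ℝ → E m} (hy : L.IsSol ω y) :
    L.StateSol (dom L.h ω) (yDer L.h ω y) := by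
  have hr := hL.order_pos
  have hud := uniqueDiffOn_dom hL.memory hy.pos
  have hcd := (contDiffOn_nat_iff_continuousOn_differentiableOn_deriv hud).1 hy.contDiffOn
  have hcont : ∀ k < r, ContinuousOn (yDer L.h ω y k) (dom L.h ω) := fun k hk =>
    hcd.1 k (by omega)
  have hctrl : ∀ τ ∈ dom L.h ω, ContinuousOn (L.control (yDer L.h ω y)) (Icc 0 τ) := by
    intro τ hτ
    have hsub := Icc_zero_subset_dom hL.memory hτ.2
    refine hL.control_continuousOn (fun k hk => (hcont k hk).mono hsub)
      Icc_subset_Ici_self fun t ht => ?_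
    exact hy.mem_domain t ht.1 (hsub ht).2
  have heq : ∀ τ ∈ dom L.h ω, 0 ≤ τ →
      L.StateEq (fun s => blocks r (yDer L.h ω y) (min s τ)) (yDer L.h ω y) τ := fun τ hτ h0 =>
    hy.equation τ h0 hτ.2
  have hbc : ∀ τ ∈ dom L.h ω, ContinuousOn (fun s => blocks r (yDer L.h ω y) (min s τ))
      (Ici (-L.h)) := fun τ hτ => blocks_min_continuousOn hτ.1 fun k hk =>
        (hcont k hk).mono (Icc_subset_dom hτ.2)
  refine ⟨hcont, fun k hk t ht => ?_, hy.initial, fun τ hτ h0 => ?_, fun t ht h0 => ?_,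
    fun τ hτ h0 ζ hζ hζx => ?_⟩
  · have h1 := (hcd.2 k (by omega) t ht).hasDerivWithinAt
    rwa [← iteratedDerivWithin_succ] at h1
  · exact (heq τ hτ h0).lipOn hL h0 (hbc τ hτ) (hctrl τ hτ) (hy.locally_ac τ h0 hτ.2)
  · exact hy.mem_domain t h0 ht.2
  · exact (heq τ hτ h0).congr hL.operator hr h0 le_rfl (fun k _ => eqOn_refl _ _)
      (blocks_min_eqOn.trans hζx.symm) (hbc τ hτ) hζ

/-- The components of x are the iterated derivatives of y within the domain, so values of y
elsewhere are irrelevant. -/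
theorem StateSol.isSol (hL : L.Admissible) {ω : EReal} (hω : 0 < ω) {x : ℕ → ℝ → E m}
    (hx : L.StateSol (dom L.h ω) x) {y : ℝ → E m} (hy : EqOn y (x 0) (dom L.h ω)) :
    L.IsSol ω y := by
  have hr := hL.order_pos
  have hud := uniqueDiffOn_dom hL.memory hω
  have hder : ∀ k < r, EqOn (yDer L.h ω y k) (x k) (dom L.h ω) :=
    iteratedDerivWithin_eq_of_hasDerivWithinAt hud hx.hasDeriv hy
  have h0ω : Icc (-L.h) 0 ⊆ dom L.h ω := Icc_subset_dom (by exact_mod_cast hω)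
  have hmem : ∀ t : ℝ, 0 ≤ t → (t : EReal) < ω → t ∈ dom L.h ω := fun t h0 h1 =>
    ⟨by linarith [hL.memory], h1⟩
  refine ⟨hω, contDiffOn_of_hasDerivWithinAt hud hx.hasDeriv hx.cont hr hy,
    fun k hk t ht => ?_, fun τ h0 hτ => ?_, fun t h0 ht => ?_, fun τ h0 hτ => ?_⟩
  · rw [hder k hk (h0ω ht), hx.initial k hk ht]
  · exact ((hx.lip τ (hmem τ h0 hτ) h0).congr
      ((hder (r - 1) (by omega)).mono (Icc_zero_subset_dom hL.memory hτ))).ac h0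
  · refine memD_congr (fun j hj => ?_) (hx.mem_domain t (hmem t h0 ht) h0)
    change _ = L.φ t • L.signal (yDer L.h ω y) j t
    rw [signal_congr (hder j hj (hmem t h0 ht))]
  · have hsub : Icc (-L.h) τ ⊆ dom L.h ω := Icc_subset_dom hτ
    have hc : ∀ k < r, ContinuousOn (yDer L.h ω y k) (Icc (-L.h) τ) := fun k hk =>
      ((hx.cont k hk).congr (hder k hk)).mono hsub
    have hζ := blocks_min_continuousOn (by linarith [hL.memory]) hc
    have h1 := hx.equation τ (hmem τ h0 hτ) h0 _ hζ
      (blocks_min_eqOn.trans fun t ht => blocks_eq fun k hk => hder k hk (hsub ht))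
    exact h1.congr hL.operator hr h0 le_rfl (fun k hk => ((hder k hk).mono
      (Icc_zero_subset_dom hL.memory hτ)).symm) (eqOn_refl _ _) hζ hζ

end ClosedLoop

end FunnelControl

namespace FunnelControl

/-! ### Local existence -/

/-- ρ_k evaluates the gain only at the earlier ρ_j, so no condition on ρ_k itself is needed; this
makes an induction on k possible. -/
theorem rho_eq_of_gain_eq {m : ℕ} {α β : ℝ → ℝ} {c : ℝ} (h : ∀ s ∈ Icc 0 c, α s = β s)
    {η : ℕ → E m} {k : ℕ} (hη : ∀ j < k, ‖rho α η j‖ ^ 2 ≤ c) : rho α η k = rho β η k := by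
  induction k with
  | zero => rfl
  | succ k ih =>
    have h1 := ih fun j hj => hη j (by omega)
    simp only [rho, gam]
    rw [h _ ⟨sq_nonneg _, hη k (by omega)⟩, h1]

/-- The `k`-th block of a state vector. -/
noncomputable def coord {r m : ℕ} (v : Blocks r m) (k : ℕ) : E m :=
  if hk : k < r then v ⟨k, hk⟩ else 0

theorem continuous_coord {r m : ℕ} (k : ℕ) : Continuous fun v : Blocks r m => coord v k := by
  unfold coord
  by_cases hk : k < r
  · simp only [hk, dif_pos]; fun_prop
  · simp only [hk, dif_neg, not_false_iff]; exact continuous_const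

theorem coord_blocks {r m : ℕ} {x : ℕ → ℝ → E m} {t : ℝ} {k : ℕ} (hk : k < r) :
    coord (blocks r x t) k = x k t := by
  simp [coord, blocks, hk]

/-- The gain function, frozen outside `[0, c]`. -/
def clampGain (α : ℝ → ℝ) (c s : ℝ) : ℝ := α (max 0 (min s c))

theorem clampGain_eq {α : ℝ → ℝ} {c s : ℝ} (hs : s ∈ Icc 0 c) : clampGain α c s = α s := by
  unfold clampGain
  rw [min_eq_left hs.2, max_eq_right hs.1]

namespace ClosedLoop

variable {m r p q : ℕ} {L : ClosedLoop m r p q}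

/-- The signals `ρ_k` for the frozen gain, as a function of time and state. -/
noncomputable def localRho (L : ClosedLoop m r p q) (c : ℝ) (k : ℕ) (s : ℝ) (v : Blocks r m) :
    E m :=
  rho (clampGain L.α c) (fun j => L.φ (max s 0) • L.signal (fun j _ => coord v j) j (max s 0)) k

/-- The closed-loop vector field for the frozen gain. -/
noncomputable def localField (L : ClosedLoop m r p q) (c s : ℝ) (v : Blocks r m) (δ : E p)
    (z : E q) : Blocks r m :=
  WithLp.toLp 2 fun k : Fin r => if (k : ℕ) + 1 < r then coord v (k + 1) else
    L.f δ z (L.N (clampGain L.α c (‖L.localRho c r s v‖ ^ 2)) • L.localRho c r s v)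

theorem Admissible.continuous_clampGain (hL : L.Admissible) {c : ℝ} (hc : c ∈ Ico (0 : ℝ) 1) :
    Continuous (clampGain L.α c) ∧ ∀ s, 1 ≤ clampGain L.α c s := by
  have h1 : ∀ s : ℝ, max 0 (min s c) ∈ Ico (0 : ℝ) 1 := fun s =>
    ⟨le_max_left _ _, max_lt one_pos ((min_le_right _ _).trans_lt hc.2)⟩
  exact ⟨hL.smooth.continuousOn.comp_continuous (by fun_prop) h1, fun s => one_le_gain hL.bij (h1 s)⟩

theorem Admissible.continuous_localRho (hL : L.Admissible) {c : ℝ} (hc : c ∈ Ico (0 : ℝ) 1) :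
    ∀ k ≤ r, Continuous fun y : ℝ × Blocks r m => L.localRho c k y.1 y.2 := by
  intro k
  induction k with
  | zero => intro _; exact continuous_const
  | succ k ih =>
    intro hk
    have h1 := ih (by omega)
    have hmax : Continuous fun y : ℝ × Blocks r m => max y.1 0 := by fun_prop
    have h2 : Continuous fun y : ℝ × Blocks r m => L.φ (max y.1 0) :=
      hL.funnel_continuousOn.comp_continuous hmax fun y => mem_Ici.2 (le_max_right _ _)
    have h3 : Continuous fun y : ℝ × Blocks r m =>
        L.signal (fun j _ => coord y.2 j) k (max y.1 0) := by
      have h4 : Continuous fun y : ℝ × Blocks r m => coord y.2 k :=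
        (continuous_coord k).comp continuous_snd
      unfold signal
      by_cases h : k < L.rhat
      · simp only [h, if_true]
        exact h4.sub ((hL.ref.lip k hk).continuousOn.comp_continuous hmax fun y => mem_Ici.2 (le_max_right _ _))
      · simpa only [h, if_false] using h4
    have h5 : Continuous fun y : ℝ × Blocks r m =>
        clampGain L.α c (‖L.localRho c k y.1 y.2‖ ^ 2) :=
      (hL.continuous_clampGain hc).1.comp (h1.norm.pow 2)
    exact (h2.smul h3).add (h5.smul h1)

theorem Admissible.continuous_localField (hL : L.Admissible) {c : ℝ} (hc : c ∈ Ico (0 : ℝ) 1) :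
    Continuous fun y : (ℝ × Blocks r m) × E p × E q =>
      L.localField c y.1.1 y.1.2 y.2.1 y.2.2 := by
  refine (PiLp.continuous_toLp 2 _).comp (continuous_pi fun k => ?_)
  by_cases h : (k : ℕ) + 1 < r
  · simp only [h, if_true]
    exact (continuous_coord _).comp (by fun_prop)
  · simp only [h, if_false]
    have h1 : Continuous fun y : (ℝ × Blocks r m) × E p × E q => L.localRho c r y.1.1 y.1.2 :=
      (hL.continuous_localRho hc r le_rfl).comp continuous_fst
    have h2 : Continuous fun y : (ℝ × Blocks r m) × E p × E q =>
        L.N (clampGain L.α c (‖L.localRho c r y.1.1 y.1.2‖ ^ 2)) :=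
      hL.gain.1.comp_continuous ((hL.continuous_clampGain hc).1.comp (h1.norm.pow 2))
        fun y => zero_le_one.trans ((hL.continuous_clampGain hc).2 _)
    exact hL.field.comp ((continuous_fst.comp continuous_snd).prodMk
      ((continuous_snd.comp continuous_snd).prodMk (h2.smul h1)))

/-- With frozen gain the field is continuous everywhere. The BIBO property bounds the operator
uniformly over all continuations of ξ, and its local Lipschitz property gives convergence along
uniformly convergent arguments. -/
theorem Admissible.exists_causalField (hL : L.Admissible) {c : ℝ} (hc : c ∈ Ico (0 : ℝ) 1)
    {t₀ : ℝ} (ht₀ : 0 ≤ t₀) {ξ : ℝ → Blocks r m} (hξ : Continuous ξ) {B : ℝ}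
    (hB : ∀ t ≤ t₀, ‖ξ t‖ ≤ B) :
    ∃ τ R M : ℝ, 0 < τ ∧ 0 ≤ M ∧ M * τ ≤ R ∧
      CausalField ξ t₀ τ R M fun x s => L.localField c s (x s) (L.d s) (L.T x s) := by
  have hh := hL.memory
  obtain ⟨c₀, δ, τ₁, hc₀, hδ, hτ₁, hlip⟩ := hL.operator.lipschitz t₀ ht₀ ξ hξ.continuousOn
  -- Continuations satisfy a non-strict bound by R, while the local Lipschitz property asks for
  -- distance strictly below δ.
  set R := δ / 2 with hR
  obtain ⟨Z, hZ0, hZ⟩ := hL.operator.bibo (|B| + R + 1) (by positivity)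
  obtain ⟨D, hD0, hD⟩ := hL.exists_disturbance_bound
  have hF := hL.continuous_localField hc
  obtain ⟨M₀, hM₀⟩ := (((isCompact_Icc (a := t₀) (b := t₀ + 1)).prod
    (isCompact_closedBall (ξ t₀) R)).prod ((isCompact_closedBall (0 : E p) D).prod
      (isCompact_closedBall (0 : E q) Z))).exists_bound_of_continuousOn hF.continuousOn
  set M := max M₀ 0 with hM
  have hM0 : 0 ≤ M := le_max_right _ _
  -- τ ≤ 1 keeps time in the compact set defining M₀, τ ≤ τ₁ serves the Lipschitz property, and R /
  -- (M + 1) yields M τ ≤ R even when M = 0.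
  set τ := min (min 1 τ₁) (R / (M + 1)) with hτ_def
  have hτ : 0 < τ := lt_min (lt_min one_pos hτ₁) (by positivity)
  have hτ1 : τ ≤ 1 := (min_le_left _ _).trans (min_le_left _ _)
  have hττ₁ : τ ≤ τ₁ := (min_le_left _ _).trans (min_le_right _ _)
  have hMτ : M * τ ≤ R := by
    have h1 : τ ≤ R / (M + 1) := min_le_right _ _
    rw [le_div_iff₀ (by positivity)] at h1
    nlinarith
  have hsub : Icc t₀ (t₀ + τ) ⊆ Ici (0 : ℝ) := fun t ht => ht₀.trans ht.1
  have hcont : ∀ {x : ℝ → Blocks r m}, Continues ξ t₀ R x → ContinuousOn x (Ici (-L.h)) :=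
    fun hx => hx.continuous.continuousOn
  have hTb : ∀ x, Continues ξ t₀ R x → ∀ᵐ s ∂volume.restrict (Icc t₀ (t₀ + τ)),
      ‖L.T x s‖ ≤ Z := by
    intro x hx
    have h1 := hZ x (hcont hx) fun t _ => by
      rcases le_total t t₀ with h | h
      · rw [hx.eqOn h]
        linarith [hB t h, le_abs_self B]
      · have h2 := hx.bound t h
        have h3 : ‖x t‖ ≤ ‖x t - ξ t₀‖ + ‖ξ t₀‖ := by
          simpa using norm_add_le (x t - ξ t₀) (ξ t₀)
        linarith [hB t₀ le_rfl, le_abs_self B]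
    filter_upwards [ae_restrict_of_ae_restrict_of_subset hsub h1] with s hs using hs.le
  refine ⟨τ, R, M, hτ, hM0, hMτ, ?_, ?_, ?_, ?_⟩
  · intro x hx
    have h1 : AEStronglyMeasurable L.d (volume.restrict (Icc t₀ (t₀ + τ))) :=
      hL.disturbance.1.mono_measure (Measure.restrict_mono hsub le_rfl)
    have h2 : AEStronglyMeasurable (L.T x) (volume.restrict (Icc t₀ (t₀ + τ))) :=
      (hL.operator.memLp_loc x (hcont hx) (t₀ + τ) (by linarith)).1.mono_measure
        (Measure.restrict_mono (Icc_subset_Icc_left ht₀) le_rfl)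
    have h3 : AEStronglyMeasurable (fun s => (s, x s)) (volume.restrict (Icc t₀ (t₀ + τ))) :=
      (continuous_id.prodMk hx.continuous).aestronglyMeasurable
    exact hF.comp_aestronglyMeasurable (h3.prodMk (h1.prodMk h2))
  · intro x hx
    filter_upwards [hTb x hx, ae_restrict_of_ae_restrict_of_subset hsub hD,
      ae_restrict_mem measurableSet_Icc] with s h1 h2 h3
    refine (hM₀ ((s, x s), L.d s, L.T x s) ⟨⟨⟨h3.1, h3.2.trans (by linarith)⟩, ?_⟩, ?_, ?_⟩).trans
      (le_max_left _ _)
    · rw [mem_closedBall_iff_norm]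
      exact hx.bound s h3.1
    · simpa using h2
    · simpa using h1
  · intro x x' hx hx' t ht hxx'
    have h1 := hL.operator.causal x x' (hcont hx) (hcont hx') t (ht₀.trans ht.1)
      (hxx'.mono fun s hs => hs.2)
    filter_upwards [ae_restrict_of_ae_restrict_of_subset (Icc_subset_Icc_left ht₀) h1,
      ae_restrict_mem measurableSet_Icc] with s h2 h3
    rw [h2, hxx' (show s ∈ Iic t from h3.2)]
  · intro xs x hxs hx hunif
    have h1 : ∀ᵐ s ∂volume.restrict (Icc t₀ (t₀ + τ)), ∀ n, ‖L.T (xs n) s - L.T x s‖ ≤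
        c₀ * sSup ((fun s' => ‖xs n s' - x s'‖) '' Icc t₀ (t₀ + τ₁)) := by
      rw [ae_all_iff]
      intro n
      refine ae_restrict_of_ae_restrict_of_subset (Icc_subset_Icc_right (by linarith))
        (hlip (xs n) x (hcont (hxs n)) (hcont hx) (fun s hs => (hxs n).eqOn hs.2)
          (fun s hs => hx.eqOn hs.2) fun s hs => ?_)
      exact ⟨((hxs n).bound s hs.1).trans_lt (by linarith),
        (hx.bound s hs.1).trans_lt (by linarith)⟩
    have h2 : Tendsto (fun n => c₀ * sSup ((fun s' => ‖xs n s' - x s'‖) '' Icc t₀ (t₀ + τ₁)))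
        atTop (𝓝 0) := by
      rw [← mul_zero c₀]
      refine Tendsto.const_mul c₀ ?_
      rw [Metric.tendsto_nhds]
      intro ε hε
      filter_upwards [(Metric.tendstoUniformly_iff.1 hunif) (ε / 2) (by positivity)] with n hn
      have h3 : sSup ((fun s' => ‖xs n s' - x s'‖) '' Icc t₀ (t₀ + τ₁)) ≤ ε / 2 := by
        refine csSup_le ((nonempty_Icc.2 (by linarith)).image _) ?_
        rintro _ ⟨s, -, rfl⟩
        have := hn s
        rw [dist_comm, dist_eq_norm] at this
        exact this.le
      have h4 : 0 ≤ sSup ((fun s' => ‖xs n s' - x s'‖) '' Icc t₀ (t₀ + τ₁)) :=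
        Real.sSup_nonneg (by rintro _ ⟨s, -, rfl⟩; positivity)
      rw [dist_zero_right, Real.norm_of_nonneg h4]
      linarith
    filter_upwards [h1] with s hs
    have h3 : Tendsto (fun n => L.T (xs n) s) atTop (𝓝 (L.T x s)) := by
      rw [tendsto_iff_norm_sub_tendsto_zero]
      exact squeeze_zero (fun n => norm_nonneg _) hs h2
    have h4 : Tendsto (fun n => (((s, xs n s), L.d s, L.T (xs n) s) :
        (ℝ × Blocks r m) × E p × E q)) atTop (𝓝 ((s, x s), L.d s, L.T x s)) :=
      (tendsto_const_nhds.prodMk_nhds (hunif.tendsto_at s)).prodMk_nhds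
        (tendsto_const_nhds.prodMk_nhds h3)
    exact (hF.tendsto _).comp h4

theorem localRho_eq {c t : ℝ} (ht : 0 ≤ t) (v : Blocks r m) {x : ℕ → ℝ → E m}
    (hx : ∀ j < r, x j t = coord v j) {k : ℕ} (hk : k ≤ r) :
    L.localRho c k t v = rho (clampGain L.α c) (fun j => L.φ t • L.signal x j t) k := by
  unfold localRho
  rw [max_eq_left ht]
  refine rho_congr fun j hj => ?_
  have : L.signal (fun j _ => coord v j) j t = L.signal x j t := signal_congr (hx j (by omega)).symm
  rw [this]

end ClosedLoop

end FunnelControl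

/-! ### Gluing at a point and extension to the right -/

namespace FunnelControl

theorem LipOn.of_inter_Iic_Ici {Y : Type*} [PseudoMetricSpace Y] {g : ℝ → Y} {s : Set ℝ}
    (hs : s.OrdConnected) {b : ℝ} (h1 : LipOn g (s ∩ Iic b)) (h2 : LipOn g (s ∩ Ici b)) :
    LipOn g s := by
  obtain ⟨C, hC0, hC⟩ := h1.exists_dist_le
  obtain ⟨D, hD0, hD⟩ := h2.exists_dist_le
  have key : ∀ u ∈ s, ∀ t ∈ s, u ≤ t → dist (g u) (g t) ≤ (C + D) * dist u t := by
    intro u hu t ht hut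
    rw [Real.dist_eq, abs_sub_comm, abs_of_nonneg (by linarith)]
    rcases le_total t b with h | h
    · have := hC u ⟨hu, hut.trans h⟩ t ⟨ht, h⟩
      rw [Real.dist_eq, abs_sub_comm, abs_of_nonneg (by linarith)] at this
      nlinarith
    · rcases le_total b u with h' | h'
      · have := hD u ⟨hu, h'⟩ t ⟨ht, h⟩
        rw [Real.dist_eq, abs_sub_comm, abs_of_nonneg (by linarith)] at this
        nlinarith
      · have hb : b ∈ s := hs.out hu ht ⟨h', h⟩
        have e1 := hC u ⟨hu, h'⟩ b ⟨hb, mem_Iic.2 le_rfl⟩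
        have e2 := hD b ⟨hb, mem_Ici.2 le_rfl⟩ t ⟨ht, h⟩
        rw [Real.dist_eq, abs_sub_comm, abs_of_nonneg (by linarith)] at e1 e2
        have := dist_triangle (g u) (g b) (g t)
        nlinarith
  refine LipOn.of_dist_le (C := C + D) fun u hu t ht => ?_
  rcases le_total u t with h | h
  · exact key u hu t ht h
  · rw [dist_comm (g u), dist_comm u]; exact key t ht u hu h

theorem LipOn.union_Icc {Y : Type*} [PseudoMetricSpace Y] {g : ℝ → Y} {a b c : ℝ}
    (h1 : LipOn g (Icc a b)) (h2 : LipOn g (Icc b c)) : LipOn g (Icc a c) :=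
  LipOn.of_inter_Iic_Ici ordConnected_Icc (h1.mono fun _ ht => ⟨ht.1.1, ht.2⟩)
    (h2.mono fun _ ht => ⟨ht.2, ht.1.2⟩)

theorem ae_restrict_Icc_union {a b c : ℝ} {P : ℝ → Prop}
    (h1 : ∀ᵐ t ∂volume.restrict (Icc a b), P t) (h2 : ∀ᵐ t ∂volume.restrict (Icc b c), P t) :
    ∀ᵐ t ∂volume.restrict (Icc a c), P t := by
  have h3 : ∀ᵐ t ∂volume.restrict (Icc a b ∪ Icc b c), P t := (ae_restrict_union_iff _ _ _).2 ⟨h1, h2⟩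
  refine ae_restrict_of_ae_restrict_of_subset (fun t ht => ?_) h3
  rcases le_total t b with h | h
  · exact Or.inl ⟨ht.1, h⟩
  · exact Or.inr ⟨h, ht.2⟩

theorem exists_forall_lt_lt_one {r : ℕ} {v : ℕ → ℝ} (h : ∀ k ≤ r, v k < 1) :
    ∃ c ∈ Ico (0 : ℝ) 1, ∀ k ≤ r, v k < c := by
  have h1 : ∀ᶠ c in 𝓝[<] (1 : ℝ), ∀ k ∈ Finset.range (r + 1), v k < c := by
    rw [Filter.eventually_all_finset]
    intro k hk
    exact mem_nhdsWithin_of_mem_nhds (Ioi_mem_nhds (h k (by simpa [Nat.lt_succ_iff] using hk)))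
  obtain ⟨c, hc, hcI⟩ := (h1.and (Ico_mem_nhdsLT (zero_lt_one (α := ℝ)))).exists
  exact ⟨c, hcI, fun k hk => hc k (by simpa [Nat.lt_succ_iff] using hk)⟩

namespace ClosedLoop

variable {m r p q : ℕ} {L : ClosedLoop m r p q}

/-- A solution on a closed interval can be extended to the right. -/
theorem StateSol.exists_extension (hL : L.Admissible) {t₀ : ℝ} (ht₀ : 0 ≤ t₀) {x : ℕ → ℝ → E m}
    (hx : L.StateSol (Icc (-L.h) t₀) x) :
    ∃ (ω : EReal) (y : ℝ → E m), (t₀ : EReal) < ω ∧ L.IsSol ω y ∧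
      EqOn y (x 0) (Icc (-L.h) t₀) := by
  have hr := hL.order_pos
  have hh := hL.memory
  have hle : -L.h ≤ t₀ := by linarith
  have ht₀J : t₀ ∈ Icc (-L.h) t₀ := ⟨hle, le_rfl⟩
  -- c lies strictly above every ‖ρ_k(t₀)‖², so the freezing of the gain beyond c is inactive near
  -- t₀.
  obtain ⟨c, hc, hρc⟩ := exists_forall_lt_lt_one (r := r) (v := fun k => ‖L.rhoSig x k t₀‖ ^ 2)
    fun k hk => by
      have h1 : ‖L.rhoSig x k t₀‖ < 1 := (hx.mem_domain t₀ ht₀J ht₀).norm_rho_lt hk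
      nlinarith [norm_nonneg (L.rhoSig x k t₀)]
  have hblocks := blocks_continuousOn hx.cont
  -- The history is continued by constants on both sides, which makes it continuous on ℝ and
  -- bounded.
  set ξ : ℝ → Blocks r m := fun t => blocks r x (projIcc (-L.h) t₀ hle t) with hξ_def
  have hξ : Continuous ξ :=
    hblocks.comp_continuous (continuous_subtype_val.comp continuous_projIcc) fun t => Subtype.prop _
  obtain ⟨B, hB⟩ := isCompact_Icc.exists_bound_of_continuousOn hblocks
  obtain ⟨τ, R, M, hτ, hM, hMR, hH⟩ := hL.exists_causalField hc ht₀ hξ (B := B)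
    fun t _ => hB _ (Subtype.prop _)
  obtain ⟨z, hz, hzeq⟩ := hH.exists_solution hξ hτ hM hMR
  set H : ℝ → Blocks r m := fun s => L.localField c s (z s) (L.d s) (L.T z s) with hH_def
  have hzx : EqOn z (blocks r x) (Icc (-L.h) t₀) := fun t ht => by
    rw [hz.eqOn ht.2, hξ_def]
    simp only [projIcc_of_mem hle ht]
  set Z : ℕ → ℝ → E m := fun k t => coord (z t) k with hZ_def
  have hZc : ∀ k, Continuous (Z k) := fun k => (continuous_coord k).comp hz.continuous
  have hZx : ∀ k < r, EqOn (Z k) (x k) (Icc (-L.h) t₀) := fun k hk t ht => by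
    simp only [hZ_def, hzx ht, coord_blocks hk]
  have hZz : blocks r Z = z := by
    funext t
    ext k
    simp [blocks, hZ_def, coord]
  have hgain : ∀ s ∈ Icc 0 c, clampGain L.α c s = L.α s := fun s hs => clampGain_eq hs
  have hloc : ∀ t, 0 ≤ t → ∀ k ≤ r, L.localRho c k t (z t) =
      rho (clampGain L.α c) (fun j => L.φ t • L.signal Z j t) k := fun t ht k hk =>
    localRho_eq ht (z t) (fun _ _ => rfl) hk
  have hg0 : ∀ k ≤ r, ‖L.localRho c k t₀ (z t₀)‖ ^ 2 < c := by
    intro k hk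
    rw [localRho_eq ht₀ (z t₀) (fun j hj => (hZx j hj ht₀J).symm) hk,
      ← rho_eq_of_gain_eq (α := L.α) (fun s hs => (hgain s hs).symm)
        fun j hj => (hρc j (by omega)).le]
    exact hρc k hk
  have hev : ∀ᶠ t in 𝓝 t₀, ∀ k ∈ Finset.range (r + 1), ‖L.localRho c k t (z t)‖ ^ 2 < c := by
    rw [Filter.eventually_all_finset]
    intro k hk
    have hk' : k ≤ r := by simpa [Nat.lt_succ_iff] using hk
    have h1 : Continuous fun t => ‖L.localRho c k t (z t)‖ ^ 2 :=
      (((hL.continuous_localRho hc k hk').comp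
        (continuous_id.prodMk hz.continuous)).norm).pow 2
    exact h1.continuousAt.eventually (gt_mem_nhds (hg0 k hk'))
  -- On [t₀, b], with b close to t₀, all frozen signals keep squared norm below c and hence coincide
  -- with the true ρ_k.
  obtain ⟨σ, hσ, hball⟩ := Metric.eventually_nhds_iff.1 hev
  set τ' := min τ (σ / 2) with hτ'_def
  have hτ' : 0 < τ' := lt_min hτ (by positivity)
  have hτ'τ : τ' ≤ τ := min_le_left _ _
  set b := t₀ + τ' with hb
  have hbτ : Icc t₀ b ⊆ Icc t₀ (t₀ + τ) := Icc_subset_Icc_right (by linarith)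
  have hsmall : ∀ t ∈ Icc t₀ b, ∀ k ≤ r, ‖L.localRho c k t (z t)‖ ^ 2 < c := by
    intro t ht k hk
    refine hball ?_ k (by simpa [Nat.lt_succ_iff] using hk)
    rw [Real.dist_eq, abs_of_nonneg (by linarith [ht.1])]
    have : τ' ≤ σ / 2 := min_le_right _ _
    linarith [ht.2]
  have hrho : ∀ t ∈ Icc t₀ b, ∀ k ≤ r, L.localRho c k t (z t) = L.rhoSig Z k t := by
    intro t ht k hk
    have h0 := ht₀.trans ht.1
    rw [hloc t h0 k hk]
    refine rho_eq_of_gain_eq hgain fun j hj => ?_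
    rw [← hloc t h0 j (by omega)]
    exact (hsmall t ht j (by omega)).le
  have hHint : ∀ t ∈ Icc t₀ (t₀ + τ), IntervalIntegrable H volume t₀ t := by
    intro t ht
    have h1 : IntegrableOn H (Icc t₀ (t₀ + τ)) := Integrable.of_bound (hH.meas z hz) M (hH.bound z hz)
    exact (h1.mono_set (uIcc_subset_Icc ⟨le_rfl, by linarith⟩ ht)).intervalIntegrable
  have hcomp : ∀ k (hk : k < r), ∀ t ∈ Icc t₀ (t₀ + τ),
      Z k t = Z k t₀ + ∫ s in t₀..t, H s ⟨k, hk⟩ := by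
    intro k hk t ht
    have h1 := congrArg (PiLp.proj (𝕜 := ℝ) 2 (fun _ : Fin r => E m) ⟨k, hk⟩) (hzeq t ht)
    rw [map_add, ← ContinuousLinearMap.intervalIntegral_comp_comm _ (hHint t ht),
      ← hz.eqOn (mem_Iic.2 (le_refl t₀))] at h1
    simpa [hZ_def, coord, hk] using h1
  have hdomb : ∀ {t : ℝ}, t ∈ dom L.h b ↔ -L.h ≤ t ∧ t < b := by
    intro t
    rw [mem_dom, EReal.coe_lt_coe_iff]
  have hsplit : dom L.h (b : EReal) ⊆ Icc (-L.h) t₀ ∪ Ico t₀ b := by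
    intro t ht
    rcases le_total t t₀ with h | h
    · exact Or.inl ⟨(hdomb.1 ht).1, h⟩
    · exact Or.inr ⟨h, (hdomb.1 ht).2⟩
  have htop : ∀ s, H s ⟨r - 1, by omega⟩ = L.f (L.d s) (L.T z s)
      (L.N (clampGain L.α c (‖L.localRho c r s (z s)‖ ^ 2)) • L.localRho c r s (z s)) := by
    intro s
    simp only [hH_def, localField]
    rw [if_neg (by omega)]
  have hctrl : ∀ t ∈ Icc t₀ b, L.N (clampGain L.α c (‖L.localRho c r t (z t)‖ ^ 2)) •
      L.localRho c r t (z t) = L.control Z t := by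
    intro t ht
    rw [clampGain_eq ⟨sq_nonneg _, (hsmall t ht r le_rfl).le⟩, hrho t ht r le_rfl]
    rfl
  have hbpos : (0 : EReal) < (b : EReal) := by
    have : 0 < b := by linarith
    exact_mod_cast this
  refine ⟨b, Z 0, by exact_mod_cast (by linarith : t₀ < b), StateSol.isSol hL hbpos
    ⟨fun k _ => (hZc k).continuousOn, fun k hk t ht => ?_, fun k hk t ht => ?_,
      fun s hs h0 => ?_, fun t ht h0 => ?_, fun s hs h0 ζ hζ hζZ => ?_⟩ (eqOn_refl _ _),
    hZx 0 hr⟩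
  -- At t₀ the derivative is assembled from the derivatives within the two pieces; at any other
  -- point one piece does not accumulate and imposes nothing.
  · refine HasDerivWithinAt.mono ?_ hsplit
    refine HasDerivWithinAt.union ?_ ?_
    · by_cases htt : t ≤ t₀
      · have htJ : t ∈ Icc (-L.h) t₀ := ⟨(hdomb.1 ht).1, htt⟩
        rw [hZx (k + 1) hk htJ]
        exact (hx.hasDeriv k hk t htJ).congr_of_mem (hZx k (by omega)) htJ
      · refine HasFDerivWithinAt.of_notMem_closure ?_
        rw [closure_Icc]
        exact fun h => htt h.2
    · by_cases htt : t₀ ≤ t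
      · have h1 : HasDerivAt (fun t => Z k t₀ + ∫ s in t₀..t, Z (k + 1) s) (Z (k + 1) t) t :=
          (intervalIntegral.integral_hasDerivAt_right ((hZc _).intervalIntegrable _ _)
            ((hZc _).stronglyMeasurableAtFilter _ _) (hZc _).continuousAt).const_add _
        refine h1.hasDerivWithinAt.congr_of_mem (fun s hs => ?_) ⟨htt, (hdomb.1 ht).2⟩
        rw [hcomp k (by omega) s (hbτ (Ico_subset_Icc_self hs))]
        congr 1
        refine intervalIntegral.integral_congr fun u _ => ?_
        simp only [hH_def, localField, hk, if_true, hZ_def]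
      · refine HasFDerivWithinAt.of_notMem_closure fun h => htt ?_
        exact (closure_minimal Ico_subset_Icc_self isClosed_Icc h).1
  · rw [hZx k hk ⟨ht.1, ht.2.trans ht₀⟩, hx.initial k hk ht]
  · have h1 : LipOn (Z (r - 1)) (Icc 0 t₀) := (hx.lip t₀ ht₀J ht₀).congr
      ((hZx (r - 1) (by omega)).mono (Icc_subset_Icc_left (by linarith)))
    have h2 : LipOn (Z (r - 1)) (Icc t₀ (t₀ + τ)) := by
      refine LipOn.of_dist_le (C := M) fun s hs t ht => ?_
      have h3 : dist (z s) (z t) ≤ M * dist s t := by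
        rw [hzeq s hs, hzeq t ht, dist_add_left]
        exact hH.dist_integral_le hτ.le hz s hs t ht
      refine le_trans ?_ h3
      have h4 : r - 1 < r := by omega
      simp only [hZ_def, coord, h4, dif_pos, dist_eq_norm]
      exact PiLp.norm_apply_le (z s - z t) _
    refine (h1.union_Icc h2).mono (Icc_subset_Icc_right ?_)
    linarith [(hdomb.1 hs).2]
  · by_cases htt : t ≤ t₀
    · have htJ : t ∈ Icc (-L.h) t₀ := ⟨(hdomb.1 ht).1, htt⟩
      refine memD_congr (fun j hj => ?_) (hx.mem_domain t htJ h0)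
      rw [signal_congr (hZx j hj htJ)]
    · have htI : t ∈ Icc t₀ b := ⟨(not_le.1 htt).le, (hdomb.1 ht).2.le⟩
      refine memD_of_norm_rho_lt fun k hk => ?_
      change ‖L.rhoSig Z k t‖ < 1
      rw [← hrho t htI k hk]
      have := hsmall t htI k hk
      nlinarith [norm_nonneg (L.localRho c k t (z t)), hc.2]
  -- The equation is verified with z itself as argument of the operator, on [0, t₀] by hypothesis
  -- and on [t₀, b] by differentiating the integral equation. Causality then transfers it to ζ.
  · have hzc : ContinuousOn z (Ici (-L.h)) := hz.continuous.continuousOn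
    have e1 : L.StateEq z Z t₀ := (hx.equation t₀ ht₀J ht₀ z hzc hzx).congr hL.operator hr ht₀
      le_rfl (fun k hk => ((hZx k hk).symm).mono (Icc_subset_Icc_left (by linarith)))
      (eqOn_refl _ _) hzc hzc
    have e2 : ∀ᵐ t ∂volume.restrict (Icc t₀ b),
        HasDerivAt (Z (r - 1)) (L.f (L.d t) (L.T z t) (L.control Z t)) t := by
      have h1 := (hHint (t₀ + τ) ⟨by linarith, le_rfl⟩).ae_hasDerivAt_integral
      rw [uIcc_of_le (by linarith)] at h1
      rw [ae_restrict_Icc_iff_Ioo]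
      filter_upwards [ae_restrict_of_ae h1, ae_restrict_mem measurableSet_Ioo] with t h2 h3
      have htI := Ioo_subset_Icc_self h3
      have h4 := h2 (hbτ htI) t₀ ⟨le_rfl, by linarith⟩
      have h5 := (h4.const_add (ξ t₀)).congr_of_eventuallyEq (f₁ := z) (by
        filter_upwards [Icc_mem_nhds h3.1 h3.2] with s hs using hzeq s (hbτ hs))
      have h6 := (PiLp.proj (𝕜 := ℝ) 2 (fun _ : Fin r => E m)
        ⟨r - 1, by omega⟩).hasFDerivAt.comp_hasDerivAt t h5
      have h7 : HasDerivAt (Z (r - 1)) (H t ⟨r - 1, by omega⟩) t := by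
        refine HasDerivAt.congr_of_eventuallyEq h6 (Eventually.of_forall fun s => ?_)
        have h8 : r - 1 < r := by omega
        simp [hZ_def, coord, h8]
      rwa [htop, hctrl t htI] at h7
    have e3 : L.StateEq z Z b := ae_restrict_Icc_union e1 e2
    exact e3.congr hL.operator hr h0 (hdomb.1 hs).2.le (fun k _ => eqOn_refl _ _)
      (by rw [hZz] at hζZ; exact hζZ.symm) hzc hζ

end ClosedLoop

end FunnelControl

namespace FunnelControl

/-! ### Bounds along solutions -/

theorem lipOn_of_hasDerivWithinAt {F : Type*} [NormedAddCommGroup F] [NormedSpace ℝ F]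
    {g g' : ℝ → F} {s : Set ℝ} (hs : Convex ℝ s) {C : ℝ}
    (h : ∀ t ∈ s, HasDerivWithinAt g (g' t) s t) (hC : ∀ t ∈ s, ‖g' t‖ ≤ C) : LipOn g s := by
  refine LipOn.of_dist_le (C := C) fun x hx y hy => ?_
  rw [dist_eq_norm, dist_eq_norm]
  exact hs.norm_image_sub_le_of_norm_hasDerivWithin_le h hC hy hx

namespace ClosedLoop

variable {m r p q : ℕ} {L : ClosedLoop m r p q}

theorem Admissible.funnel_lipOn (hL : L.Admissible) {b : ℝ} (hb : 0 ≤ b) :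
    LipOn L.φ (Icc 0 b) := by
  obtain ⟨c, hc, hd⟩ := hL.funnel.deriv_le
  obtain ⟨A, hA⟩ := isCompact_Icc.exists_bound_of_continuousOn
    (hL.funnel_continuousOn.mono (Icc_subset_Ici_self : Icc (0:ℝ) b ⊆ Ici 0))
  have hac := hL.funnel.locally_ac b hb
  refine LipOn.of_dist_le (C := c * (1 + A))
    (dist_le_of_ae_deriv_le (g' := deriv L.φ) hb hac ?_)
  have h1 := hac.ae_differentiableAt
  rw [uIcc_of_le hb, ← ae_restrict_iff' measurableSet_Icc] at h1
  filter_upwards [h1, ae_restrict_of_ae_restrict_of_subset Icc_subset_Ici_self hd,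
    ae_restrict_mem measurableSet_Icc] with t h2 h3 h4
  refine ⟨h2.hasDerivAt, h3.trans ?_⟩
  have := (le_abs_self _).trans (hA t h4)
  exact mul_le_mul_of_nonneg_left (by linarith) hc.le

/-- The positive limit inferior handles large times and compactness the rest; a > 0 is essential
since φ may vanish at 0. -/
theorem Admissible.exists_funnel_lower_bound (hL : L.Admissible) {a : ℝ} (ha : 0 < a) :
    ∃ c > 0, ∀ t, a ≤ t → c ≤ L.φ t := by
  obtain ⟨c₁, h0, h1⟩ := EReal.lt_iff_exists_real_btwn.1 hL.funnel.liminf_pos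
  have h2 := eventually_lt_of_lt_liminf h1
  obtain ⟨b, hb⟩ := eventually_atTop.1 h2
  have hc₁ : 0 < c₁ := by exact_mod_cast h0
  obtain ⟨s, hs, hmin⟩ := (isCompact_Icc (a := a) (b := max a b)).exists_isMinOn
    ⟨a, le_rfl, le_max_left _ _⟩ (hL.funnel_continuousOn.mono fun t ht => ha.le.trans ht.1)
  refine ⟨min c₁ (L.φ s), lt_min hc₁ (hL.funnel.pos s (ha.trans_le hs.1)), fun t ht => ?_⟩
  rcases le_total t (max a b) with h | h
  · exact (min_le_right _ _).trans (hmin ⟨ht, h⟩)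
  · have := hb t ((le_max_right _ _).trans h)
    exact (min_le_left _ _).trans (by exact_mod_cast this.le)

section

variable {ω : EReal} {x : ℕ → ℝ → E m}

theorem StateSol.lipOn_Icc (hL : L.Admissible) (hx : L.StateSol (dom L.h ω) x) {k : ℕ} (hk : k < r)
    {b : ℝ} (hb : b ∈ dom L.h ω) (hb0 : 0 ≤ b) : LipOn (x k) (Icc 0 b) := by
  have hsub := Icc_zero_subset_dom hL.memory hb.2
  rcases Nat.lt_or_ge (k + 1) r with h | h
  · obtain ⟨C, hC⟩ := isCompact_Icc.exists_bound_of_continuousOn ((hx.cont (k + 1) h).mono hsub)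
    exact lipOn_of_hasDerivWithinAt (convex_Icc _ _)
      (fun t ht => (hx.hasDeriv k h t (hsub ht)).mono hsub) hC
  · obtain rfl : k = r - 1 := by omega
    exact hx.lip b hb hb0

theorem StateSol.hasDerivAt (hx : L.StateSol (dom L.h ω) x) {k : ℕ} (hk : k + 1 < r)
    {t : ℝ} (ht : -L.h < t) (ht' : (t : EReal) < ω) : HasDerivAt (x k) (x (k + 1) t) t :=
  (hx.hasDeriv k hk t ⟨ht.le, ht'⟩).hasDerivAt (dom_mem_nhds ht ht')

theorem Admissible.hasDerivAt_ref (hL : L.Admissible) {k : ℕ} (hk : k + 1 < r) {t : ℝ}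
    (ht : 0 < t) : HasDerivAt (refDer L.yref k) (refDer L.yref (k + 1) t) t :=
  (hL.ref.hasDeriv k hk t ht.le).hasDerivAt (Ici_mem_nhds ht)

/-- The derivative of one signal differs from the next signal only where errors give way to output
derivatives. -/
theorem StateSol.errorChain (hL : L.Admissible) (hx : L.StateSol (dom L.h ω) x) {a : ℝ}
    (ha : 0 < a) (haω : (a : EReal) < ω) :
    ErrorChain L.α L.φ r (dom (-a) ω) a (L.signal x) := by
  have hh := hL.memory
  have hS : ∀ {t : ℝ}, t ∈ dom (-a) ω → a ≤ t := fun ht => by simpa using ht.1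
  have hSd : ∀ {t : ℝ}, t ∈ dom (-a) ω → t ∈ dom L.h ω := fun ht => ⟨by linarith [hS ht], ht.2⟩
  have hlip : ∀ k < r, ∀ b ∈ dom (-a) ω, LipOn (L.signal x k) (Icc a b) := by
    intro k hk b hb
    have h1 := (hx.lipOn_Icc hL hk (hSd hb) (ha.le.trans (hS hb))).mono (Icc_subset_Icc_left ha.le)
    unfold signal
    by_cases h : k < L.rhat
    · simp only [h, if_true]
      exact h1.sub ((hL.ref.lip k hk).mono fun t ht => ha.le.trans ht.1)
    · simpa only [h, if_false] using h1
  obtain ⟨c, hc, hd⟩ := hL.funnel.deriv_le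
  obtain ⟨φ₀, hφ₀, hφ⟩ := hL.exists_funnel_lower_bound ha
  refine ⟨(convex_dom _ _).ordConnected, ⟨by simp, haω⟩, fun t ht => hS ht, fun b hb =>
    (hL.funnel_lipOn (ha.le.trans (hS hb))).mono (Icc_subset_Icc_left ha.le),
    ⟨φ₀, hφ₀, fun t ht => hφ t (hS ht)⟩, ⟨c, hc.le, ae_restrict_of_ae_restrict_of_subset
      (fun t ht => ha.le.trans (hS ht)) hd⟩, hlip, fun k hk => ?_, fun t ht =>
        hx.mem_domain t (hSd ht) (ha.le.trans (hS ht))⟩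
  have hder : ∀ b ∈ dom (-a) ω, ∀ t ∈ Icc a b, ∀ e', HasDerivAt (L.signal x k) e' t →
      e' - L.signal x (k + 1) t = if k + 1 = L.rhat then -refDer L.yref (k + 1) t else 0 := by
    intro b hb t ht e' he'
    have htω : (t : EReal) < ω := lt_of_le_of_lt (by exact_mod_cast ht.2) hb.2
    have ht0 : 0 < t := ha.trans_le ht.1
    have hxd := hx.hasDerivAt hk (by linarith : -L.h < t) htω
    have hrd := hL.hasDerivAt_ref hk ht0
    unfold signal at he' ⊢
    rcases lt_trichotomy (k + 1) L.rhat with h | h | h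
    · simp only [show k < L.rhat by omega, if_true] at he'
      rw [he'.unique (hxd.sub hrd), if_pos h, if_neg h.ne]; abel
    · simp only [show k < L.rhat by omega, if_true] at he'
      rw [he'.unique (hxd.sub hrd), if_neg (by omega), if_pos h]; abel
    · simp only [show ¬ k < L.rhat by omega, if_false] at he'
      rw [he'.unique hxd, if_neg (by omega), if_neg h.ne']; abel
  -- At the switching index the defect is -y_ref^{(r̂)}. Here r̂ < r, so φ is bounded and so is the
  -- weighted defect.
  by_cases h : k + 1 = L.rhat
  · obtain ⟨A, hA⟩ := hL.funnel_bdd (by omega)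
    obtain ⟨B, hB⟩ := hL.ref.bdd (k + 1) hk
    refine ⟨A * B, fun b hb => ?_⟩
    filter_upwards [ae_restrict_mem measurableSet_Icc] with t ht e' he'
    have ht0 : (0 : ℝ) ≤ t := ha.le.trans ht.1
    rw [hder b hb t ht e' he', if_pos h, norm_smul, norm_neg,
      Real.norm_of_nonneg (hL.funnel.nonneg t ht0)]
    exact mul_le_mul (hA ⟨t, ht0, rfl⟩) (hB t ht0) (norm_nonneg _)
      ((hL.funnel.nonneg t ht0).trans (hA ⟨t, ht0, rfl⟩))
  · refine ⟨0, fun b hb => ?_⟩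
    filter_upwards [ae_restrict_mem measurableSet_Icc] with t ht e' he'
    rw [hder b hb t ht e' he', if_neg h]
    simp

/-- After a the error estimate and the bounded reference apply; before a compactness does. -/
theorem StateSol.bounded (hL : L.Admissible) (hω : 0 < ω) (hx : L.StateSol (dom L.h ω) x) {k : ℕ}
    (hk : k < r) : ∃ C, ∀ t ∈ dom L.h ω, ‖x k t‖ ≤ C := by
  obtain ⟨a, ha, haω⟩ := exists_pos_coe_lt hω
  obtain ⟨B, hB⟩ := (hx.errorChain hL ha haω).bounded hL.smooth hL.bij hk
  obtain ⟨A, hA⟩ := isCompact_Icc.exists_bound_of_continuousOn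
    ((hx.cont k hk).mono (Icc_subset_dom haω))
  obtain ⟨D, hD⟩ := hL.ref.bdd k hk
  refine ⟨max A (B + |D|), fun t ht => ?_⟩
  rcases le_total t a with h | h
  · exact (hA t ⟨ht.1, h⟩).trans (le_max_left _ _)
  · refine le_trans ?_ (le_max_right _ _)
    have h1 := hB t ⟨by simpa using h, ht.2⟩
    have h2 := (hD t (ha.le.trans h)).trans (le_abs_self D)
    unfold signal at h1
    by_cases h3 : k < L.rhat
    · rw [if_pos h3] at h1
      have := norm_add_le (x k t - refDer L.yref k t) (refDer L.yref k t)
      rw [sub_add_cancel] at this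
      linarith
    · rw [if_neg h3] at h1
      linarith [abs_nonneg D]

theorem StateSol.exists_blocks_bound (hL : L.Admissible) (hω : 0 < ω)
    (hx : L.StateSol (dom L.h ω) x) : ∃ C, 0 < C ∧ ∀ t ∈ dom L.h ω, ‖blocks r x t‖ < C := by
  choose! C hC using fun k hk => hx.bounded hL hω (k := k) hk
  have hK : IsCompact (univ.pi fun k : Fin r => Metric.closedBall (0 : E m) (C k)) :=
    isCompact_univ_pi fun k => isCompact_closedBall _ _
  obtain ⟨B, hB⟩ := hK.exists_bound_of_continuousOn
    (PiLp.continuous_toLp 2 (fun _ : Fin r => E m)).continuousOn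
  refine ⟨|B| + 1, by positivity, fun t ht => ?_⟩
  have := hB (fun k : Fin r => x k t) fun k _ => by simpa using hC k k.2 t ht
  exact (this.trans (le_abs_self B)).trans_lt (lt_add_one _)

/-- The operator is bounded along a solution. -/
theorem StateSol.exists_operator_bound (hL : L.Admissible) (hω : 0 < ω)
    (hx : L.StateSol (dom L.h ω) x) : ∃ Z, 0 ≤ Z ∧ ∀ τ ∈ dom L.h ω, 0 ≤ τ →
      ∃ ζ : ℝ → Blocks r m, (∀ᵐ t ∂volume.restrict (Icc 0 τ), ‖L.T ζ t‖ ≤ Z) ∧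
        L.StateEq ζ x τ := by
  obtain ⟨C, hC, hCb⟩ := hx.exists_blocks_bound hL hω
  obtain ⟨Z, hZ, hb⟩ := hL.operator.bibo C hC
  refine ⟨Z, hZ.le, fun τ hτ h0 => ⟨fun s => blocks r x (min s τ), ?_, ?_⟩⟩
  · have hc := blocks_min_continuousOn hτ.1 fun k hk => (hx.cont k hk).mono (Icc_subset_dom hτ.2)
    have h1 := hb _ hc fun t ht => hCb _ (Icc_subset_dom hτ.2 ⟨le_min ht hτ.1, min_le_right _ _⟩)
    filter_upwards [ae_restrict_of_ae_restrict_of_subset Icc_subset_Ici_self h1] with t ht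
      using ht.le
  · exact hx.equation τ hτ h0 _
      (blocks_min_continuousOn hτ.1 fun k hk => (hx.cont k hk).mono (Icc_subset_dom hτ.2))
      blocks_min_eqOn

/-- The signals `ρ_k` are uniformly bounded away from the funnel boundary. -/
theorem StateSol.exists_rhoSig_bound (hL : L.Admissible) (hω : 0 < ω)
    (hx : L.StateSol (dom L.h ω) x) : ∃ ε ∈ Ioo (0 : ℝ) 1, ∀ k ≤ r, ∀ t ∈ dom L.h ω, 0 ≤ t →
      ‖L.rhoSig x k t‖ ≤ ε := by
  have hr := hL.order_pos
  obtain ⟨a, ha, haω⟩ := exists_pos_coe_lt hω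
  have hch := hx.errorChain hL ha haω
  have hlast : ∃ ε < 1, ∀ t ∈ dom (-a) ω, ‖L.rhoSig x r t‖ ≤ ε := by
    obtain ⟨hN, S', hS', hgain⟩ := hL.gain
    obtain ⟨D, hD0, hD⟩ := hL.exists_disturbance_bound
    obtain ⟨Z, hZ0, hZ⟩ := hx.exists_operator_bound hL hω
    -- R is a Lipschitz constant of y_ref^{(r-1)} and thus bounds y_ref^{(r)} wherever it exists.
    obtain ⟨R, hR0, hR⟩ := (hL.ref.lip (r - 1) (by omega)).exists_dist_le
    refine hch.rho_last_bounded_away hr hL.smooth hL.bij hL.field hN hS' hgain hD0 hZ0 (R := R)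
      fun b hb => ?_
    have hab : a ≤ b := by simpa using hb.1
    obtain ⟨ζ, hζ, heq⟩ := hZ b ⟨by linarith [hL.memory], hb.2⟩ (ha.le.trans hab)
    have hsub : Icc a b ⊆ Icc 0 b := Icc_subset_Icc_left ha.le
    filter_upwards [ae_restrict_of_ae_restrict_of_subset hsub hζ,
      ae_restrict_of_ae_restrict_of_subset hsub heq,
      ae_restrict_of_ae_restrict_of_subset (hsub.trans Icc_subset_Ici_self) hD,
      ae_restrict_mem measurableSet_Icc] with t h1 h2 h3 h4 e' he'
    refine ⟨L.d t, L.T ζ t, h3, h1, ?_⟩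
    change ‖e' - L.f (L.d t) (L.T ζ t) (L.control x t)‖ ≤ R
    -- This is the case r̂ = r, where the last signal contains the reference. Differentiability of
    -- y_ref^{(r-1)} at t is inferred from that of the state and of the error.
    by_cases h : r - 1 < L.rhat
    · have h5 : HasDerivAt (fun t => x (r - 1) t - refDer L.yref (r - 1) t) e' t := by
        refine he'.congr_of_eventuallyEq (Eventually.of_forall fun s => ?_)
        simp only [signal, h, if_true]
      have h6 : HasDerivAt (refDer L.yref (r - 1))
          (L.f (L.d t) (L.T ζ t) (L.control x t) - e') t := by
        refine (h2.sub h5).congr_of_eventuallyEq (Eventually.of_forall fun s => ?_)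
        simp
      rw [norm_sub_rev, ← h6.deriv]
      exact norm_deriv_le_of_dist_le hR hR0 (Ici_mem_nhds (ha.trans_le h4.1))
    · have h5 : HasDerivAt (x (r - 1)) e' t := by
        refine he'.congr_of_eventuallyEq (Eventually.of_forall fun s => ?_)
        simp only [signal, h, if_false]
      rw [h5.unique h2, sub_self, norm_zero]
      exact hR0
  have hS : ∀ k ≤ r, ∃ ε < 1, ∀ t ∈ dom (-a) ω, ‖L.rhoSig x k t‖ ≤ ε := by
    intro k hk
    rcases hk.lt_or_eq with h | rfl
    · exact (hch.rho_bounded_away hL.smooth hL.bij k h).1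
    · exact hlast
  have hsub0 : Icc 0 a ⊆ dom L.h ω := Icc_zero_subset_dom hL.memory haω
  have hall : ∀ k ≤ r, ∃ ε < 1, ∀ t ∈ dom L.h ω, 0 ≤ t → ‖L.rhoSig x k t‖ ≤ ε := by
    intro k hk
    obtain ⟨ε, hε, hb⟩ := hS k hk
    have hmem : ∀ t ∈ Icc 0 a, memD L.α (fun k => L.φ t • L.signal x k t) r := fun t ht =>
      hx.mem_domain t (hsub0 ht) ht.1
    have hc := hL.rhoSig_continuousOn (fun j hj => (hx.cont j hj).mono hsub0)
      Icc_subset_Ici_self hmem k hk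
    obtain ⟨s, hs, hmax⟩ := isCompact_Icc.exists_isMaxOn ⟨0, le_rfl, ha.le⟩ hc.norm
    refine ⟨max ε ‖L.rhoSig x k s‖, max_lt hε ((hmem s hs).norm_rho_lt hk), fun t ht h0 => ?_⟩
    rcases le_total t a with h | h
    · exact (hmax ⟨h0, h⟩).trans (le_max_right _ _)
    · exact (hb t ⟨by simpa using h, ht.2⟩).trans (le_max_left _ _)
  choose! v hv hvb using hall
  obtain ⟨c, hc, hcv⟩ := exists_forall_lt_lt_one hv
  -- The maximum with 1/2 makes the bound positive, since c may be 0.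
  refine ⟨max c (1 / 2), ⟨by positivity, max_lt hc.2 (by norm_num)⟩, fun k hk t ht h0 => ?_⟩
  exact ((hvb k hk t ht h0).trans (hcv k hk).le).trans (le_max_left _ _)

/-- The gain N ∘ α is continuous on the compact interval [0, ε²] to which ‖ρ_r‖² is confined. -/
theorem StateSol.exists_control_bound (hL : L.Admissible) (hω : 0 < ω)
    (hx : L.StateSol (dom L.h ω) x) : ∃ U, ∀ t ∈ dom L.h ω, 0 ≤ t → ‖L.control x t‖ ≤ U := by
  obtain ⟨ε, hε, hb⟩ := hx.exists_rhoSig_bound hL hω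
  have hsub : Icc 0 (ε ^ 2) ⊆ Ico (0 : ℝ) 1 :=
    Icc_subset_Ico_right (by nlinarith [hε.1, hε.2])
  have hc : ContinuousOn (fun s => L.N (L.α s)) (Icc 0 (ε ^ 2)) :=
    hL.gain.1.comp (hL.smooth.continuousOn.mono hsub)
      fun s hs => zero_le_one.trans (one_le_gain hL.bij (hsub hs))
  obtain ⟨U, hU⟩ := isCompact_Icc.exists_bound_of_continuousOn hc
  refine ⟨U * 1, fun t ht h0 => ?_⟩
  have h1 := hb r le_rfl t ht h0
  have h2 := hU (‖L.rhoSig x r t‖ ^ 2) ⟨sq_nonneg _, pow_le_pow_left₀ (norm_nonneg _) h1 2⟩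
  rw [control, norm_smul]
  exact mul_le_mul h2 (h1.trans hε.2.le) (norm_nonneg _) ((norm_nonneg _).trans h2)

/-- The bounds on input and operator do not depend on τ, so one Lipschitz constant serves up to ω.
-/
theorem StateSol.lipOn_last (hL : L.Admissible) (hω : 0 < ω) (hx : L.StateSol (dom L.h ω) x) :
    LipOn (x (r - 1)) (dom L.h ω ∩ Ici 0) := by
  obtain ⟨U, hU⟩ := hx.exists_control_bound hL hω
  obtain ⟨Z, -, hZ⟩ := hx.exists_operator_bound hL hω
  obtain ⟨C, -, hC⟩ := hL.exists_field_bound Z U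
  have key : ∀ τ ∈ dom L.h ω, 0 ≤ τ → ∀ s ∈ Icc 0 τ, ∀ t ∈ Icc 0 τ,
      dist (x (r - 1) s) (x (r - 1) t) ≤ C * dist s t := by
    intro τ hτ h0
    obtain ⟨ζ, hζ, heq⟩ := hZ τ hτ h0
    refine dist_le_of_ae_deriv_le (g' := fun t => L.f (L.d t) (L.T ζ t) (L.control x t)) h0
      ((hx.lip τ hτ h0).ac h0) ?_
    filter_upwards [heq, hζ, ae_restrict_of_ae_restrict_of_subset Icc_subset_Ici_self hC,
      ae_restrict_mem measurableSet_Icc] with t h1 h2 h3 h4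
    exact ⟨h1, h3 _ _ h2 (hU t (Icc_zero_subset_dom hL.memory hτ.2 h4) h4.1)⟩
  refine LipOn.of_dist_le (C := C) fun s hs t ht => ?_
  have hmax : max s t ∈ dom L.h ω := by
    rcases max_choice s t with h | h <;> rw [h]
    exacts [hs.1, ht.1]
  exact key _ hmax (le_max_of_le_left hs.2) s ⟨hs.2, le_max_left _ _⟩ t ⟨ht.2, le_max_right _ _⟩

theorem StateSol.lipOn (hL : L.Admissible) (hω : 0 < ω) (hx : L.StateSol (dom L.h ω) x) {k : ℕ}
    (hk : k < r) : LipOn (x k) (dom L.h ω ∩ Ici 0) := by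
  rcases Nat.lt_or_ge (k + 1) r with h | h
  · obtain ⟨C, hC⟩ := hx.bounded hL hω h
    exact (lipOn_of_hasDerivWithinAt (convex_dom _ _) (hx.hasDeriv k h) hC).mono inter_subset_left
  · obtain rfl : k = r - 1 := by omega
    exact hx.lipOn_last hL hω

end

end ClosedLoop

end FunnelControl

namespace FunnelControl

/-! ### Continuation to the closed interval -/

/-- Rational endpoints suffice, so only countably many null sets are united. -/
theorem ae_restrict_Icc_of_forall_lt {a b : ℝ} {P : ℝ → Prop}
    (h : ∀ τ, a ≤ τ → τ < b → ∀ᵐ t ∂volume.restrict (Icc a τ), P t) :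
    ∀ᵐ t ∂volume.restrict (Icc a b), P t := by
  have h1 : ∀ᵐ t : ℝ, ∀ τ : ℚ, a ≤ τ → (τ : ℝ) < b → t ∈ Icc a (τ : ℝ) → P t := by
    refine ae_all_iff.2 fun τ => ?_
    by_cases h1 : a ≤ τ
    · by_cases h2 : (τ : ℝ) < b
      · filter_upwards [(ae_restrict_iff' measurableSet_Icc).1 (h τ h1 h2)] with t ht _ _ using ht
      · exact Eventually.of_forall fun t _ h3 => absurd h3 h2
    · exact Eventually.of_forall fun t h3 => absurd h3 h1
  rw [ae_restrict_Icc_iff_Ioo]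
  filter_upwards [ae_restrict_of_ae h1, ae_restrict_mem measurableSet_Ioo] with t h2 h3
  obtain ⟨τ, hτ, hτb⟩ := exists_rat_btwn h3.2
  exact h2 τ (h3.1.le.trans hτ.le) hτb ⟨h3.1.le, hτ.le⟩

theorem dom_coe {h b t : ℝ} : t ∈ dom h (b : EReal) ↔ -h ≤ t ∧ t < b := by
  rw [mem_dom, EReal.coe_lt_coe_iff]

namespace ClosedLoop

variable {m r p q : ℕ} {L : ClosedLoop m r p q}

/-- A solution on a bounded interval has a continuation to the closed interval. -/
theorem StateSol.exists_closed (hL : L.Admissible) {b : ℝ} (hb : 0 < b) {x : ℕ → ℝ → E m}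
    (hx : L.StateSol (dom L.h b) x) :
    ∃ z : ℕ → ℝ → E m, L.StateSol (Icc (-L.h) b) z ∧ ∀ k, EqOn (z k) (x k) (dom L.h b) := by
  have hr := hL.order_pos
  have hh := hL.memory
  have hω : (0 : EReal) < (b : EReal) := by exact_mod_cast hb
  have hG : ∀ k, ∃ G : ℝ → E m, k < r → LipOn G univ ∧ EqOn (x k) G (dom L.h b ∩ Ici 0) := by
    intro k
    by_cases hk : k < r
    · obtain ⟨K, hK⟩ := hx.lipOn hL hω hk
      obtain ⟨G, hG, hGx⟩ := hK.extend_finite_dimension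
      exact ⟨G, fun _ => ⟨⟨_, hG.lipschitzOnWith⟩, hGx⟩⟩
    · exact ⟨0, fun h => absurd h hk⟩
  choose G hG using hG
  -- The Lipschitz extension G supplies the limiting value at b.
  set z : ℕ → ℝ → E m := fun k t => if t < b then x k t else G k t with hz
  have hzx : ∀ k, EqOn (z k) (x k) (dom L.h b) := fun k t ht => if_pos (dom_coe.1 ht).2
  have hzG : ∀ k < r, EqOn (z k) (G k) (Ici 0) := by
    intro k hk t ht
    by_cases h : t < b
    · have h0 : (0 : ℝ) ≤ t := ht
      simp only [hz, if_pos h]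
      exact (hG k hk).2 ⟨dom_coe.2 ⟨by linarith, h⟩, ht⟩
    · simp only [hz, if_neg h]
  have hzlip : ∀ k < r, LipOn (z k) (Ici 0) := fun k hk =>
    ((hG k hk).1.mono (subset_univ _)).congr (hzG k hk)
  have hnhds : ∀ t < b, dom L.h b ∈ 𝓝[Icc (-L.h) b] t := fun t ht => by
    filter_upwards [self_mem_nhdsWithin, mem_nhdsWithin_of_mem_nhds (Iio_mem_nhds ht)]
      with s h1 h2 using dom_coe.2 ⟨h1.1, h2⟩
  have hdom : ∀ {t}, t ∈ Icc (-L.h) b → t < b → t ∈ dom L.h b := fun ht h => dom_coe.2 ⟨ht.1, h⟩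
  have hcont : ∀ k < r, ContinuousOn (z k) (Icc (-L.h) b) := by
    intro k hk t ht
    rcases ht.2.lt_or_eq with h | h
    · exact (((hx.cont k hk).congr (hzx k)) t (hdom ht h)).mono_of_mem_nhdsWithin (hnhds t h)
    · subst h
      exact ((hzlip k hk).continuousOn.continuousAt (Ici_mem_nhds hb)).continuousWithinAt
  have hsignal : ∀ t ∈ dom L.h b, ∀ k, L.signal x k t = L.signal z k t := fun t ht k =>
    signal_congr (hzx k ht).symm
  obtain ⟨ε, hε, hεb⟩ := hx.exists_rhoSig_bound hL hω
  have hεz : ∀ k ≤ r, ∀ t ∈ Ico 0 b, ‖L.rhoSig z k t‖ ≤ ε := fun k hk t ht => by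
    have htd : t ∈ dom L.h b := dom_coe.2 ⟨by linarith [ht.1], ht.2⟩
    rw [← rhoSig_congr fun j _ => (hzx j htd).symm]
    exact hεb k hk t htd ht.1
  -- The bound by ε < 1 is non-strict, hence survives the limit at b and keeps each ρ_k in the open
  -- ball.
  have hclos : ∀ k ≤ r, ContinuousOn (L.rhoSig z k) (Icc 0 b) →
      ∀ t ∈ Icc 0 b, ‖L.rhoSig z k t‖ ≤ ε := by
    intro k hk hc t ht
    rw [← closure_Ico hb.ne] at hc ht
    exact le_on_closure (hεz k hk) hc.norm continuousOn_const ht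
  have hsub0 : Icc 0 b ⊆ Icc (-L.h) b := Icc_subset_Icc_left (by linarith)
  have hρ := hL.rhoSig_continuousOn_of_norm_lt (fun k hk => (hcont k hk).mono hsub0)
    Icc_subset_Ici_self fun k hk hc t ht => (hclos k hk.le hc t ht).trans_lt hε.2
  refine ⟨z, ⟨hcont, fun k hk t ht => ?_, fun k hk t ht => ?_, fun τ _ _ =>
    (hzlip (r - 1) (by omega)).mono Icc_subset_Ici_self, fun t ht h0 => ?_,
    fun τ hτ h0 ζ hζ hζz => ?_⟩, hzx⟩
  · rcases ht.2.lt_or_eq with h | h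
    · have htd := hdom ht h
      rw [hzx (k + 1) htd]
      exact ((hx.hasDeriv k hk t htd).congr_of_mem (hzx k) htd).mono_of_mem_nhdsWithin (hnhds t h)
    · subst h
      have hder : ∀ s ∈ Ioo 0 t, HasDerivAt (z k) (z (k + 1) s) s := fun s hs => by
        have hsd : s ∈ dom L.h t := dom_coe.2 ⟨by linarith [hs.1], hs.2⟩
        rw [hzx (k + 1) hsd]
        exact ((hx.hasDeriv k hk s hsd).congr_of_mem (hzx k) hsd).hasDerivAt
          (dom_mem_nhds (by linarith [hs.1]) hsd.2)
      have hc : ∀ j < r, ContinuousAt (z j) t := fun j hj =>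
        (hzlip j hj).continuousOn.continuousAt (Ici_mem_nhds hb)
      -- At the right endpoint the one-sided derivative is the limit of the derivatives from the
      -- left.
      refine (hasDerivWithinAt_Iic_of_tendsto_deriv (s := Ioo 0 t)
        (fun s hs => (hder s hs).differentiableAt.differentiableWithinAt)
        (hc k (by omega)).continuousWithinAt (Ioo_mem_nhdsLT hb) ?_).mono Icc_subset_Iic_self
      refine Tendsto.congr' ?_ ((hc (k + 1) hk).tendsto.mono_left nhdsWithin_le_nhds)
      filter_upwards [Ioo_mem_nhdsLT hb] with s hs using (hder s hs).deriv.symm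
  · rw [hzx k (dom_coe.2 ⟨ht.1, ht.2.trans_lt hb⟩), hx.initial k hk ht]
  · exact memD_of_norm_rho_lt fun k hk => (hclos k hk (hρ k hk) t ⟨h0, ht.2⟩).trans_lt hε.2
  · refine ae_restrict_Icc_of_forall_lt fun σ hσ hστ => ?_
    have hσb : σ < b := hστ.trans_le hτ.2
    have hsub : Icc (-L.h) σ ⊆ dom L.h b := Icc_subset_dom (by exact_mod_cast hσb)
    have h1 := hx.equation σ (dom_coe.2 ⟨by linarith, hσb⟩) hσ ζ hζ fun s hs =>
      (hζz ⟨hs.1, hs.2.trans hστ.le⟩).trans (blocks_eq fun k _ => hzx k (hsub hs))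
    exact h1.congr hL.operator hr hσ le_rfl (fun k _ s hs =>
      (hzx k (hsub ⟨by linarith [hs.1], hs.2⟩)).symm) (eqOn_refl _ _) hζ hζ

/-! ### Gluing solutions, maximal extension and global existence -/

theorem IsSol.congr (hL : L.Admissible) {ω : EReal} {y z : ℝ → E m} (hz : L.IsSol ω z)
    (hzy : EqOn z y (dom L.h ω)) : L.IsSol ω y :=
  (hz.stateSol hL).isSol hL hz.pos fun t ht => by rw [yDer, iteratedDerivWithin_zero, hzy ht]

/-- The two domains coincide near every point of the smaller one, including the left endpoint. -/
theorem yDer_eqOn_of_le {h : ℝ} {ω ω' : EReal} (hle : ω ≤ ω') (y : ℝ → E m) (k : ℕ) :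
    EqOn (yDer h ω' y k) (yDer h ω y k) (dom h ω) := fun t ht => by
  have h1 : dom h ω' =ᶠ[𝓝 t] dom h ω := by
    have h2 : IsOpen {s : ℝ | (s : EReal) < ω} :=
      isOpen_lt continuous_coe_real_ereal continuous_const
    filter_upwards [h2.mem_nhds ht.2] with s hs
    exact propext ⟨fun h3 => ⟨h3.1, hs⟩, fun h3 => ⟨h3.1, h3.2.trans_le hle⟩⟩
  simp only [yDer, iteratedDerivWithin, iteratedFDerivWithin_congr_set h1]

/-- A function is a solution if it is one on arbitrarily large subintervals. -/
theorem IsSol.of_forall_lt (hL : L.Admissible) {Ω : EReal} (hΩ : 0 < Ω) {y : ℝ → E m}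
    (h : ∀ τ : ℝ, 0 ≤ τ → (τ : EReal) < Ω → ∃ ω, (τ : EReal) < ω ∧ ω ≤ Ω ∧ L.IsSol ω y) :
    L.IsSol Ω y := by
  have hr := hL.order_pos
  have hh := hL.memory
  have key : ∀ t ∈ dom L.h Ω, ∃ ω, t ∈ dom L.h ω ∧ ω ≤ Ω ∧ L.IsSol ω y := fun t ht => by
    obtain ⟨ω, h1, h2, h3⟩ := h (max t 0) (le_max_right _ _) (by
      rcases max_choice t 0 with h | h <;> rw [h]
      exacts [ht.2, by exact_mod_cast hΩ])
    exact ⟨ω, ⟨ht.1, lt_of_le_of_lt (by exact_mod_cast le_max_left _ _) h1⟩, h2, h3⟩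
  have hnhds : ∀ {t : ℝ} {ω : EReal}, t ∈ dom L.h ω → dom L.h ω ∈ 𝓝[dom L.h Ω] t := by
    intro t ω ht
    have h2 : IsOpen {s : ℝ | (s : EReal) < ω} :=
      isOpen_lt continuous_coe_real_ereal continuous_const
    filter_upwards [self_mem_nhdsWithin, mem_nhdsWithin_of_mem_nhds (h2.mem_nhds ht.2)]
      with s h3 h4 using ⟨h3.1, h4⟩
  refine StateSol.isSol hL hΩ (x := yDer L.h Ω y) ⟨fun k hk t ht => ?_, fun k hk t ht => ?_,
    fun k hk t ht => ?_, fun τ hτ h0 => ?_, fun t ht h0 => ?_, fun τ hτ h0 ζ hζ hζy => ?_⟩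
    fun t _ => by rw [yDer, iteratedDerivWithin_zero]
  · obtain ⟨ω, htω, hle, hy⟩ := key t ht
    exact ((((hy.stateSol hL).cont k hk).congr (yDer_eqOn_of_le hle y k)) t
      htω).mono_of_mem_nhdsWithin (hnhds htω)
  · obtain ⟨ω, htω, hle, hy⟩ := key t ht
    rw [yDer_eqOn_of_le hle y (k + 1) htω]
    exact (((hy.stateSol hL).hasDeriv k hk t htω).congr_of_mem (yDer_eqOn_of_le hle y k)
      htω).mono_of_mem_nhdsWithin (hnhds htω)
  · obtain ⟨ω, h0ω, hle, hy⟩ := h 0 le_rfl (by exact_mod_cast hΩ)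
    rw [yDer_eqOn_of_le hle y k (Icc_subset_dom h0ω ht)]
    exact hy.initial k hk ht
  · obtain ⟨ω, htω, hle, hy⟩ := key τ hτ
    exact ((hy.stateSol hL).lip τ htω h0).congr
      ((yDer_eqOn_of_le hle y _).mono (Icc_zero_subset_dom hh htω.2))
  · obtain ⟨ω, htω, hle, hy⟩ := key t ht
    refine memD_congr (fun j _ => ?_) ((hy.stateSol hL).mem_domain t htω h0)
    rw [signal_congr (yDer_eqOn_of_le hle y j htω)]
  · obtain ⟨ω, htω, hle, hy⟩ := key τ hτ
    have h1 := (hy.stateSol hL).equation τ htω h0 ζ hζ fun s hs => (hζy hs).trans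
      (blocks_eq fun k _ => yDer_eqOn_of_le hle y k (Icc_subset_dom htω.2 hs))
    exact h1.congr hL.operator hr h0 le_rfl (fun k _ => ((yDer_eqOn_of_le hle y k).mono
      (Icc_zero_subset_dom hh htω.2)).symm) (eqOn_refl _ _) hζ hζ

/-- `y` is a maximal solution of the closed loop on `[-h, ω)`. -/
abbrev IsMaxSol (L : ClosedLoop m r p q) (ω : EReal) (y : ℝ → E m) : Prop :=
  IsMaximalSolution r L.rhat L.h L.d L.f L.T L.φ L.N L.α L.yref L.y0 ω y

/-- Zorn's lemma for extensions of y. The relation is only a preorder, since functions may differ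
off their domains; transitivity is enough. -/
theorem IsSol.exists_maximal (hL : L.Admissible) {ω : EReal} {y : ℝ → E m} (hy : L.IsSol ω y) :
    ∃ (ω' : EReal) (z : ℝ → E m), ω ≤ ω' ∧ EqOn z y (dom L.h ω) ∧ L.IsMaxSol ω' z := by
  let P := {s : EReal × (ℝ → E m) // L.IsSol s.1 s.2 ∧ ω ≤ s.1 ∧ EqOn s.2 y (dom L.h ω)}
  let R : P → P → Prop := fun a b => a.1.1 ≤ b.1.1 ∧ EqOn b.1.2 a.1.2 (dom L.h a.1.1)
  have hdom : ∀ {a b : EReal}, a ≤ b → dom L.h a ⊆ dom L.h b := fun hab t ht =>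
    ⟨ht.1, ht.2.trans_le hab⟩
  have hchain : ∀ c : Set P, IsChain R c → ∃ u, ∀ s ∈ c, R s u := by
    intro c hc
    rcases c.eq_empty_or_nonempty with rfl | ⟨s₀, hs₀⟩
    · exact ⟨⟨(ω, y), hy, le_rfl, eqOn_refl _ _⟩, by simp⟩
    classical
    let Ω : EReal := ⨆ s : c, s.1.1.1
    have hΩ : ∀ s ∈ c, s.1.1 ≤ Ω := fun s hs => le_iSup (fun s : c => s.1.1.1) ⟨s, hs⟩
    have hex : ∀ t : ℝ, (t : EReal) < Ω → ∃ s ∈ c, (t : EReal) < s.1.1 := fun t ht => by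
      obtain ⟨⟨s, hs⟩, h⟩ := lt_iSup_iff.1 ht
      exact ⟨s, hs, h⟩
    -- Any member of the chain that is defined at t may supply the value, because members agree on
    -- common domains.
    let Y : ℝ → E m := fun t => if h : (t : EReal) < Ω then (hex t h).choose.1.2 t else 0
    have hY : ∀ s ∈ c, EqOn Y s.1.2 (dom L.h s.1.1) := by
      intro s hs t ht
      have htΩ : (t : EReal) < Ω := ht.2.trans_le (hΩ s hs)
      obtain ⟨h1, h2⟩ := (hex t htΩ).choose_spec
      have h3 : Y t = (hex t htΩ).choose.1.2 t := dif_pos htΩ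
      rw [h3]
      by_cases heq : (hex t htΩ).choose = s
      · rw [heq]
      · rcases hc h1 hs heq with h | h
        · exact (h.2 ⟨ht.1, h2⟩).symm
        · exact h.2 ht
    have hYsol : L.IsSol Ω Y := by
      refine IsSol.of_forall_lt hL (s₀.2.1.pos.trans_le (hΩ s₀ hs₀)) fun τ _ hτ => ?_
      obtain ⟨s, hs, h1⟩ := hex τ hτ
      exact ⟨s.1.1, h1, hΩ s hs, s.2.1.congr hL (hY s hs).symm⟩
    refine ⟨⟨(Ω, Y), hYsol, s₀.2.2.1.trans (hΩ s₀ hs₀),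
      ((hY s₀ hs₀).mono (hdom s₀.2.2.1)).trans s₀.2.2.2⟩, fun s hs => ⟨hΩ s hs, hY s hs⟩⟩
  obtain ⟨⟨⟨ω', z⟩, hz, hle, hzy⟩, hmax⟩ := exists_maximal_of_chains_bounded hchain
    fun hab hbc => ⟨hab.1.trans hbc.1, (hbc.2.mono (hdom hab.1)).trans hab.2⟩
  refine ⟨ω', z, hle, hzy, hz, fun ω'' z' hz' hle' hzz' => ?_⟩
  have := hmax ⟨⟨ω'', z'⟩, hz', hle.trans hle', (hzz'.mono (hdom hle)).trans hzy⟩ ⟨hle', hzz'⟩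
  exact le_antisymm this.1 hle'

/-- A finite endpoint would allow closing the solution there and extending it further, against
maximality. -/
theorem IsMaxSol.eq_top (hL : L.Admissible) {ω : EReal} {y : ℝ → E m} (hy : L.IsMaxSol ω y) :
    ω = ⊤ := by
  by_contra hne
  have hpos := hy.1.pos
  lift ω to ℝ using ⟨hne, fun h => by simp [h] at hpos⟩ with b
  have hb : 0 < b := by exact_mod_cast hpos
  obtain ⟨z, hz, hzx⟩ := (IsSol.stateSol hL hy.1).exists_closed hL hb
  obtain ⟨ω', y', hω', hy', hyz⟩ := hz.exists_extension hL hb.le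
  refine hω'.ne' (hy.2 ω' y' hy' hω'.le fun t ht => ?_)
  rw [hyz ⟨ht.1, (dom_coe.1 ht).2.le⟩, hzx 0 ht, yDer, iteratedDerivWithin_zero]

/-- The initial data are themselves a state trajectory on [-h, 0], where the equation is imposed
only on a null set; extension to the right does the rest. -/
theorem Admissible.exists_isSol (hL : L.Admissible) : ∃ ω y, L.IsSol ω y := by
  have hh := hL.memory
  have key : L.StateSol (Icc (-L.h) 0) L.y0 := by
    refine ⟨hL.initialData.1, hL.initialData.2, fun k _ => eqOn_refl _ _, fun τ hτ h0 => ?_,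
      fun t ht h0 => ?_, fun τ hτ h0 ζ _ _ => ?_⟩
    · obtain rfl : τ = 0 := le_antisymm hτ.2 h0
      refine LipOn.of_dist_le (C := 0) fun s hs t ht => ?_
      rw [le_antisymm hs.2 hs.1, le_antisymm ht.2 ht.1]
      simp
    · obtain rfl : t = 0 := le_antisymm ht.2 h0
      exact hL.init
    · obtain rfl : τ = 0 := le_antisymm hτ.2 h0
      simp [StateEq]
  obtain ⟨ω, y, -, hy, -⟩ := key.exists_extension hL le_rfl
  exact ⟨ω, y, hy⟩

end ClosedLoop

end FunnelControl

namespace FunnelControl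

/-! ### Properties of global solutions -/

theorem dom_top (h : ℝ) : dom h ⊤ = Ici (-h) := by
  ext t
  simp [mem_dom]

theorem IsSmoothChain.congr {n k : ℕ} {I : Set ℝ} {D D' : ℕ → ℝ → E n} (hD : IsSmoothChain k I D)
    (h : ∀ j < k, EqOn (D' j) (D j) I) : IsSmoothChain k I D' := by
  refine ⟨fun j hj t ht => ?_, fun j hj => (hD.lip j hj).congr (h j hj), fun j hj => ?_⟩
  · rw [h (j + 1) hj ht]
    exact (hD.hasDeriv j hj t ht).congr_of_mem (h j (by omega)) ht
  · obtain ⟨C, hC⟩ := hD.bdd j hj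
    exact ⟨C, fun t ht => by rw [h j hj ht]; exact hC t ht⟩

theorem MemWInf.isSmoothChain_refDer {m r : ℕ} (hr : 1 ≤ r) {yref : ℝ → E m}
    (h : MemWInf r (Ici 0) yref) (hc : ContinuousOn yref (Ici 0)) :
    IsSmoothChain r (Ici 0) (refDer yref) := by
  obtain ⟨D, hD0, hD⟩ := h.exists_isSmoothChain (convex_Ici 0) (by simp) hc hr
  exact hD.congr (iteratedDerivWithin_eq_of_hasDerivWithinAt (uniqueDiffOn_Ici 0) hD.hasDeriv
    hD0.symm)

namespace ClosedLoop

variable {m r p q : ℕ} {L : ClosedLoop m r p q} {x : ℕ → ℝ → E m}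

theorem StateSol.memLp_control (hL : L.Admissible) (hx : L.StateSol (dom L.h ⊤) x) :
    MemLp (L.control x) ⊤ (volume.restrict (Ici 0)) := by
  have hsub : Ici 0 ⊆ dom L.h ⊤ := by
    rw [dom_top]
    exact Ici_subset_Ici.2 (by linarith [hL.memory])
  obtain ⟨U, hU⟩ := hx.exists_control_bound hL EReal.zero_lt_top
  refine memLp_top_of_bound ((hL.control_continuousOn (fun k hk => (hx.cont k hk).mono hsub)
    subset_rfl fun t ht => hx.mem_domain t (hsub ht) ht).aestronglyMeasurable measurableSet_Ici) U ?_
  filter_upwards [ae_restrict_mem measurableSet_Ici] with t ht using hU t (hsub ht) ht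

theorem StateSol.isSmoothChain_Ici (hL : L.Admissible) (hx : L.StateSol (dom L.h ⊤) x) :
    IsSmoothChain r (Ici 0) x := by
  have hsub : Ici 0 ⊆ dom L.h ⊤ := by
    rw [dom_top]
    exact Ici_subset_Ici.2 (by linarith [hL.memory])
  refine ⟨fun k hk t ht => (hx.hasDeriv k hk t (hsub ht)).mono hsub, fun k hk =>
    (hx.lipOn hL EReal.zero_lt_top hk).mono fun t ht => ⟨hsub ht, ht⟩, fun k hk => ?_⟩
  obtain ⟨C, hC⟩ := hx.bounded hL EReal.zero_lt_top hk
  exact ⟨C, fun t ht => hC t (hsub ht)⟩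

theorem StateSol.isSmoothChain_dom (hL : L.Admissible) (hx : L.StateSol (dom L.h ⊤) x)
    (h0 : MemWInf r (Icc (-L.h) 0) (L.y0 0)) : IsSmoothChain r (Ici (-L.h)) x := by
  have hr := hL.order_pos
  have hch := hx.isSmoothChain_Ici hL
  rcases hL.memory.eq_or_lt with hh | hh
  -- For h = 0 there is no history. For h > 0 the Sobolev regularity of the data is needed for the
  -- Lipschitz property of the last derivative left of 0.
  · rwa [← hh, neg_zero]
  obtain ⟨D, hD0, hD⟩ := h0.exists_isSmoothChain (convex_Icc _ _) (by simp [hh])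
    (hL.initialData.1 0 hr) hr
  have hDy := hasDerivWithinAt_chain_unique (uniqueDiffOn_Icc (by linarith)) hD.hasDeriv
    hL.initialData.2 hD0
  have hb := fun k hk => hx.bounded hL EReal.zero_lt_top (k := k) hk
  have hd := hx.hasDeriv
  rw [dom_top] at hb hd
  refine ⟨hd, fun k hk => ?_, hb⟩
  refine LipOn.of_inter_Iic_Ici ordConnected_Ici (b := 0) ?_ ((hch.lip k hk).mono inter_subset_right)
  exact (hD.lip k hk).congr fun t ht => (hx.initial k hk ht).trans (hDy k hk ht).symm

theorem StateSol.exists_funnel_bound (hL : L.Admissible) (hx : L.StateSol (dom L.h ⊤) x) :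
    ∃ ε ∈ Ioo (0 : ℝ) 1, ∀ t : ℝ, 0 ≤ t → L.φ t * ‖x 0 t - L.yref t‖ ≤ ε := by
  obtain ⟨ε, hε, h⟩ := hx.exists_rhoSig_bound hL EReal.zero_lt_top
  refine ⟨ε, hε, fun t ht => ?_⟩
  have h1 := h 1 hL.order_pos t (by rw [dom_top]; exact (neg_nonpos.2 hL.memory).trans ht) ht
  have h2 : L.rhoSig x 1 t = L.φ t • (x 0 t - L.yref t) := by
    simp [rhoSig, rho, gam, signal, refDer, show 0 < L.rhat from hL.rhat_pos]
  rwa [h2, norm_smul, Real.norm_of_nonneg (hL.funnel.nonneg t ht)] at h1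

/-- φ e^{(k)} = ρ_{k+1} - γ(ρ_k) is bounded, so e^{(k)} decays at least like 1/φ. The filter encodes
all sequences of nonnegative times along which φ tends to infinity. -/
theorem StateSol.tendsto_error (hL : L.Admissible) (hx : L.StateSol (dom L.h ⊤) x)
    (hrhat : L.rhat = r) {k : ℕ} (hk : k < r) :
    Tendsto (fun t => x k t - refDer L.yref k t) (comap L.φ atTop ⊓ 𝓟 (Ici 0)) (𝓝 0) := by
  obtain ⟨ε, hε, h⟩ := hx.exists_rhoSig_bound hL EReal.zero_lt_top
  obtain ⟨B, hB⟩ := (gam_lipOn (m := m) hL.smooth hε.2).2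
  have hφ : Tendsto L.φ (comap L.φ atTop ⊓ 𝓟 (Ici 0)) atTop :=
    tendsto_comap.mono_left inf_le_left
  have hlim : Tendsto (fun t => (ε + B) * (L.φ t)⁻¹) (comap L.φ atTop ⊓ 𝓟 (Ici 0)) (𝓝 0) := by
    simpa using (tendsto_inv_atTop_zero.comp hφ).const_mul (ε + B)
  refine squeeze_zero_norm' ?_ hlim
  filter_upwards [hφ.eventually_gt_atTop 0, mem_inf_of_right (mem_principal_self _)] with t hpos ht
  have htd : t ∈ dom L.h ⊤ := by rw [dom_top]; exact (neg_nonpos.2 hL.memory).trans ht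
  have h1 := h (k + 1) hk t htd ht
  have h2 := hB (L.rhoSig x k t) (by simpa using h k hk.le t htd ht)
  have h3 : L.φ t • (x k t - refDer L.yref k t) =
      L.rhoSig x (k + 1) t - gam L.α (L.rhoSig x k t) := by
    simp [rhoSig, rho, signal, hrhat, hk]
  have h4 : L.φ t * ‖x k t - refDer L.yref k t‖ ≤ ε + B := by
    rw [← Real.norm_of_nonneg hpos.le, ← norm_smul, h3]
    exact (norm_sub_le _ _).trans (add_le_add h1 h2)
  rw [← div_eq_mul_inv, le_div_iff₀ hpos, mul_comm]
  exact h4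

end ClosedLoop

end FunnelControl

/-! ### The main theorem -/

theorem theorem1 {m r p q : ℕ} (hm : 1 ≤ m) (hr : 1 ≤ r)
    -- the system, of class `𝒩^{m,r}`, and the initial data
    (h : ℝ) (d : ℝ → E p) (f : E p → E q → E m → E m) (T : (ℝ → Blocks r m) → ℝ → E q)
    (hsys : IsSystem h d f T)
    (y0 : ℕ → ℝ → E m) (hy0 : IsInitialData r h y0)
    -- the reference signal (its continuous representative)
    (yref : ℝ → E m) (hyref : MemWInf r (Ici 0) yref) (hyref_cont : ContinuousOn yref (Ici 0))
    (rhat : ℕ) (hrhat_pos : 1 ≤ rhat) (hrhat : rhat ≤ r)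
    -- the design parameters
    (φ : ℝ → ℝ) (hφ : IsFunnelFunction φ) (hφ_bdd : rhat < r → BddAbove (φ '' Ici 0))
    (α : ℝ → ℝ) (hα : ContDiffOn ℝ 1 α (Ico 0 1)) (hα_bij : BijOn α (Ico 0 1) (Ici 1))
    (N : ℝ → ℝ)
    (hN : (ContinuousOn N (Ici 0) ∧ SurjOn N (Ici 0) univ) ∨
      (NegDefHighGain f ∧ ∀ s, 0 ≤ s → N s = s) ∨
      (PosDefHighGain f ∧ ∀ s, 0 ≤ s → N s = -s))
    -- the condition `φ(0) 𝐞(0) ∈ 𝒟_r`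
    (hinit : memD α (fun k => φ 0 • initInfo rhat yref y0 k) r) :
    -- there is a solution
    (∃ (ω : EReal) (y : ℝ → E m), IsSolution r rhat h d f T φ N α yref y0 ω y) ∧
    -- every solution can be maximally extended
    (∀ (ω : EReal) (y : ℝ → E m), IsSolution r rhat h d f T φ N α yref y0 ω y →
      ∃ (ω' : EReal) (z : ℝ → E m), ω ≤ ω' ∧ EqOn z y (dom h ω) ∧
        IsMaximalSolution r rhat h d f T φ N α yref y0 ω' z) ∧
    -- every maximal solution has the following properties
    (∀ (ω : EReal) (y : ℝ → E m), IsMaximalSolution r rhat h d f T φ N α yref y0 ω y →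
      -- it is global
      ω = ⊤ ∧
      -- the input is bounded
      MemLp (uSig r rhat h φ N α ⊤ yref y) ⊤ (volume.restrict (Ici 0)) ∧
      -- the output and its derivatives are bounded
      MemWInf r (Ici 0) y ∧
      (∀ k < r, ∃ C : ℝ, ∀ t ∈ Ici (-h), ‖yDer h ⊤ y k t‖ ≤ C) ∧
      (MemWInf r (Icc (-h) 0) (y0 0) → MemWInf r (Ici (-h)) y) ∧
      -- the error evolves in the funnel, uniformly bounded away from its boundary
      (∃ ε ∈ Ioo (0 : ℝ) 1, ∀ t : ℝ, 0 ≤ t → φ t * ‖y t - yref t‖ ≤ ε) ∧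
      -- asymptotic tracking
      (rhat = r → ∀ k < r,
        Tendsto (eDer h ⊤ yref y k) (comap φ atTop ⊓ 𝓟 (Ici 0)) (𝓝 0) ∧
        (Tendsto φ atTop atTop → Tendsto (eDer h ⊤ yref y k) atTop (𝓝 0)))) := by
  let L : ClosedLoop m r p q :=
    { rhat := rhat, h := h, d := d, f := f, T := T, φ := φ, N := N, α := α, yref := yref, y0 := y0 }
  -- S is ℝ for a surjective N, (0, ∞) for the identity and (-∞, 0) for its negative; each is paired
  -- with the matching high-gain property.
  have hgain : ContinuousOn N (Ici 0) ∧ ∃ S, SurjOn N (Ici 0) S ∧ HighGainOn S f := by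
    rcases hN with ⟨hc, hs⟩ | ⟨hf, hs⟩ | ⟨hf, hs⟩
    · exact ⟨hc, univ, hs, hsys.highGain⟩
    · exact ⟨continuousOn_id.congr hs, Ioi 0, fun s hs0 =>
        ⟨s, mem_Ici.2 (le_of_lt hs0), hs s (le_of_lt hs0)⟩, hf⟩
    · refine ⟨continuousOn_neg.congr hs, Iio 0, fun s hs0 => ?_, hf⟩
      have h0 : 0 ≤ -s := neg_nonneg.2 (le_of_lt hs0)
      exact ⟨-s, h0, by rw [hs _ h0, neg_neg]⟩
  have hL : L.Admissible :=
    { order_pos := hr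
      memory := hsys.memory_nonneg
      disturbance := hsys.disturbance
      field := hsys.continuous
      operator := hsys.operator
      gain := hgain
      initialData := hy0
      ref := hyref.isSmoothChain_refDer hr hyref_cont
      rhat_pos := hrhat_pos
      rhat_le := hrhat
      funnel := hφ
      funnel_bdd := hφ_bdd
      bij := hα_bij
      smooth := hα
      init := hinit }
  refine ⟨hL.exists_isSol, fun ω y hy => ClosedLoop.IsSol.exists_maximal (L := L) hL hy,
    fun ω y hy => ?_⟩
  obtain rfl : ω = ⊤ := ClosedLoop.IsMaxSol.eq_top (L := L) hL hy
  have hx : L.StateSol (dom L.h ⊤) (yDer L.h ⊤ y) := ClosedLoop.IsSol.stateSol hL hy.1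
  have hy0' : yDer L.h ⊤ y 0 = y := by
    funext t
    rw [yDer, iteratedDerivWithin_zero]
  refine ⟨rfl, hx.memLp_control hL, ?_, fun k hk => ?_, fun h0 => ?_, ?_, fun hrr k hk => ?_⟩
  · rw [← hy0']
    exact (hx.isSmoothChain_Ici hL).memWInf (convex_Ici 0) hr
  · obtain ⟨C, hC⟩ := hx.bounded hL EReal.zero_lt_top hk
    exact ⟨C, by rwa [dom_top] at hC⟩
  · rw [← hy0']
    exact (hx.isSmoothChain_dom hL h0).memWInf (convex_Ici _) hr
  · have h1 := hx.exists_funnel_bound hL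
    rwa [hy0'] at h1
  · have h1 := hx.tendsto_error hL hrr hk
    exact ⟨h1, fun hφt => h1.mono_left
      (le_inf (map_le_iff_le_comap.1 hφt) (le_principal_iff.2 (Ici_mem_atTop 0)))⟩
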